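/- **Conventions.** A complex surface is a Hausdorff complex manifold of dimension 2. For a composition $E:X\to Y$ of blowing-ups that is an isomorphism outside $p\in Y$, and for $S\subset Y$, the *strict transform* of $S$ is the closure of $E^{-1}(S\setminus\{p\})$ and the *attaching locus* of $S$ is its intersection with $E^{-1}(p)$. Define $\mathfrak E^{n}(p,S)=E_1\circ\cdots\circ E_n$, where $E_i$ is the blowing-up centered at the attaching locus of $S$ with respect to $E_1\circ\cdots\circ E_{i-1}$ (so $E_1$ is centered at $p$); its *$i$-component* $D_i$ is the strict transform of the exceptional curve of $E_i$. A *desingularization* of a curve $C$ is a finite composition $E$ of blowing-ups of points such that $E^{-1}(C)$ has only normal crossings (near each of its points it is given by $s=0$ or $st=0$ in suitable local coordinates); it is *minimal* if every desingularization of $C$ factors through it by a holomorphic map. **Proposition.** Let $1\le\alpha<\beta$ be coprime integers, $\gamma\geq 1$, and let $f=\sum_{\alpha i+\beta j=\gamma}a_{ij}u^iv^j\in\mathbb C[u,v]$ be reduced (square-free). Let $\Omega$ be any open neighborhood of $0$ in $\mathbb C^2$ and $C=f^{-1}(0)\cap\Omega$. Let $q_1,\dots,q_{N+1}$ be the successive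 quotients in the Euclidean algorithm for $(\beta,\alpha)$: $r_0=\beta$, $r_1=\alpha$, $r_{i}=q_{i+1}r_{i+1}+r_{i+2}$ for $0\le i<N$, and $r_N=q_{N+1}r_{N+1}$. Then there is a composition $$E=\mathfrak E^{q_1}(p_1,S_1)\circ\mathfrak E^{q_2}(p_2,S_2)\circ\cdots\circ\mathfrak E^{q_{N+1}}(p_{N+1},S_{N+1}):\mathcal M\to\Omega$$ where $p_1=0$, $S_1=\{v=0\}$, and, for $1\le i\le N$, $p_{i+1}$ is the attaching point of $S_i$ with respect to $\mathfrak E^{q_i}(p_i,S_i)$ (for $i\ge2$: the intersection point of the last component of $\mathfrak E^{q_i}(p_i,S_i)$ with the strict transform of the last component of $\mathfrak E^{q_{i-1}}(p_{i-1},S_{i-1})$), and $S_{i+1}$ is the last component (the $q_i$-component) of $\mathfrak E^{q_i}(p_i,S_i)$; all the attaching loci used as centers are single points. Moreover, for every such $E$: 1. $E$ is a desingularization of $C$, and the strict transform of $C$ is smooth. If $C$ does not already have a normal crossing at $0$, then $E$ is the minimal desingularization of $C$. 2. The exceptional divisor $E^{-1}(0)$ is the union of the strict transforms of the components of all the $\mathfrak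 E^{q_i}(p_i,S_i)$, and these can be ordered so as to form a chain: two consecutive ones meet in exactly one point, any two others are disjoint. The strict transform of $\{u=0\}$ meets only the first member of the chain, that of $\{v=0\}$ only the last one. 3. The $q_{N+1}$-component of $\mathfrak E^{q_{N+1}}(p_{N+1},S_{N+1})$ is the central component: if $f$ vanishes at some point of $\Omega$ off the axes, it is the one and only component that meets the strict transform of $C\setminus\{uv=0\}$. -/

import Mathlib

open scoped Manifold ContDiff

/-- A complex surface: a Hausdorff complex-analytic manifold of dimension two. -/
structure ComplexSurface : Type 1 where
  carrier : Type
  [top : TopologicalSpace carrier]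
  [t2 : T2Space carrier]
  [charted : ChartedSpace (ℂ × ℂ) carrier]
  [mfd : IsManifold 𝓘(ℂ, ℂ × ℂ) ω carrier]

namespace ComplexSurface

instance : CoeSort ComplexSurface Type := ⟨ComplexSurface.carrier⟩

attribute [instance] ComplexSurface.top ComplexSurface.t2 ComplexSurface.charted
  ComplexSurface.mfd

/-- An open subset of `ℂ²`, as a complex surface. -/
noncomputable def ofOpens (Ω : TopologicalSpace.Opens (ℂ × ℂ)) : ComplexSurface where
  carrier := Ω

/-- Holomorphic maps between complex surfaces. -/
def IsHolomorphic {X Y : ComplexSurface} (E : X → Y) : Prop :=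
  ContMDiff 𝓘(ℂ, ℂ × ℂ) 𝓘(ℂ, ℂ × ℂ) ω E

/-- The local holomorphic coordinate systems of a complex surface. -/
abbrev coords (X : ComplexSurface) : Set (OpenPartialHomeomorph X (ℂ × ℂ)) :=
  IsManifold.maximalAtlas 𝓘(ℂ, ℂ × ℂ) ω X

/-- `E : X → Y` is the blowing-up of the surface `Y` at the point `p` (up to isomorphism over `Y`):
it is biholomorphic over `Y ∖ {p}`, and over the domain of some coordinate system `φ = (x, y)`
centred at `p` it is covered by the two standard charts `(s, t)` of a blowing-up, in which it reads
`(x, y) = (s, s t)` and `(x, y) = (s t, t)`. (As `X` is Hausdorff, the two charts are glued in the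
usual way.) -/
def IsBlowup {X Y : ComplexSurface} (E : X → Y) (p : Y) : Prop :=
  IsHolomorphic E ∧
  (∀ y, y ≠ p → ∃! x, E x = y) ∧
  (∀ x, E x ≠ p → IsLocalDiffeomorphAt 𝓘(ℂ, ℂ × ℂ) 𝓘(ℂ, ℂ × ℂ) ω E x) ∧
  ∃ φ ∈ Y.coords, p ∈ φ.source ∧ φ p = 0 ∧
    ∃ ψ₁ ∈ X.coords, ∃ ψ₂ ∈ X.coords,
      E ⁻¹' φ.source = ψ₁.source ∪ ψ₂.source ∧
      ψ₁.target = {z | (z.1, z.1 * z.2) ∈ φ.target} ∧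
      ψ₂.target = {z | (z.1 * z.2, z.2) ∈ φ.target} ∧
      (∀ x ∈ ψ₁.source, φ (E x) = ((ψ₁ x).1, (ψ₁ x).1 * (ψ₁ x).2)) ∧
      (∀ x ∈ ψ₂.source, φ (E x) = ((ψ₂ x).1 * (ψ₂ x).2, (ψ₂ x).2))

/-- Finite compositions of blowing-ups of points, over a fixed surface `Y`. -/
inductive IsBlowupComposition (Y : ComplexSurface) : (X : ComplexSurface) → (X → Y) → Prop
  | refl : IsBlowupComposition Y Y id
  | step {X X' : ComplexSurface} {E : X → Y} {F : X' → X} {q : X} :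
      IsBlowupComposition Y X E → IsBlowup F q → IsBlowupComposition Y X' (E ∘ F)

/-- The strict transform of `S` by a map `E` that is an isomorphism outside `p`. -/
def strictTransform {X Y : ComplexSurface} (E : X → Y) (p : Y) (S : Set Y) : Set X :=
  closure (E ⁻¹' (S \ {p}))

/-- The attaching locus of `S` with respect to `E`: the intersection of the strict transform
with the exceptional divisor. -/
def attachingLocus {X Y : ComplexSurface} (E : X → Y) (p : Y) (S : Set Y) : Set X :=
  strictTransform E p S ∩ E ⁻¹' {p}

/-- `IsBlowupChain p S n X E D`: the map `E : X → Y` is the composition `𝔈ⁿ(p, S) = E₁ ∘ ⋯ ∘ Eₙ`,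
where `Eᵢ` is the blowing-up centred at the attaching locus of `S` with respect to
`E₁ ∘ ⋯ ∘ Eᵢ₋₁`, and `D = [D₁, …, Dₙ]` lists the components of its exceptional divisor (`Dᵢ` is the
strict transform in `X` of the exceptional curve of `Eᵢ`). -/
inductive IsBlowupChain {Y : ComplexSurface} (p : Y) (S : Set Y) :
    (n : ℕ) → (X : ComplexSurface) → (X → Y) → List (Set X) → Prop
  | nil : IsBlowupChain p S 0 Y id []
  | step {n : ℕ} {X X' : ComplexSurface} {E : X → Y} {F : X' → X} {D : List (Set X)} {q : X} :
      IsBlowupChain p S n X E D → attachingLocus E p S = {q} → IsBlowup F q →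
      IsBlowupChain p S (n + 1) X' (E ∘ F) (D.map (strictTransform F q) ++ [F ⁻¹' {q}])

/-- `IsChainComposition [q₁, …, qₘ] Y p S X E D`: the map `E : X → Y` is a composition
`𝔈^{q₁}(p₁, S₁) ∘ ⋯ ∘ 𝔈^{qₘ}(pₘ, Sₘ)` where `p₁ = p`, `S₁ = S`, the point `pᵢ₊₁` is the attaching
point of `Sᵢ` with respect to `𝔈^{qᵢ}(pᵢ, Sᵢ)`, and `Sᵢ₊₁` is the last (the `qᵢ`-th) component of
`𝔈^{qᵢ}(pᵢ, Sᵢ)`. The list `D` consists of the components of the exceptional divisor in `X`, in the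
order of their creation. -/
inductive IsChainComposition : List ℕ → (Y : ComplexSurface) → Y → Set Y →
    (X : ComplexSurface) → (X → Y) → List (Set X) → Prop
  | nil (Y : ComplexSurface) (p : Y) (S : Set Y) : IsChainComposition [] Y p S Y id []
  | cons {n : ℕ} {l : List ℕ} {Y Y' X : ComplexSurface} {p : Y} {S : Set Y} {p' : Y'} {S' : Set Y'}
      {E₁ : Y' → Y} {E₂ : X → Y'} {D₁ : List (Set Y')} {D₂ : List (Set X)} :
      IsBlowupChain p S n Y' E₁ D₁ → attachingLocus E₁ p S = {p'} → D₁.getLast? = some S' →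
      IsChainComposition l Y' p' S' X E₂ D₂ →
      IsChainComposition (n :: l) Y p S X (E₁ ∘ E₂) (D₁.map (strictTransform E₂ p') ++ D₂)

/-- The curve `Z` is smooth at `x`: it reads `s = 0` in suitable coordinates `(s, t)` at `x`. -/
def IsSmoothCurveAt {X : ComplexSurface} (Z : Set X) (x : X) : Prop :=
  ∃ φ ∈ X.coords, x ∈ φ.source ∧ φ x = 0 ∧ ∀ y ∈ φ.source, y ∈ Z ↔ (φ y).1 = 0

/-- The curve `Z` has a normal crossing at its point `x`: it reads `s = 0` or `s t = 0` in suitable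
coordinates `(s, t)` at `x`. -/
def HasNormalCrossingAt {X : ComplexSurface} (Z : Set X) (x : X) : Prop :=
  IsSmoothCurveAt Z x ∨
  ∃ φ ∈ X.coords, x ∈ φ.source ∧ φ x = 0 ∧ ∀ y ∈ φ.source, y ∈ Z ↔ (φ y).1 * (φ y).2 = 0

/-- A desingularization of the curve `C`: a composition of blowing-ups of points such that the total
transform of `C` has only normal crossings. -/
def IsDesingularization {X Y : ComplexSurface} (E : X → Y) (C : Set Y) : Prop :=
  IsBlowupComposition Y X E ∧ ∀ x ∈ E ⁻¹' C, HasNormalCrossingAt (E ⁻¹' C) x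

/-- The minimal desingularization: every other one factors through it. -/
def IsMinimalDesingularization {X Y : ComplexSurface} (E : X → Y) (C : Set Y) : Prop :=
  IsDesingularization E C ∧
  ∀ (X' : ComplexSurface) (E' : X' → Y), IsDesingularization E' C →
    ∃ g : X' → X, IsHolomorphic g ∧ E ∘ g = E'

/-- A list of curves forms a chain: consecutive ones meet in exactly one point, any other two are
disjoint. -/
def IsChainOfCurves {X : ComplexSurface} (L : List (Set X)) : Prop :=
  ∀ (i j : ℕ) (hi : i < L.length) (hj : j < L.length),
    (j = i + 1 → ∃ x, L[i] ∩ L[j] = {x}) ∧ (i + 1 < j → L[i] ∩ L[j] = ∅)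

/-- The point `0` of an open subset of `ℂ²`. -/
noncomputable def origin (Ω : TopologicalSpace.Opens (ℂ × ℂ)) (h0 : (0 : ℂ × ℂ) ∈ Ω) : ofOpens Ω :=
  (⟨0, h0⟩ : Ω)

/-- The zero set, in an open subset of `ℂ²`, of a polynomial in the coordinates `u`, `v`. -/
def zeroSet (Ω : TopologicalSpace.Opens (ℂ × ℂ)) (f : MvPolynomial (Fin 2) ℂ) : Set (ofOpens Ω) :=
  {z : Ω | MvPolynomial.eval ![(z : ℂ × ℂ).1, (z : ℂ × ℂ).2] f = 0}

end ComplexSurface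

/-- The successive quotients in the Euclidean algorithm for the pair `(a, b)`. -/
def euclidQuotients (a b : ℕ) : List ℕ :=
  if _h : b = 0 then [] else (a / b) :: euclidQuotients b (a % b)
termination_by b
decreasing_by exact Nat.mod_lt _ (Nat.pos_of_ne_zero _h)

open Set Filter Topology

/-! ### Local coordinates and local biholomorphisms. -/

namespace ComplexSurface

variable {X Y Z : ComplexSurface}

/-! Everything stays monomial. Suppose that a chart (s, t) of a surface over Ω reads u = s^(w.1)
t^(w'.1), v = s^(w.2) t^(w'.2), where the exponents `w`, `w'` have determinant 1. Blowing up its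
origin replaces it by two charts of the same kind, with exponents w, w + w' and w + w', w'. So, in a
chain of curves with exponents (1, 0), …, (0, 1), blowing up the corner of two consecutive curves
inserts between them a curve whose exponent is the sum of theirs. This is `IsToric`, preserved by
`IsToric.blowup`.

Let the centre be the corner of the curve S with a neighbour O, and write (α, β) = r' w_O + r w_S.
Blowing up, and taking the new curve for O, changes (r', r) into (r', r - r'). After r / r'
blowing-ups the coefficients are (r', r % r'); exchanging O and S is then one step of the Euclidean
algorithm. The process starts from the axes with coefficients (α, β) and ends with (0, 1), so the
last curve created has exponent (α, β) (`IsBlowupChain.isToric`, `IsChainComposition.isToric`).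

Quasihomogeneity shows that C consists of some of the axes and of finitely many branches v^α = c u^β
with c ≠ 0 (`exists_isQuasihomogeneous`). In a monomial chart the branches become s^p t^q =
constant, where p and q are, up to sign, the determinants of (α, β) with the exponents of the chart
(`IsToric.exists_branch_exponents`). One of them vanishes only along the curve of exponent (α, β),
and then the other is 1. So the branches cross this central curve transversally and meet no other
exceptional curve, which gives the normal crossings, the smoothness and the last assertion.

For minimality, the branches read t^ρ = κ s^ρ' at every centre. There the total transform contains a
cusp, two tangent smooth branches or three branches, none of which is a normal crossing
(`IsToric.not_hasNormalCrossingAt`). Every desingularization factors through the blowing-up of a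
point that is not a normal crossing (`IsModification.exists_factor`). This rests on the universal
property `IsBlowup.exists_lift` and on the commutation of blowing-ups of distinct points,
`IsBlowup.comm`. The factorizations are then composed along the tower. -/

theorem mem_coords {φ : OpenPartialHomeomorph X (ℂ × ℂ)}
    (h : ContMDiffOn 𝓘(ℂ, ℂ × ℂ) 𝓘(ℂ, ℂ × ℂ) ω φ φ.source)
    (h' : ContMDiffOn 𝓘(ℂ, ℂ × ℂ) 𝓘(ℂ, ℂ × ℂ) ω φ.symm φ.target) : φ ∈ X.coords :=
  φ.mem_maximalAtlas_of_contMDiffOn h h'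

theorem contMDiffOn_coords {φ : OpenPartialHomeomorph X (ℂ × ℂ)} (h : φ ∈ X.coords) :
    ContMDiffOn 𝓘(ℂ, ℂ × ℂ) 𝓘(ℂ, ℂ × ℂ) ω φ φ.source :=
  contMDiffOn_of_mem_maximalAtlas h

theorem contMDiffOn_coords_symm {φ : OpenPartialHomeomorph X (ℂ × ℂ)} (h : φ ∈ X.coords) :
    ContMDiffOn 𝓘(ℂ, ℂ × ℂ) 𝓘(ℂ, ℂ × ℂ) ω φ.symm φ.target :=
  contMDiffOn_symm_of_mem_maximalAtlas h

theorem contMDiffAt_coords {φ : OpenPartialHomeomorph X (ℂ × ℂ)} (h : φ ∈ X.coords) {x : X}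
    (hx : x ∈ φ.source) : ContMDiffAt 𝓘(ℂ, ℂ × ℂ) 𝓘(ℂ, ℂ × ℂ) ω φ x :=
  contMDiffAt_of_mem_maximalAtlas h hx

theorem contMDiffAt_coords_symm {φ : OpenPartialHomeomorph X (ℂ × ℂ)} (h : φ ∈ X.coords)
    {z : ℂ × ℂ} (hz : z ∈ φ.target) : ContMDiffAt 𝓘(ℂ, ℂ × ℂ) 𝓘(ℂ, ℂ × ℂ) ω φ.symm z :=
  contMDiffAt_symm_of_mem_maximalAtlas h hz

/-- Coordinates on `Y`, pulled back by a biholomorphic map between open sets. -/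
theorem trans_mem_coords {e : OpenPartialHomeomorph X Y}
    (he : ContMDiffOn 𝓘(ℂ, ℂ × ℂ) 𝓘(ℂ, ℂ × ℂ) ω e e.source)
    (he' : ContMDiffOn 𝓘(ℂ, ℂ × ℂ) 𝓘(ℂ, ℂ × ℂ) ω e.symm e.target)
    {φ : OpenPartialHomeomorph Y (ℂ × ℂ)} (hφ : φ ∈ Y.coords) : e.trans φ ∈ X.coords := by
  refine mem_coords ?_ ?_
  · exact (contMDiffOn_coords hφ).comp (he.mono (by simp)) (by intro x hx; simpa using hx.2)
  · refine he'.comp ((contMDiffOn_coords_symm hφ).mono ?_) ?_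
    · intro x hx; simp only [OpenPartialHomeomorph.trans_target] at hx; exact hx.1
    · intro x hx; simp only [OpenPartialHomeomorph.trans_target] at hx; exact hx.2

/-- Changing the coordinates by a biholomorphic map between open sets of the plane. -/
theorem coords_trans {φ : OpenPartialHomeomorph X (ℂ × ℂ)} (hφ : φ ∈ X.coords)
    {e : OpenPartialHomeomorph (ℂ × ℂ) (ℂ × ℂ)}
    (he : ContDiffOn ℂ ω e e.source) (he' : ContDiffOn ℂ ω e.symm e.target) :
    φ.trans e ∈ X.coords := by
  refine mem_coords ?_ ?_
  · exact he.contMDiffOn.comp ((contMDiffOn_coords hφ).mono (by simp))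
      (by intro x hx; simpa using hx.2)
  · refine (contMDiffOn_coords_symm hφ).comp (he'.contMDiffOn.mono ?_) ?_
    · intro x hx; simp only [OpenPartialHomeomorph.trans_target] at hx; exact hx.1
    · intro x hx; simp only [OpenPartialHomeomorph.trans_target] at hx; exact hx.2

theorem restr_mem_coords {φ : OpenPartialHomeomorph X (ℂ × ℂ)} (hφ : φ ∈ X.coords) {U : Set X}
    (hU : IsOpen U) : φ.restr U ∈ X.coords :=
  restr_mem_maximalAtlas _ hφ hU

theorem exists_coords_mem (p : X) : ∃ φ ∈ X.coords, p ∈ φ.source :=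
  ⟨chartAt (ℂ × ℂ) p, IsManifold.chart_mem_maximalAtlas p, mem_chart_source _ p⟩

/-- Coordinates translated by a constant. -/
theorem exists_coords_sub {φ : OpenPartialHomeomorph X (ℂ × ℂ)} (hφ : φ ∈ X.coords) (c : ℂ × ℂ) :
    ∃ φ' ∈ X.coords, φ'.source = φ.source ∧ ∀ x, φ' x = φ x - c := by
  refine ⟨φ.trans (Homeomorph.subRight c).toOpenPartialHomeomorph, coords_trans hφ ?_ ?_,
    by simp, by simp⟩
  · exact (contDiff_id.sub contDiff_const).contDiffOn
  · exact (contDiff_id.add contDiff_const).contDiffOn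

theorem exists_coords_centered (p : X) : ∃ φ ∈ X.coords, p ∈ φ.source ∧ φ p = 0 := by
  obtain ⟨φ, hφ, hp⟩ := exists_coords_mem p
  obtain ⟨φ', h, hs, he⟩ := exists_coords_sub hφ (φ p)
  exact ⟨φ', h, hs ▸ hp, by simp [he]⟩

/-- Exchanging the two coordinates. -/
theorem coords_swap {φ : OpenPartialHomeomorph X (ℂ × ℂ)} (hφ : φ ∈ X.coords) :
    φ.trans (Homeomorph.prodComm ℂ ℂ).toOpenPartialHomeomorph ∈ X.coords :=
  coords_trans hφ (contDiff_snd.prodMk contDiff_fst).contDiffOn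
    (contDiff_snd.prodMk contDiff_fst).contDiffOn

theorem IsHolomorphic.comp {g : Y → Z} {f : X → Y} (hg : IsHolomorphic g) (hf : IsHolomorphic f) :
    IsHolomorphic (g ∘ f) :=
  ContMDiff.comp hg hf

theorem isHolomorphic_id : IsHolomorphic (id : X → X) := contMDiff_id

theorem IsHolomorphic.continuous {f : X → Y} (hf : IsHolomorphic f) : Continuous f :=
  ContMDiff.continuous hf

/-- A map which reads as the identity in suitable coordinates is a local diffeomorphism. -/
theorem isLocalDiffeomorphAt_of_coords {E : X → Y} {ψ : OpenPartialHomeomorph X (ℂ × ℂ)}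
    (hψ : ψ ∈ X.coords) {φ : OpenPartialHomeomorph Y (ℂ × ℂ)} (hφ : φ ∈ Y.coords)
    (h : ∀ x ∈ ψ.source, E x ∈ φ.source ∧ φ (E x) = ψ x) {x : X} (hx : x ∈ ψ.source) :
    IsLocalDiffeomorphAt 𝓘(ℂ, ℂ × ℂ) 𝓘(ℂ, ℂ × ℂ) ω E x := by
  have key : ∀ x ∈ ψ.source, ψ x ∈ φ.target := fun x hx => by
    rw [← (h x hx).2]; exact φ.map_source (h x hx).1
  refine ⟨⟨(ψ.trans φ.symm).toPartialEquiv, (ψ.trans φ.symm).open_source,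
    (ψ.trans φ.symm).open_target, ?_, ?_⟩, ?_, ?_⟩
  · refine (contMDiffOn_coords_symm hφ).comp ((contMDiffOn_coords hψ).mono ?_) ?_
    · intro x hx; exact hx.1
    · intro x hx; exact hx.2
  · refine (contMDiffOn_coords_symm hψ).comp ((contMDiffOn_coords hφ).mono ?_) ?_
    · intro x hx; simpa using hx.1
    · intro x hx; simpa using hx.2
  · exact ⟨hx, key x hx⟩
  · intro y hy
    have hy' : y ∈ ψ.source := hy.1
    change E y = φ.symm (ψ y)
    rw [← (h y hy').2, φ.left_inv (h y hy').1]

theorem exists_openPartialHomeomorph_at {E : X → Y} {x : X}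
    (h : IsLocalDiffeomorphAt 𝓘(ℂ, ℂ × ℂ) 𝓘(ℂ, ℂ × ℂ) ω E x) :
    ∃ e : OpenPartialHomeomorph X Y, x ∈ e.source ∧ (∀ y ∈ e.source, E y = e y) ∧
      ContMDiffOn 𝓘(ℂ, ℂ × ℂ) 𝓘(ℂ, ℂ × ℂ) ω e e.source ∧
      ContMDiffOn 𝓘(ℂ, ℂ × ℂ) 𝓘(ℂ, ℂ × ℂ) ω e.symm e.target := by
  obtain ⟨Φ, hx, hΦ⟩ := h
  exact ⟨Φ.toOpenPartialHomeomorph, hx, hΦ, Φ.contMDiffOn_toFun, Φ.contMDiffOn_invFun⟩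

theorem map_nhds_eq_of_isLocalDiffeomorphAt {E : X → Y} {x : X}
    (h : IsLocalDiffeomorphAt 𝓘(ℂ, ℂ × ℂ) 𝓘(ℂ, ℂ × ℂ) ω E x) : map E (𝓝 x) = 𝓝 (E x) := by
  obtain ⟨Φ, hx, hΦ⟩ := h
  have h1 : E =ᶠ[𝓝 x] Φ := hΦ.eventuallyEq_of_mem (Φ.open_source.mem_nhds hx)
  rw [Filter.map_congr h1, h1.eq_of_nhds]
  exact Φ.toOpenPartialHomeomorph.map_nhds_eq hx

/-- A map which is a local diffeomorphism and injective on an open set is biholomorphic from this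
set onto its image. -/
theorem exists_openPartialHomeomorph [Nonempty X] {E : X → Y} {O : Set X} (hO : IsOpen O)
    (hinj : InjOn E O)
    (hloc : ∀ x ∈ O, IsLocalDiffeomorphAt 𝓘(ℂ, ℂ × ℂ) 𝓘(ℂ, ℂ × ℂ) ω E x) :
    ∃ e : OpenPartialHomeomorph X Y, e.source = O ∧ (e : X → Y) = E ∧
      ContMDiffOn 𝓘(ℂ, ℂ × ℂ) 𝓘(ℂ, ℂ × ℂ) ω e e.source ∧
      ContMDiffOn 𝓘(ℂ, ℂ × ℂ) 𝓘(ℂ, ℂ × ℂ) ω e.symm e.target := by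
  have hcont : ContMDiffOn 𝓘(ℂ, ℂ × ℂ) 𝓘(ℂ, ℂ × ℂ) ω E O := fun x hx =>
    (hloc x hx).contMDiffAt.contMDiffWithinAt
  have hopen : IsOpenMap (O.domRestrict E) := by
    refine IsOpenMap.of_nhds_le fun x => ?_
    have h1 := map_nhds_eq_of_isLocalDiffeomorphAt (hloc x x.2)
    change 𝓝 (E x) ≤ map (E ∘ Subtype.val) (𝓝 x)
    rw [← Filter.map_map, map_nhds_subtype_coe_eq_nhds x.2 (hO.mem_nhds x.2), h1]
  let e := OpenPartialHomeomorph.ofContinuousOpenRestrict (hinj.toPartialEquiv E O)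
    hcont.continuousOn hopen hO
  have hsrc : e.source = O := rfl
  have hco : (e : X → Y) = E := rfl
  refine ⟨e, hsrc, hco, hcont, ?_⟩
  intro y hy
  obtain ⟨x, hx, rfl⟩ : ∃ x ∈ e.source, e x = y := ⟨e.symm y, e.map_target hy, e.right_inv hy⟩
  obtain ⟨Φ, hxΦ, hΦ⟩ := hloc x hx
  have hEx : E x = Φ x := hΦ hxΦ
  have hΦx : Φ x ∈ Φ.target := Φ.map_source hxΦ
  have hev : e.symm =ᶠ[𝓝 (e x)] Φ.symm := by
    have h1 : ∀ᶠ y in 𝓝 (e x), y ∈ e.target := e.open_target.mem_nhds (e.map_source hx)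
    have h2 : ∀ᶠ y in 𝓝 (e x), y ∈ Φ.target := by
      rw [hco, hEx]; exact Φ.open_target.mem_nhds hΦx
    have h3 : ∀ᶠ y in 𝓝 (e x), Φ.symm y ∈ O := by
      rw [hco, hEx]
      have hc : ContinuousAt Φ.symm (Φ x) :=
        (Φ.symm.contMDiffOn.continuousOn).continuousAt (Φ.open_target.mem_nhds hΦx)
      apply hc.eventually_mem
      have : Φ.symm (Φ x) = x := Φ.left_inv hxΦ
      rw [this]
      exact hO.mem_nhds hx
    filter_upwards [h1, h2, h3] with y h1 h2 h3
    apply hinj (e.map_target h1) h3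
    have h4 : E (e.symm y) = y := e.right_inv h1
    have h5 : E (Φ.symm y) = Φ (Φ.symm y) := hΦ (Φ.map_target h2)
    rw [h4, h5]
    exact (Φ.right_inv h2).symm
  have : ContMDiffAt 𝓘(ℂ, ℂ × ℂ) 𝓘(ℂ, ℂ × ℂ) ω Φ.symm (e x) := by
    rw [hco, hEx]
    exact Φ.symm.contMDiffOn.contMDiffAt (Φ.open_target.mem_nhds hΦx)
  exact (this.congr_of_eventuallyEq hev).contMDiffWithinAt

/-- Normal crossings descend along local diffeomorphisms. -/
theorem HasNormalCrossingAt.of_preimage {E : X → Y} {C : Set Y} {x : X}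
    (hE : IsLocalDiffeomorphAt 𝓘(ℂ, ℂ × ℂ) 𝓘(ℂ, ℂ × ℂ) ω E x)
    (h : HasNormalCrossingAt (E ⁻¹' C) x) : HasNormalCrossingAt C (E x) := by
  obtain ⟨e, hx, he, he₁, he₂⟩ := exists_openPartialHomeomorph_at hE
  have key : ∀ φ ∈ X.coords, x ∈ φ.source → φ x = 0 → ∃ φ' ∈ Y.coords, E x ∈ φ'.source ∧
      φ' (E x) = 0 ∧ ∀ y ∈ φ'.source, ∃ x' ∈ φ.source, E x' = y ∧ φ' y = φ x' := by
    intro φ hφ hxφ h0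
    refine ⟨e.symm.trans φ, trans_mem_coords he₂ he₁ hφ, ?_, ?_, ?_⟩
    · rw [he x hx]
      exact ⟨e.map_source hx, by simpa [e.left_inv hx] using hxφ⟩
    · simp [he x hx, e.left_inv hx, h0]
    · intro y hy
      refine ⟨e.symm y, hy.2, ?_, rfl⟩
      rw [he _ (e.map_target hy.1)]
      exact e.right_inv hy.1
  rcases h with ⟨φ, hφ, hxφ, h0, h⟩ | ⟨φ, hφ, hxφ, h0, h⟩
  · obtain ⟨φ', hφ', h1, h2, h3⟩ := key φ hφ hxφ h0
    refine Or.inl ⟨φ', hφ', h1, h2, fun y hy => ?_⟩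
    obtain ⟨x', hx', rfl, h4⟩ := h3 y hy
    rw [h4]; exact h x' hx'
  · obtain ⟨φ', hφ', h1, h2, h3⟩ := key φ hφ hxφ h0
    refine Or.inr ⟨φ', hφ', h1, h2, fun y hy => ?_⟩
    obtain ⟨x', hx', rfl, h4⟩ := h3 y hy
    rw [h4]; exact h x' hx'

end ComplexSurface

/-! ### Construction of the blowing-up of a point. -/

namespace ComplexSurface

/-- The set underlying the blowing-up of `Y` at `p`: the points of `Y ∖ {p}`, and the slopes
in `ℂ ∪ {∞}`. -/
inductive BlowupPoint {Y : ComplexSurface} (p : Y) : Type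
  | off (y : Y) (h : y ≠ p)
  | slope (o : Option ℂ)

namespace BlowupPoint

variable {Y : ComplexSurface} {p : Y}

/-- The projection of the blowing-up. -/
def down : BlowupPoint p → Y
  | off y _ => y
  | slope _ => p

open Classical in
/-- The point over `y`, of slope `o` if `y = p`. -/
noncomputable def up (p y : Y) (o : Option ℂ) : BlowupPoint p :=
  if h : y = p then slope o else off y h


@[simp] theorem down_off (y : Y) (h : y ≠ p) : down (off y h) = y := rfl
@[simp] theorem down_slope (o : Option ℂ) : down (p := p) (slope o) = p := rfl

@[simp] theorem down_up (y : Y) (o : Option ℂ) : down (up p y o) = y := by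
  unfold up; split_ifs with h <;> simp [h]

theorem up_self (o : Option ℂ) : up p p o = slope o := by simp [up]

theorem up_of_ne {y : Y} (h : y ≠ p) (o : Option ℂ) : up p y o = off y h := by simp [up, h]

theorem up_down_of_ne {x : BlowupPoint p} (h : down x ≠ p) (o : Option ℂ) : up p (down x) o = x := by
  rcases x with ⟨y, hy⟩ | o'
  · exact up_of_ne hy o
  · exact absurd rfl h

theorem exists_inr {x : BlowupPoint p} (h : down x = p) : ∃ o, x = slope o := by
  rcases x with ⟨y, hy⟩ | o'
  · exact absurd h hy
  · exact ⟨o', rfl⟩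

variable {φ : OpenPartialHomeomorph Y (ℂ × ℂ)} (hp : p ∈ φ.source) (h0 : φ p = 0)

theorem symm_eq_iff (hp : p ∈ φ.source) (h0 : φ p = 0) {w : ℂ × ℂ} (hw : w ∈ φ.target) :
    φ.symm w = p ↔ w = 0 := by
  constructor
  · intro h; rw [← φ.right_inv hw, h, h0]
  · rintro rfl; rw [← h0, φ.left_inv hp]

/-- The values of the first standard chart. -/
noncomputable def fun₁ (φ : OpenPartialHomeomorph Y (ℂ × ℂ)) : BlowupPoint p → ℂ × ℂ
  | off y _ => ((φ y).1, (φ y).2 / (φ y).1)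
  -- The slope is y / x, and `none` is the infinite one. Its value here is arbitrary, since `dom₁`
  -- excludes it.
  | slope o => (0, o.getD 0)

/-- The domain of the first standard chart. -/
def dom₁ (φ : OpenPartialHomeomorph Y (ℂ × ℂ)) : BlowupPoint p → Prop
  | off y _ => y ∈ φ.source ∧ (φ y).1 ≠ 0
  | slope o => o ≠ none

/-- The values of the second standard chart. -/
noncomputable def fun₂ (φ : OpenPartialHomeomorph Y (ℂ × ℂ)) : BlowupPoint p → ℂ × ℂ
  | off y _ => ((φ y).1 / (φ y).2, (φ y).2)
  -- The second chart carries the inverse slope x / y, so the infinite slope goes to 0; the slope 0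
  -- is excluded by `dom₂`.
  | slope o => (o.elim 0 (·⁻¹), 0)

/-- The domain of the second standard chart. -/
def dom₂ (φ : OpenPartialHomeomorph Y (ℂ × ℂ)) : BlowupPoint p → Prop
  | off y _ => y ∈ φ.source ∧ (φ y).2 ≠ 0
  | slope o => o ≠ some 0

/-- The first standard chart of the blowing-up. -/
noncomputable def chart₁ (hp : p ∈ φ.source) (h0 : φ p = 0) :
    PartialEquiv (BlowupPoint p) (ℂ × ℂ) where
  toFun := fun₁ φ
  -- The slope given to `up` matters only when z.1 = 0; any other point is determined by its image
  -- in `Y`.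
  invFun z := up p (φ.symm (z.1, z.1 * z.2)) (some z.2)
  source := {x | dom₁ φ x}
  target := {z | (z.1, z.1 * z.2) ∈ φ.target}
  map_source' := by
    rintro (⟨y, hy⟩ | o) hx
    · obtain ⟨h1, h2⟩ : y ∈ φ.source ∧ (φ y).1 ≠ 0 := hx
      simpa [fun₁, mul_div_cancel₀ _ h2] using φ.map_source h1
    · simpa [fun₁, ← Prod.zero_eq_mk, ← h0] using φ.map_source hp
  map_target' := by
    intro z hz
    rcases eq_or_ne z.1 0 with h | h
    · have : φ.symm (z.1, z.1 * z.2) = p := (symm_eq_iff hp h0 hz).2 (by simp [h])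
      simp [dom₁, this, up_self]
    · have : φ.symm (z.1, z.1 * z.2) ≠ p := fun h' => h (by
        simpa using congrArg Prod.fst ((symm_eq_iff hp h0 hz).1 h'))
      rw [up_of_ne this]
      exact ⟨φ.map_target hz, by rw [φ.right_inv hz]; exact h⟩
  left_inv' := by
    rintro (⟨y, hy⟩ | o) hx
    · obtain ⟨h1, h2⟩ : y ∈ φ.source ∧ (φ y).1 ≠ 0 := hx
      simp [fun₁, mul_div_cancel₀ _ h2, φ.left_inv h1, up_of_ne hy]
    · obtain ⟨t, rfl⟩ := Option.ne_none_iff_exists'.1 hx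
      have : φ.symm (0, 0) = p := by rw [← Prod.zero_eq_mk, ← h0, φ.left_inv hp]
      simp [fun₁, this, up_self]
  right_inv' := by
    intro z hz
    rcases eq_or_ne z.1 0 with h | h
    · have : φ.symm (z.1, z.1 * z.2) = p := (symm_eq_iff hp h0 hz).2 (by simp [h])
      rw [this, up_self]
      exact Prod.ext h.symm rfl
    · have : φ.symm (z.1, z.1 * z.2) ≠ p := fun h' => h (by
        simpa using congrArg Prod.fst ((symm_eq_iff hp h0 hz).1 h'))
      rw [up_of_ne this]
      simp [fun₁, φ.right_inv hz, h]

open Classical in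
/-- The second standard chart of the blowing-up. -/
noncomputable def chart₂ (hp : p ∈ φ.source) (h0 : φ p = 0) :
    PartialEquiv (BlowupPoint p) (ℂ × ℂ) where
  toFun := fun₂ φ
  invFun z := up p (φ.symm (z.1 * z.2, z.2)) (if z.1 = 0 then none else some z.1⁻¹)
  source := {x | dom₂ φ x}
  target := {z | (z.1 * z.2, z.2) ∈ φ.target}
  map_source' := by
    rintro (⟨y, hy⟩ | o) hx
    · obtain ⟨h1, h2⟩ : y ∈ φ.source ∧ (φ y).2 ≠ 0 := hx
      simpa [fun₂, div_mul_cancel₀ _ h2] using φ.map_source h1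
    · simpa [fun₂, ← Prod.zero_eq_mk, ← h0] using φ.map_source hp
  map_target' := by
    intro z hz
    rcases eq_or_ne z.2 0 with h | h
    · have : φ.symm (z.1 * z.2, z.2) = p := (symm_eq_iff hp h0 hz).2 (by simp [h])
      rw [this, up_self]
      change (if z.1 = 0 then none else some z.1⁻¹) ≠ some 0
      split_ifs with h1 <;> simp [h1]
    · have : φ.symm (z.1 * z.2, z.2) ≠ p := fun h' => h (by
        simpa using congrArg Prod.snd ((symm_eq_iff hp h0 hz).1 h'))
      rw [up_of_ne this]
      exact ⟨φ.map_target hz, by rw [φ.right_inv hz]; exact h⟩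
  left_inv' := by
    rintro (⟨y, hy⟩ | o) hx
    · obtain ⟨h1, h2⟩ : y ∈ φ.source ∧ (φ y).2 ≠ 0 := hx
      simp [fun₂, div_mul_cancel₀ _ h2, φ.left_inv h1, up_of_ne hy]
    · have : φ.symm (0, 0) = p := by rw [← Prod.zero_eq_mk, ← h0, φ.left_inv hp]
      rcases o with _ | t
      · simp [fun₂, this, up_self]
      · have ht : t ≠ 0 := fun h => hx (by rw [h])
        simp [fun₂, this, up_self, ht]
  right_inv' := by
    intro z hz
    rcases eq_or_ne z.2 0 with h | h
    · have : φ.symm (z.1 * z.2, z.2) = p := (symm_eq_iff hp h0 hz).2 (by simp [h])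
      rw [this, up_self]
      by_cases h1 : z.1 = 0
      · simp only [h1, if_true]; exact Prod.ext h1.symm h.symm
      · simp only [h1, if_false]; exact Prod.ext (by simp [fun₂]) h.symm
    · have : φ.symm (z.1 * z.2, z.2) ≠ p := fun h' => h (by
        simpa using congrArg Prod.snd ((symm_eq_iff hp h0 hz).1 h'))
      rw [up_of_ne this]
      simp [fun₂, φ.right_inv hz, h]

/-- The chart of the blowing-up given by coordinates of `Y` outside `p`. -/
noncomputable def lift {φ' : OpenPartialHomeomorph Y (ℂ × ℂ)} (hp' : p ∉ φ'.source) :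
    PartialEquiv (BlowupPoint p) (ℂ × ℂ) where
  toFun x := φ' (down x)
  -- The slope `none` is never used, because `p` is not in the source of `φ'`.
  invFun z := up p (φ'.symm z) none
  source := {x | down x ∈ φ'.source}
  target := φ'.target
  map_source' x hx := φ'.map_source hx
  map_target' z hz := by simpa using φ'.map_target hz
  left_inv' x hx := by
    have : down x ≠ p := fun h => hp' (by rw [← h]; exact hx)
    simp only [φ'.left_inv hx, up_down_of_ne this]
  right_inv' z hz := by simp [φ'.right_inv hz]

/-- The atlas of the blowing-up. -/
inductive Charts (hp : p ∈ φ.source) (h0 : φ p = 0) : PartialEquiv (BlowupPoint p) (ℂ × ℂ) → Prop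
  | chart₁ : Charts hp h0 (chart₁ hp h0)
  | chart₂ : Charts hp h0 (chart₂ hp h0)
  | lift {φ' : OpenPartialHomeomorph Y (ℂ × ℂ)} (h : φ' ∈ Y.coords) (hp' : p ∉ φ'.source) :
      Charts hp h0 (lift hp')

theorem mem_source_chart₁ {x : BlowupPoint p} (hx : down x ≠ p) :
    x ∈ (chart₁ hp h0).source ↔ down x ∈ φ.source ∧ (φ (down x)).1 ≠ 0 := by
  rcases x with ⟨y, hy⟩ | o
  · exact Iff.rfl
  · exact absurd rfl hx

theorem mem_source_chart₂ {x : BlowupPoint p} (hx : down x ≠ p) :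
    x ∈ (chart₂ hp h0).source ↔ down x ∈ φ.source ∧ (φ (down x)).2 ≠ 0 := by
  rcases x with ⟨y, hy⟩ | o
  · exact Iff.rfl
  · exact absurd rfl hx

theorem chart₁_apply {x : BlowupPoint p} (hx : down x ≠ p) :
    chart₁ hp h0 x = ((φ (down x)).1, (φ (down x)).2 / (φ (down x)).1) := by
  rcases x with ⟨y, hy⟩ | o
  · rfl
  · exact absurd rfl hx

theorem chart₂_apply {x : BlowupPoint p} (hx : down x ≠ p) :
    chart₂ hp h0 x = ((φ (down x)).1 / (φ (down x)).2, (φ (down x)).2) := by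
  rcases x with ⟨y, hy⟩ | o
  · rfl
  · exact absurd rfl hx

theorem down_chart₁_symm (z : ℂ × ℂ) :
    down ((chart₁ hp h0).symm z) = φ.symm (z.1, z.1 * z.2) := down_up _ _

theorem down_chart₂_symm (z : ℂ × ℂ) :
    down ((chart₂ hp h0).symm z) = φ.symm (z.1 * z.2, z.2) := down_up _ _

theorem continuous_std₁ : ContDiff ℂ ω fun z : ℂ × ℂ => (z.1, z.1 * z.2) :=
  contDiff_fst.prodMk (contDiff_fst.mul contDiff_snd)

theorem continuous_std₂ : ContDiff ℂ ω fun z : ℂ × ℂ => (z.1 * z.2, z.2) :=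
  (contDiff_fst.mul contDiff_snd).prodMk contDiff_snd

variable {hp h0}

theorem Charts.isOpen_target {e : PartialEquiv (BlowupPoint p) (ℂ × ℂ)} (he : Charts hp h0 e) :
    IsOpen e.target := by
  rcases he with _ | _ | @⟨φ', h, hp'⟩
  · exact φ.open_target.preimage continuous_std₁.continuous
  · exact φ.open_target.preimage continuous_std₂.continuous
  · exact φ'.open_target

/-- Once the projection is analytic in every chart, a transition into a chart that is a function of
the image point is analytic by composition. Only the two standard charts along the exceptional curve
need a separate computation. -/
theorem Charts.contMDiffOn_down (hφ : φ ∈ Y.coords) {e : PartialEquiv (BlowupPoint p) (ℂ × ℂ)}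
    (he : Charts hp h0 e) :
    ContMDiffOn 𝓘(ℂ, ℂ × ℂ) 𝓘(ℂ, ℂ × ℂ) ω (fun z => down (e.symm z)) e.target := by
  rcases he with _ | _ | h
  · simp only [down_chart₁_symm]
    exact (contMDiffOn_coords_symm hφ).comp continuous_std₁.contMDiff.contMDiffOn (fun z hz => hz)
  · simp only [down_chart₂_symm]
    exact (contMDiffOn_coords_symm hφ).comp continuous_std₂.contMDiff.contMDiffOn (fun z hz => hz)
  · exact (contMDiffOn_coords_symm h).congr (fun z _ => down_up _ _)

theorem trans_lift (hφ : φ ∈ Y.coords) {e : PartialEquiv (BlowupPoint p) (ℂ × ℂ)}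
    (he : Charts hp h0 e) {φ' : OpenPartialHomeomorph Y (ℂ × ℂ)} (h : φ' ∈ Y.coords)
    (hp' : p ∉ φ'.source) :
    IsOpen (e.symm.trans (lift hp')).source ∧
      ContDiffOn ℂ ω (e.symm.trans (lift hp')) (e.symm.trans (lift hp')).source := by
  have h1 := he.contMDiffOn_down hφ
  constructor
  · exact h1.continuousOn.isOpen_inter_preimage he.isOpen_target φ'.open_source
  · refine ContMDiffOn.contDiffOn ?_
    exact (contMDiffOn_coords h).comp (h1.mono fun z hz => hz.1) fun z hz => hz.2

/-- Used for `e` a chart lifted from the complement of `p` and `e'` a standard chart: there `e'` is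
a quotient map `g` applied to the coordinates `φ`. -/
theorem trans_of_notMem (hφ : φ ∈ Y.coords) {e : PartialEquiv (BlowupPoint p) (ℂ × ℂ)}
    (he : Charts hp h0 e) (e' : PartialEquiv (BlowupPoint p) (ℂ × ℂ)) {U : Set (ℂ × ℂ)}
    (hU : IsOpen U) {g : ℂ × ℂ → ℂ × ℂ} (hg : ContDiffOn ℂ ω g U)
    (hs : ∀ z ∈ e.target, e.symm z ∈ e'.source ↔ down (e.symm z) ∈ φ.source ∧
      φ (down (e.symm z)) ∈ U)
    (hv : ∀ z ∈ e.target, e.symm z ∈ e'.source → e' (e.symm z) = g (φ (down (e.symm z)))) :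
    IsOpen (e.symm.trans e').source ∧ ContDiffOn ℂ ω (e.symm.trans e') (e.symm.trans e').source := by
  have h1 := he.contMDiffOn_down hφ
  have h2 : (e.symm.trans e').source =
      e.target ∩ (fun z => down (e.symm z)) ⁻¹' (φ.source ∩ φ ⁻¹' U) := by
    ext z
    constructor
    · rintro ⟨hz, hz'⟩; exact ⟨hz, (hs z hz).1 hz'⟩
    · rintro ⟨hz, hz'⟩; exact ⟨hz, (hs z hz).2 hz'⟩
  constructor
  · rw [h2]
    exact h1.continuousOn.isOpen_inter_preimage he.isOpen_target (φ.isOpen_inter_preimage hU)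
  · rw [h2]
    refine ContMDiffOn.contDiffOn ?_
    have h3 : ContMDiffOn 𝓘(ℂ, ℂ × ℂ) 𝓘(ℂ, ℂ × ℂ) ω (fun z => φ (down (e.symm z)))
        (e.target ∩ (fun z => down (e.symm z)) ⁻¹' (φ.source ∩ φ ⁻¹' U)) :=
      (contMDiffOn_coords hφ).comp (h1.mono fun z hz => hz.1) fun z hz => hz.2.1
    refine (hg.contMDiffOn.comp h3 fun z hz => hz.2.2).congr ?_
    intro z hz
    exact hv z hz.1 ((hs z hz.1).2 hz.2)

theorem contDiffOn_div₁ : ContDiffOn ℂ ω (fun w : ℂ × ℂ => (w.1, w.2 / w.1)) {w | w.1 ≠ 0} :=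
  contDiffOn_fst.prodMk (contDiffOn_snd.div contDiffOn_fst fun _ h => h)

theorem contDiffOn_div₂ : ContDiffOn ℂ ω (fun w : ℂ × ℂ => (w.1 / w.2, w.2)) {w | w.2 ≠ 0} :=
  (contDiffOn_fst.div contDiffOn_snd fun _ h => h).prodMk contDiffOn_snd

theorem isOpen_fst_ne : IsOpen {w : ℂ × ℂ | w.1 ≠ 0} := isOpen_ne_fun continuous_fst continuous_const

theorem isOpen_snd_ne : IsOpen {w : ℂ × ℂ | w.2 ≠ 0} := isOpen_ne_fun continuous_snd continuous_const

theorem trans_self {e : PartialEquiv (BlowupPoint p) (ℂ × ℂ)} (he : Charts hp h0 e) :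
    IsOpen (e.symm.trans e).source ∧ ContDiffOn ℂ ω (e.symm.trans e) (e.symm.trans e).source := by
  have h2 : (e.symm.trans e).source = e.target := by
    ext z
    exact ⟨fun h => h.1, fun h => ⟨h, e.map_target h⟩⟩
  rw [h2]
  exact ⟨he.isOpen_target, contDiffOn_id.congr fun z hz => e.right_inv hz⟩

theorem chart₂_symm_mem_source_chart₁ {z : ℂ × ℂ} (hz : z ∈ (chart₂ hp h0).target) :
    (chart₂ hp h0).symm z ∈ (chart₁ hp h0).source ↔ z.1 ≠ 0 := by
  have hz' : (z.1 * z.2, z.2) ∈ φ.target := hz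
  by_cases h : down ((chart₂ hp h0).symm z) = p
  · rw [down_chart₂_symm, symm_eq_iff hp h0 hz'] at h
    have h2 : z.2 = 0 := congrArg Prod.snd h
    have : φ.symm (z.1 * z.2, z.2) = p := (symm_eq_iff hp h0 hz').2 (by simp [h2])
    change up p _ _ ∈ _ ↔ _
    rw [this, up_self]
    change (if z.1 = 0 then none else some z.1⁻¹) ≠ none ↔ _
    split_ifs with h3 <;> simp [h3]
  · rw [mem_source_chart₁ hp h0 h, down_chart₂_symm, φ.right_inv hz']
    rw [down_chart₂_symm, symm_eq_iff hp h0 hz'] at h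
    refine ⟨fun h' => left_ne_zero_of_mul h'.2, fun h' => ⟨φ.map_target hz', mul_ne_zero h' ?_⟩⟩
    rintro h2
    exact h (by simp [h2])

theorem chart₁_symm_mem_source_chart₂ {z : ℂ × ℂ} (hz : z ∈ (chart₁ hp h0).target) :
    (chart₁ hp h0).symm z ∈ (chart₂ hp h0).source ↔ z.2 ≠ 0 := by
  have hz' : (z.1, z.1 * z.2) ∈ φ.target := hz
  by_cases h : down ((chart₁ hp h0).symm z) = p
  · rw [down_chart₁_symm, symm_eq_iff hp h0 hz'] at h
    have h2 : z.1 = 0 := congrArg Prod.fst h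
    have : φ.symm (z.1, z.1 * z.2) = p := (symm_eq_iff hp h0 hz').2 (by simp [h2])
    change up p _ _ ∈ _ ↔ _
    rw [this, up_self]
    change some z.2 ≠ some 0 ↔ _
    simp
  · rw [mem_source_chart₂ hp h0 h, down_chart₁_symm, φ.right_inv hz']
    rw [down_chart₁_symm, symm_eq_iff hp h0 hz'] at h
    refine ⟨fun h' => right_ne_zero_of_mul h'.2, fun h' => ⟨φ.map_target hz', mul_ne_zero ?_ h'⟩⟩
    rintro h2
    exact h (by simp [h2])

theorem chart₂_symm_chart₁ {z : ℂ × ℂ} (hz : z ∈ (chart₂ hp h0).target) (h1 : z.1 ≠ 0) :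
    chart₁ hp h0 ((chart₂ hp h0).symm z) = (z.1 * z.2, z.1⁻¹) := by
  have hz' : (z.1 * z.2, z.2) ∈ φ.target := hz
  by_cases h : down ((chart₂ hp h0).symm z) = p
  · rw [down_chart₂_symm, symm_eq_iff hp h0 hz'] at h
    have h2 : z.2 = 0 := congrArg Prod.snd h
    have : φ.symm (z.1 * z.2, z.2) = p := (symm_eq_iff hp h0 hz').2 (by simp [h2])
    change chart₁ hp h0 (up p _ _) = _
    rw [this, up_self, if_neg h1]
    simp [chart₁, fun₁, h2]
  · rw [chart₁_apply hp h0 h, down_chart₂_symm, φ.right_inv hz']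
    rw [down_chart₂_symm, symm_eq_iff hp h0 hz'] at h
    have h2 : z.2 ≠ 0 := by rintro h2; exact h (by simp [h2])
    refine Prod.ext rfl ?_
    field_simp

theorem chart₁_symm_chart₂ {z : ℂ × ℂ} (hz : z ∈ (chart₁ hp h0).target) (h1 : z.2 ≠ 0) :
    chart₂ hp h0 ((chart₁ hp h0).symm z) = (z.2⁻¹, z.1 * z.2) := by
  have hz' : (z.1, z.1 * z.2) ∈ φ.target := hz
  by_cases h : down ((chart₁ hp h0).symm z) = p
  · rw [down_chart₁_symm, symm_eq_iff hp h0 hz'] at h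
    have h2 : z.1 = 0 := congrArg Prod.fst h
    have : φ.symm (z.1, z.1 * z.2) = p := (symm_eq_iff hp h0 hz').2 (by simp [h2])
    change chart₂ hp h0 (up p _ _) = _
    rw [this, up_self]
    simp [chart₂, fun₂, h2]
  · rw [chart₂_apply hp h0 h, down_chart₁_symm, φ.right_inv hz']
    rw [down_chart₁_symm, symm_eq_iff hp h0 hz'] at h
    have h2 : z.1 ≠ 0 := by rintro h2; exact h (by simp [h2])
    refine Prod.ext ?_ rfl
    field_simp

theorem trans_chart₁ (hφ : φ ∈ Y.coords) {e : PartialEquiv (BlowupPoint p) (ℂ × ℂ)}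
    (he : Charts hp h0 e) :
    IsOpen (e.symm.trans (chart₁ hp h0)).source ∧
      ContDiffOn ℂ ω (e.symm.trans (chart₁ hp h0)) (e.symm.trans (chart₁ hp h0)).source := by
  rcases he with _ | _ | h
  · exact trans_self .chart₁
  · have hs : ((chart₂ hp h0).symm.trans (chart₁ hp h0)).source =
        (chart₂ hp h0).target ∩ {z | z.1 ≠ 0} := by
      ext z
      exact ⟨fun h => ⟨h.1, (chart₂_symm_mem_source_chart₁ (hp := hp) (h0 := h0) h.1).1 h.2⟩,
        fun h => ⟨h.1, (chart₂_symm_mem_source_chart₁ (hp := hp) (h0 := h0) h.1).2 h.2⟩⟩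
    rw [hs]
    refine ⟨(Charts.chart₂ (hp := hp) (h0 := h0)).isOpen_target.inter isOpen_fst_ne, ?_⟩
    refine ContDiffOn.congr (f := fun z : ℂ × ℂ => (z.1 * z.2, z.1⁻¹)) ?_
      fun z hz => chart₂_symm_chart₁ hz.1 hz.2
    exact (contDiff_fst.mul contDiff_snd).contDiffOn.prodMk
      (contDiffOn_fst.inv fun z hz => hz.2)
  · rename_i φ' hp'
    have hne : ∀ z ∈ φ'.target, down ((lift hp').symm z) ≠ p := fun z hz h => hp' (by
      have : down ((lift hp').symm z) = φ'.symm z := down_up _ _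
      rw [← h, this]; exact φ'.map_target hz)
    exact trans_of_notMem hφ (.lift (hp := hp) (h0 := h0) h hp') (chart₁ hp h0) isOpen_fst_ne contDiffOn_div₁
      (fun z hz => mem_source_chart₁ hp h0 (hne z hz))
      (fun z hz _ => chart₁_apply hp h0 (hne z hz))

theorem trans_chart₂ (hφ : φ ∈ Y.coords) {e : PartialEquiv (BlowupPoint p) (ℂ × ℂ)}
    (he : Charts hp h0 e) :
    IsOpen (e.symm.trans (chart₂ hp h0)).source ∧
      ContDiffOn ℂ ω (e.symm.trans (chart₂ hp h0)) (e.symm.trans (chart₂ hp h0)).source := by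
  rcases he with _ | _ | h
  · have hs : ((chart₁ hp h0).symm.trans (chart₂ hp h0)).source =
        (chart₁ hp h0).target ∩ {z | z.2 ≠ 0} := by
      ext z
      exact ⟨fun h => ⟨h.1, (chart₁_symm_mem_source_chart₂ (hp := hp) (h0 := h0) h.1).1 h.2⟩,
        fun h => ⟨h.1, (chart₁_symm_mem_source_chart₂ (hp := hp) (h0 := h0) h.1).2 h.2⟩⟩
    rw [hs]
    refine ⟨(Charts.chart₁ (hp := hp) (h0 := h0)).isOpen_target.inter isOpen_snd_ne, ?_⟩
    refine ContDiffOn.congr (f := fun z : ℂ × ℂ => (z.2⁻¹, z.1 * z.2)) ?_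
      fun z hz => chart₁_symm_chart₂ hz.1 hz.2
    exact (contDiffOn_snd.inv fun z hz => hz.2).prodMk (contDiff_fst.mul contDiff_snd).contDiffOn
  · exact trans_self .chart₂
  · rename_i φ' hp'
    have hne : ∀ z ∈ φ'.target, down ((lift hp').symm z) ≠ p := fun z hz h => hp' (by
      have : down ((lift hp').symm z) = φ'.symm z := down_up _ _
      rw [← h, this]; exact φ'.map_target hz)
    exact trans_of_notMem hφ (.lift (hp := hp) (h0 := h0) h hp') (chart₂ hp h0) isOpen_snd_ne contDiffOn_div₂
      (fun z hz => mem_source_chart₂ hp h0 (hne z hz))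
      (fun z hz _ => chart₂_apply hp h0 (hne z hz))

theorem Charts.trans (hφ : φ ∈ Y.coords) {e e' : PartialEquiv (BlowupPoint p) (ℂ × ℂ)}
    (he : Charts hp h0 e) (he' : Charts hp h0 e') :
    IsOpen (e.symm.trans e').source ∧ ContDiffOn ℂ ω (e.symm.trans e') (e.symm.trans e').source := by
  rcases he' with _ | _ | h
  · exact trans_chart₁ hφ he
  · exact trans_chart₂ hφ he
  · exact trans_lift hφ he h _

theorem exists_chart (x : BlowupPoint p) : ∃ e, Charts hp h0 e ∧ x ∈ e.source := by
  rcases x with ⟨y, hy⟩ | (_ | t)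
  · obtain ⟨φ', h1, h2⟩ := exists_coords_mem y
    refine ⟨_, .lift (restr_mem_coords h1 (U := {p}ᶜ) isClosed_singleton.isOpen_compl)
      (by simp), ?_⟩
    change y ∈ (φ'.restr {p}ᶜ).source
    rw [φ'.restr_source, isClosed_singleton.isOpen_compl.interior_eq]
    exact ⟨h2, hy⟩
  · exact ⟨_, .chart₂, (Option.some_ne_none 0).symm⟩
  · exact ⟨_, .chart₁, Option.some_ne_none t⟩

/-- The charted space structure of the blowing-up. -/
noncomputable def core (hφ : φ ∈ Y.coords) (hp : p ∈ φ.source) (h0 : φ p = 0) :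
    ChartedSpaceCore (ℂ × ℂ) (BlowupPoint p) where
  atlas := {e | Charts hp h0 e}
  chartAt x := (exists_chart (hp := hp) (h0 := h0) x).choose
  mem_chart_source x := (exists_chart x).choose_spec.2
  chart_mem_atlas x := (exists_chart x).choose_spec.1
  open_source _ _ he he' := (Charts.trans hφ he he').1
  continuousOn_toFun _ _ he he' := (Charts.trans hφ he he').2.continuousOn

theorem continuous_down (hφ : φ ∈ Y.coords) (hp : p ∈ φ.source) (h0 : φ p = 0) :
    letI := (core hφ hp h0).toTopologicalSpace
    Continuous (down : BlowupPoint p → Y) := by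
  let _ := (core hφ hp h0).toTopologicalSpace
  rw [continuous_iff_continuousAt]
  intro x
  obtain ⟨e, he, hx⟩ := exists_chart (hp := hp) (h0 := h0) x
  let e' := (core hφ hp h0).openPartialHomeomorph e he
  have h1 : ContinuousAt (fun z => down (e.symm z)) (e x) :=
    (he.contMDiffOn_down hφ).continuousOn.continuousAt (he.isOpen_target.mem_nhds (e.map_source hx))
  have h2 : ContinuousAt e' x := e'.continuousAt hx
  refine (h1.comp (f := e') h2).congr ?_
  filter_upwards [e'.open_source.mem_nhds hx] with y hy
  exact congrArg down (e'.left_inv hy)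

/-- Points with distinct images are separated in `Y`. Two points of the exceptional curve lie in a
common chart, unless their slopes are 0 and ∞; these two are separated by the conditions |slope| < 1
and |inverse slope| < 1, because slope and inverse slope have product 1. -/
theorem t2Space (hφ : φ ∈ Y.coords) (hp : p ∈ φ.source) (h0 : φ p = 0) :
    letI := (core hφ hp h0).toTopologicalSpace
    T2Space (BlowupPoint p) := by
  let _ := (core hφ hp h0).toTopologicalSpace
  have hcont := continuous_down hφ hp h0
  let e₁ := (core hφ hp h0).openPartialHomeomorph _ (Charts.chart₁ (hp := hp) (h0 := h0))
  let e₂ := (core hφ hp h0).openPartialHomeomorph _ (Charts.chart₂ (hp := hp) (h0 := h0))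
  have sep : ∀ e : OpenPartialHomeomorph (BlowupPoint p) (ℂ × ℂ), ∀ x ∈ e.source, ∀ y ∈ e.source,
      x ≠ y → ∃ u v, IsOpen u ∧ IsOpen v ∧ x ∈ u ∧ y ∈ v ∧ Disjoint u v := by
    intro e x hx y hy hxy
    obtain ⟨u, v, hu, hv, hxu, hyv, huv⟩ := t2_separation (fun h => hxy (e.injOn hx hy h))
    refine ⟨e.source ∩ e ⁻¹' u, e.source ∩ e ⁻¹' v, e.isOpen_inter_preimage hu,
      e.isOpen_inter_preimage hv, ⟨hx, hxu⟩, ⟨hy, hyv⟩, ?_⟩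
    exact ((huv.preimage e).mono inter_subset_right inter_subset_right)
  have opp : ∃ u v : Set (BlowupPoint p), IsOpen u ∧ IsOpen v ∧ slope none ∈ u ∧
      slope (some 0) ∈ v ∧ Disjoint u v := by
    refine ⟨e₂.source ∩ e₂ ⁻¹' {z | ‖z.1‖ < 1}, e₁.source ∩ e₁ ⁻¹' {z | ‖z.2‖ < 1},
      e₂.isOpen_inter_preimage (isOpen_lt (by fun_prop) (by fun_prop)),
      e₁.isOpen_inter_preimage (isOpen_lt (by fun_prop) (by fun_prop)),
      ⟨(Option.some_ne_none (0 : ℂ)).symm, ?_⟩, ⟨Option.some_ne_none 0, ?_⟩, ?_⟩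
    · change ‖(0 : ℂ)‖ < 1; simp
    · change ‖(0 : ℂ)‖ < 1; simp
    · rw [Set.disjoint_left]
      rintro x ⟨h1, h2⟩ ⟨h3, h4⟩
      have h5 : (e₁ x).2 * (e₂ x).1 = 1 := by
        have h6 : e₁.symm (e₁ x) = x := e₁.left_inv h3
        have h7 : e₁ x ∈ e₁.target := e₁.map_source h3
        have h8 : (e₁ x).2 ≠ 0 := (chart₁_symm_mem_source_chart₂ (hp := hp) (h0 := h0) h7).1
          (by rw [show (chart₁ hp h0).symm (e₁ x) = x from h6]; exact h1)
        have h9 := chart₁_symm_chart₂ (hp := hp) (h0 := h0) h7 h8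
        rw [show (chart₁ hp h0).symm (e₁ x) = x from h6] at h9
        rw [show e₂ x = _ from h9]
        exact mul_inv_cancel₀ h8
      have h6 : ‖(e₁ x).2‖ * ‖(e₂ x).1‖ = 1 := by rw [← norm_mul, h5, norm_one]
      have h2' : ‖(e₂ x).1‖ < 1 := h2
      have h4' : ‖(e₁ x).2‖ < 1 := h4
      nlinarith [norm_nonneg (e₂ x).1, norm_nonneg (e₁ x).2]
  refine ⟨fun x y hxy => ?_⟩
  by_cases h : down x = down y
  · by_cases hx : down x = p
    · obtain ⟨o, rfl⟩ := exists_inr hx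
      obtain ⟨o', rfl⟩ := exists_inr (h ▸ hx)
      rcases o with _ | s <;> rcases o' with _ | t
      · exact absurd rfl hxy
      · rcases eq_or_ne t 0 with rfl | ht
        · exact opp
        · exact sep e₂ _ ((Option.some_ne_none 0).symm) _ (fun h => ht (Option.some.inj h)) hxy
      · rcases eq_or_ne s 0 with rfl | ht
        · obtain ⟨u, v, hu, hv, h1, h2, h3⟩ := opp
          exact ⟨v, u, hv, hu, h2, h1, h3.symm⟩
        · exact sep e₂ (slope (some s)) (fun h => ht (Option.some.inj h)) (slope none) ((Option.some_ne_none 0).symm) hxy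
      · exact sep e₁ _ (Option.some_ne_none s) _ (Option.some_ne_none t) hxy
    · refine absurd ?_ hxy
      rw [← up_down_of_ne hx none, h, up_down_of_ne (h ▸ hx)]
  · obtain ⟨u, v, hu, hv, hxu, hyv, huv⟩ := t2_separation h
    exact ⟨down ⁻¹' u, down ⁻¹' v, hu.preimage hcont, hv.preimage hcont, hxu, hyv, huv.preimage _⟩

theorem isManifold (hφ : φ ∈ Y.coords) (hp : p ∈ φ.source) (h0 : φ p = 0) :
    letI := (core hφ hp h0).toTopologicalSpace
    letI := (core hφ hp h0).toChartedSpace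
    IsManifold 𝓘(ℂ, ℂ × ℂ) ω (BlowupPoint p) := by
  let _ := (core hφ hp h0).toTopologicalSpace
  let _ := (core hφ hp h0).toChartedSpace
  refine isManifold_of_contDiffOn _ _ _ ?_
  intro e e' he he'
  obtain ⟨e, h1, rfl⟩ : ∃ d, ∃ hd : d ∈ (core hφ hp h0).atlas, e = (core hφ hp h0).openPartialHomeomorph d hd := by
    simpa only [atlas, ChartedSpace.atlas, mem_iUnion, mem_singleton_iff] using he
  obtain ⟨e', h2, rfl⟩ :
      ∃ d, ∃ hd : d ∈ (core hφ hp h0).atlas, e' = (core hφ hp h0).openPartialHomeomorph d hd := by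
    simpa only [atlas, ChartedSpace.atlas, mem_iUnion, mem_singleton_iff] using he'
  simp only [modelWithCornersSelf_coe, modelWithCornersSelf_coe_symm, Function.id_comp,
    Function.comp_id, preimage_id, range_id, inter_univ]
  exact (Charts.trans hφ h1 h2).2

end BlowupPoint

open BlowupPoint in
/-- The blowing-up of a surface at the origin of a coordinate system. -/
noncomputable def blowup {Y : ComplexSurface} {p : Y} {φ : OpenPartialHomeomorph Y (ℂ × ℂ)}
    (hφ : φ ∈ Y.coords) (hp : p ∈ φ.source) (h0 : φ p = 0) : ComplexSurface :=
  letI := (core hφ hp h0).toTopologicalSpace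
  letI := (core hφ hp h0).toChartedSpace
  haveI := t2Space hφ hp h0
  haveI := isManifold hφ hp h0
  { carrier := BlowupPoint p }

/-- The preimage under `E` of the domain of the coordinates `φ` is covered by the two standard
charts of a blowing-up. -/
def HasBlowupCharts {X Y : ComplexSurface} (E : X → Y) (φ : OpenPartialHomeomorph Y (ℂ × ℂ)) :
    Prop :=
  ∃ ψ₁ ∈ X.coords, ∃ ψ₂ ∈ X.coords,
    E ⁻¹' φ.source = ψ₁.source ∪ ψ₂.source ∧
    ψ₁.target = {z | (z.1, z.1 * z.2) ∈ φ.target} ∧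
    ψ₂.target = {z | (z.1 * z.2, z.2) ∈ φ.target} ∧
    (∀ x ∈ ψ₁.source, φ (E x) = ((ψ₁ x).1, (ψ₁ x).1 * (ψ₁ x).2)) ∧
    (∀ x ∈ ψ₂.source, φ (E x) = ((ψ₂ x).1 * (ψ₂ x).2, (ψ₂ x).2))

open BlowupPoint in
theorem blowup_chart {Y : ComplexSurface} {p : Y} {φ : OpenPartialHomeomorph Y (ℂ × ℂ)}
    (hφ : φ ∈ Y.coords) (hp : p ∈ φ.source) (h0 : φ p = 0)
    {e : PartialEquiv (BlowupPoint p) (ℂ × ℂ)} (he : Charts hp h0 e) :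
    ∃ ψ ∈ (blowup hφ hp h0).coords, ψ.source = e.source ∧ ψ.target = e.target ∧
      (∀ x, ψ x = e x) ∧ ∀ z, ψ.symm z = e.symm z := by
  refine ⟨(core hφ hp h0).openPartialHomeomorph e he, ?_, rfl, rfl, fun x => rfl, fun z => rfl⟩
  apply IsManifold.subset_maximalAtlas
  change _ ∈ ⋃ (e : PartialEquiv (BlowupPoint p) (ℂ × ℂ)) (he : e ∈ (core hφ hp h0).atlas),
    {(core hφ hp h0).openPartialHomeomorph e he}
  simp only [mem_iUnion, mem_singleton_iff]
  exact ⟨e, he, rfl⟩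

open BlowupPoint in
/-- Every point can be blown up, with respect to any coordinates centred at this point. -/
theorem exists_isBlowup {Y : ComplexSurface} {p : Y} {φ : OpenPartialHomeomorph Y (ℂ × ℂ)}
    (hφ : φ ∈ Y.coords) (hp : p ∈ φ.source) (h0 : φ p = 0) :
    ∃ (X : ComplexSurface) (E : X → Y), IsBlowup E p ∧ HasBlowupCharts E φ := by
  have hcharts : HasBlowupCharts (X := blowup hφ hp h0) down φ := by
    obtain ⟨ψ₁, m₁, s₁, t₁, v₁, -⟩ := blowup_chart hφ hp h0 .chart₁
    obtain ⟨ψ₂, m₂, s₂, t₂, v₂, -⟩ := blowup_chart hφ hp h0 .chart₂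
    refine ⟨ψ₁, m₁, ψ₂, m₂, ?_, t₁, t₂, ?_, ?_⟩
    · rw [s₁, s₂]
      ext x
      rcases x with ⟨y, hy⟩ | o
      · change y ∈ φ.source ↔ (y ∈ φ.source ∧ (φ y).1 ≠ 0) ∨ (y ∈ φ.source ∧ (φ y).2 ≠ 0)
        refine ⟨fun h => ?_, fun h => h.elim And.left And.left⟩
        by_contra! hc
        refine hy (φ.injOn h hp ?_)
        rw [h0]
        exact Prod.ext (hc.1 h) (hc.2 h)
      · change p ∈ φ.source ↔ o ≠ none ∨ o ≠ some 0
        refine iff_of_true hp ?_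
        rcases o with _ | t <;> simp
    · intro x hx
      rw [v₁]
      rw [s₁] at hx
      rcases x with ⟨y, hy⟩ | o
      · obtain ⟨h1, h2⟩ : y ∈ φ.source ∧ (φ y).1 ≠ 0 := hx
        exact Prod.ext rfl (mul_div_cancel₀ _ h2).symm
      · exact h0.trans (Prod.ext rfl (zero_mul _).symm)
    · intro x hx
      rw [v₂]
      rw [s₂] at hx
      rcases x with ⟨y, hy⟩ | o
      · obtain ⟨h1, h2⟩ : y ∈ φ.source ∧ (φ y).2 ≠ 0 := hx
        exact Prod.ext (div_mul_cancel₀ _ h2).symm rfl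
      · exact h0.trans (Prod.ext (mul_zero _).symm rfl)
  refine ⟨blowup hφ hp h0, down, ⟨?_, ?_, ?_, φ, hφ, hp, h0, hcharts⟩, hcharts⟩
  · intro x
    obtain ⟨e, he, hx⟩ := exists_chart (hp := hp) (h0 := h0) x
    obtain ⟨ψ, m, s, t, v, i⟩ := blowup_chart hφ hp h0 he
    have hx' : x ∈ ψ.source := s ▸ hx
    have h1 : ContMDiffAt 𝓘(ℂ, ℂ × ℂ) 𝓘(ℂ, ℂ × ℂ) ω (fun z => down (e.symm z)) (ψ x) :=
      (he.contMDiffOn_down hφ).contMDiffAt (by rw [← t]; exact ψ.open_target.mem_nhds (ψ.map_source hx'))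
    refine (h1.comp x (contMDiffAt_coords m hx')).congr_of_eventuallyEq ?_
    filter_upwards [ψ.open_source.mem_nhds hx'] with y hy
    change _ = down (e.symm (ψ y))
    rw [← i, ψ.left_inv hy]
  · intro y hy
    refine ⟨off y hy, rfl, ?_⟩
    rintro (⟨y', hy'⟩ | o) h
    · change y' = y at h
      subst h; rfl
    · exact absurd h.symm hy
  · intro x hx
    obtain ⟨φ', h1, h2⟩ := exists_coords_mem (down x)
    have hp' : p ∉ (φ'.restr {p}ᶜ).source := by simp
    have h1' := restr_mem_coords h1 (U := {p}ᶜ) isClosed_singleton.isOpen_compl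
    obtain ⟨ψ, m, s, t, v, i⟩ := blowup_chart hφ hp h0 (.lift h1' hp')
    refine isLocalDiffeomorphAt_of_coords m h1' (fun z hz => ?_) (x := x) ?_
    · rw [v]
      rw [s] at hz
      exact ⟨hz, rfl⟩
    · rw [s]
      change down x ∈ (φ'.restr {p}ᶜ).source
      rw [φ'.restr_source, isClosed_singleton.isOpen_compl.interior_eq]
      exact ⟨h2, hx⟩

end ComplexSurface

/-! ### Principal pull-backs of a maximal ideal and the universal property of blowing-ups. -/

/-- An analytic map vanishing at the origin is of the form `w ↦ A w w`, with `A` analytic. -/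
theorem AnalyticAt.exists_eventually_eq_apply_self {𝕜 E F : Type*} [NontriviallyNormedField 𝕜]
    [NormedAddCommGroup E] [NormedSpace 𝕜 E] [NormedAddCommGroup F] [NormedSpace 𝕜 F]
    [CompleteSpace F] {f : E → F} (hf : AnalyticAt 𝕜 f 0) (h0 : f 0 = 0) :
    ∃ A : E → E →L[𝕜] F, AnalyticAt 𝕜 A 0 ∧ ∀ᶠ w in 𝓝 0, f w = A w w := by
  obtain ⟨p, r, hp⟩ := hf
  have hrad : 0 < p.shift.radius := by
    rw [FormalMultilinearSeries.radius_shift]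
    exact hp.r_pos.trans_le hp.r_le
  have hA := p.shift.hasFPowerSeriesOnBall hrad
  refine ⟨p.shift.sum, hA.analyticAt, ?_⟩
  -- The shifted series splits one argument off each coefficient and sums to A. Restoring this
  -- argument, with constant term f 0 = 0, gives back the series of f.
  have hB := hA.unshift (z := 0)
  have hpq : p.shift.unshift 0 = p := by
    ext n v
    rcases n with _ | n
    · simp only [FormalMultilinearSeries.unshift]
      have := hp.coeff_zero v
      rw [h0] at this
      simp [this]
    · simp only [FormalMultilinearSeries.unshift, FormalMultilinearSeries.shift]
      simp
  rw [hpq] at hB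
  have h1 := hp.mono (lt_min hp.r_pos hB.r_pos) (min_le_left _ _)
  have h2 := hB.mono (lt_min hp.r_pos hB.r_pos) (min_le_right _ _)
  have h3 := h1.unique h2
  filter_upwards [Metric.eball_mem_nhds (0 : E) h1.r_pos] with w hw
  simpa using h3 hw

/-- The derivative of a map of the form `w ↦ A w w` at the origin. -/
theorem hasFDerivAt_apply_self {𝕜 E F : Type*} [NontriviallyNormedField 𝕜]
    [NormedAddCommGroup E] [NormedSpace 𝕜 E] [NormedAddCommGroup F] [NormedSpace 𝕜 F]
    {f : E → F} {A : E → E →L[𝕜] F} (hA : DifferentiableAt 𝕜 A 0)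
    (h : ∀ᶠ w in 𝓝 0, f w = A w w) : HasFDerivAt f (A 0) 0 := by
  have h1 := hA.hasFDerivAt.clm_apply (hasFDerivAt_id (0 : E))
  refine HasFDerivAt.congr_of_eventuallyEq (h1.congr_fderiv ?_) h
  ext v
  simp

namespace ComplexSurface

variable {X Y Z X' : ComplexSurface}

/-- This lemma and the next one compute closures in charts, one inclusion each; all strict
transforms below are obtained in this way. -/
theorem mem_closure_of_coords {ψ : OpenPartialHomeomorph X (ℂ × ℂ)} {x : X} (hx : x ∈ ψ.source)
    {S : Set X} {Q : Set (ℂ × ℂ)} (hQ : ψ x ∈ closure Q)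
    (h : ∀ y ∈ ψ.source, ψ y ∈ Q → y ∈ S) : x ∈ closure S := by
  rw [mem_closure_iff_frequently] at hQ ⊢
  have h1 : Tendsto ψ.symm (𝓝 (ψ x)) (𝓝 x) := by
    simpa [ψ.left_inv hx] using (ψ.continuousAt_symm (ψ.map_source hx)).tendsto
  refine h1.frequently ?_
  refine (hQ.and_eventually (ψ.open_target.mem_nhds (ψ.map_source hx))).mono ?_
  rintro z ⟨hz, hz'⟩
  exact h _ (ψ.map_target hz') (by rwa [ψ.right_inv hz'])

theorem mem_of_mem_closure_coords {ψ : OpenPartialHomeomorph X (ℂ × ℂ)} {x : X}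
    (hx : x ∈ ψ.source) {S : Set X} {Q : Set (ℂ × ℂ)} (hQ : IsClosed Q)
    (h : ∀ y ∈ ψ.source, y ∈ S → ψ y ∈ Q) (hS : x ∈ closure S) : ψ x ∈ Q := by
  rw [mem_closure_iff_frequently] at hS
  rw [← hQ.closure_eq, mem_closure_iff_frequently]
  refine (ψ.continuousAt hx).tendsto.frequently ?_
  refine (hS.and_eventually (ψ.open_source.mem_nhds hx)).mono ?_
  rintro y ⟨hy, hy'⟩
  exact h y hy' hy

/-- In the coordinates `φ`, the map `h` is near `x` the product of a function and of a map
without zeros. -/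
def IsPrincipalAt (h : X' → Y) (φ : OpenPartialHomeomorph Y (ℂ × ℂ)) (x : X') : Prop :=
  ∃ (d : X' → ℂ) (l : X' → ℂ × ℂ), ContMDiffAt 𝓘(ℂ, ℂ × ℂ) 𝓘(ℂ, ℂ) ω d x ∧
    ContMDiffAt 𝓘(ℂ, ℂ × ℂ) 𝓘(ℂ, ℂ × ℂ) ω l x ∧ l x ≠ 0 ∧ ∀ᶠ y in 𝓝 x, φ (h y) = d y • l y

/-- The change of coordinates has the form w ↦ A(w) w with A(0) invertible, so d • l becomes d • A(φ
∘ h) l, and the second factor still has no zero at `x`. -/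
theorem IsPrincipalAt.change {h : X' → Y} {p : Y} {φ φ' : OpenPartialHomeomorph Y (ℂ × ℂ)}
    (hφ : φ ∈ Y.coords) (hφ' : φ' ∈ Y.coords) (hp : p ∈ φ.source) (hp' : p ∈ φ'.source)
    (h0 : φ p = 0) (h0' : φ' p = 0) {x : X'} (hc : ContMDiffAt 𝓘(ℂ, ℂ × ℂ) 𝓘(ℂ, ℂ × ℂ) ω h x)
    (hx : h x = p) (H : IsPrincipalAt h φ x) : IsPrincipalAt h φ' x := by
  have htrans : ∀ {φ φ' : OpenPartialHomeomorph Y (ℂ × ℂ)}, φ ∈ Y.coords → φ' ∈ Y.coords →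
      p ∈ φ.source → p ∈ φ'.source → φ p = 0 → φ' p = 0 →
      ∃ A : ℂ × ℂ → (ℂ × ℂ) →L[ℂ] (ℂ × ℂ), AnalyticAt ℂ A 0 ∧
        ∀ᶠ w in 𝓝 0, φ' (φ.symm w) = A w w := by
    intro φ φ' hφ hφ' hp hp' h0 h0'
    have h1 : φ.symm 0 = p := by rw [← h0, φ.left_inv hp]
    have h2 : ContMDiffAt 𝓘(ℂ, ℂ × ℂ) 𝓘(ℂ, ℂ × ℂ) ω (fun w => φ' (φ.symm w)) 0 := by
      refine ContMDiffAt.comp (g := φ') (f := φ.symm) _ ?_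
        (contMDiffAt_coords_symm hφ (h0 ▸ φ.map_source hp))
      rw [h1]
      exact contMDiffAt_coords hφ' hp'
    exact (contMDiffAt_iff_contDiffAt.1 h2).analyticAt.exists_eventually_eq_apply_self
      (by simp [h1, h0'])
  obtain ⟨A, hA, hA'⟩ := htrans hφ hφ' hp hp' h0 h0'
  obtain ⟨B, hB, hB'⟩ := htrans hφ' hφ hp' hp h0' h0
  -- A 0 and B 0 are the derivatives of mutually inverse coordinate changes, so B 0 ∘ A 0 = id.
  have hinj : ∀ v, A 0 v = 0 → v = 0 := by
    have h1 := hasFDerivAt_apply_self hA.differentiableAt hA'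
    have h2 := hasFDerivAt_apply_self hB.differentiableAt hB'
    have h3 : φ.symm 0 = p := by rw [← h0, φ.left_inv hp]
    have h3' : φ' (φ.symm 0) = 0 := by rw [h3, h0']
    rw [← h3'] at h2
    have h4 := h2.comp (0 : ℂ × ℂ) h1
    have h5 : ((fun w => φ (φ'.symm w)) ∘ fun w => φ' (φ.symm w)) =ᶠ[𝓝 0] id := by
      have h6 : ∀ᶠ w in 𝓝 (0 : ℂ × ℂ), w ∈ φ.target :=
        φ.open_target.mem_nhds (h0 ▸ φ.map_source hp)
      have h7 : ∀ᶠ w in 𝓝 (0 : ℂ × ℂ), φ.symm w ∈ φ'.source := by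
        apply (φ.continuousAt_symm (h0 ▸ φ.map_source hp)).eventually_mem
        rw [h3]
        exact φ'.open_source.mem_nhds hp'
      filter_upwards [h6, h7] with w h6 h7
      simp [φ'.left_inv h7, φ.right_inv h6]
    have h8 := (h4.congr_of_eventuallyEq h5.symm).unique (hasFDerivAt_id _)
    intro v hv
    have h9 := congrArg (fun L : (ℂ × ℂ) →L[ℂ] (ℂ × ℂ) => L v) h8
    simpa [h3', hv] using h9.symm
  obtain ⟨d, l, hd, hl, hlx, hdl⟩ := H
  have hφh : ContMDiffAt 𝓘(ℂ, ℂ × ℂ) 𝓘(ℂ, ℂ × ℂ) ω (fun y => φ (h y)) x :=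
    ContMDiffAt.comp (g := φ) x (hx ▸ contMDiffAt_coords hφ hp) hc
  refine ⟨d, fun y => A (φ (h y)) (l y), hd, ?_, ?_, ?_⟩
  · have h1 : ContMDiffAt 𝓘(ℂ, ℂ × ℂ) 𝓘(ℂ, (ℂ × ℂ) →L[ℂ] (ℂ × ℂ)) ω (fun y => A (φ (h y))) x := by
      refine ContMDiffAt.comp (g := A) (I' := 𝓘(ℂ, ℂ × ℂ)) x ?_ hφh
      rw [hx, h0]
      exact hA.contDiffAt.contMDiffAt
    exact h1.clm_apply hl
  · intro hz
    simp only [hx, h0] at hz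
    exact hlx (hinj _ hz)
  · have h1 : ∀ᶠ y in 𝓝 x, φ' (φ.symm (φ (h y))) = A (φ (h y)) (φ (h y)) := by
      have h2 : Tendsto (fun y => φ (h y)) (𝓝 x) (𝓝 0) := by
        have := hφh.continuousAt.tendsto
        rwa [hx, h0] at this
      exact h2.eventually hA'
    have h2 : ∀ᶠ y in 𝓝 x, h y ∈ φ.source :=
      hc.continuousAt.eventually_mem (φ.open_source.mem_nhds (hx ▸ hp))
    filter_upwards [h1, h2, hdl] with y h1 h2 h3
    rw [φ.left_inv h2] at h1
    rw [h1]
    nth_rewrite 2 [h3]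
    simp

/-- The pull-back by `h` of the maximal ideal of `p` is locally principal. -/
structure IsPrincipal (h : X' → Y) (p : Y) : Prop where
  holomorphic : IsHolomorphic h
  -- Without density the constant map with value `p` would qualify, taking d = 0.
  dense : Dense (h ⁻¹' {p}ᶜ)
  principal : ∀ x, h x = p → ∃ φ ∈ Y.coords, p ∈ φ.source ∧ φ p = 0 ∧ IsPrincipalAt h φ x

theorem IsPrincipal.at_coords {h : X' → Y} {p : Y} (H : IsPrincipal h p)
    {φ : OpenPartialHomeomorph Y (ℂ × ℂ)} (hφ : φ ∈ Y.coords) (hp : p ∈ φ.source) (h0 : φ p = 0)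
    {x : X'} (hx : h x = p) : IsPrincipalAt h φ x := by
  obtain ⟨φ', h1, h2, h3, h4⟩ := H.principal x hx
  exact h4.change h1 hφ h2 hp h3 h0 (H.holomorphic x) hx

theorem IsPrincipal.comp {h : X' → Y} {p : Y} (H : IsPrincipal h p) {g : X → X'}
    (hg : IsHolomorphic g) (hd : Dense ((h ∘ g) ⁻¹' {p}ᶜ)) : IsPrincipal (h ∘ g) p := by
  refine ⟨H.holomorphic.comp hg, hd, fun x hx => ?_⟩
  obtain ⟨φ, h1, h2, h3, d, l, h4, h5, h6, h7⟩ := H.principal (g x) hx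
  exact ⟨φ, h1, h2, h3, d ∘ g, l ∘ g, h4.comp x (hg x), h5.comp x (hg x), h6,
    (hg.continuous.continuousAt (x := x)).eventually h7⟩

theorem IsBlowup.continuous {E : X → Y} {p : Y} (hE : IsBlowup E p) : Continuous E :=
  hE.1.continuous

theorem IsBlowup.injOn {E : X → Y} {p : Y} (hE : IsBlowup E p) : InjOn E (E ⁻¹' {p}ᶜ) :=
  fun x hx _ _ h => (hE.2.1 (E x) hx).unique rfl h.symm

/-- In the two charts the projection is s • (1, t) and t • (s, 1). -/
theorem HasBlowupCharts.isPrincipalAt {E : X → Y} {φ : OpenPartialHomeomorph Y (ℂ × ℂ)}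
    (H : HasBlowupCharts E φ) {x : X} (hx : E x ∈ φ.source) : IsPrincipalAt E φ x := by
  obtain ⟨ψ₁, m₁, ψ₂, m₂, hs, t₁, t₂, v₁, v₂⟩ := H
  rcases (hs ▸ hx : x ∈ ψ₁.source ∪ ψ₂.source) with hx | hx
  · refine ⟨fun y => (ψ₁ y).1, fun y => (1, (ψ₁ y).2), ?_, ?_, by simp, ?_⟩
    · exact contDiff_fst.contMDiff.contMDiffAt.comp x (contMDiffAt_coords m₁ hx)
    · exact (contDiff_const.prodMk contDiff_snd).contMDiff.contMDiffAt.comp x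
        (contMDiffAt_coords m₁ hx)
    · filter_upwards [ψ₁.open_source.mem_nhds hx] with y hy
      simp [v₁ y hy]
  · refine ⟨fun y => (ψ₂ y).2, fun y => ((ψ₂ y).1, 1), ?_, ?_, by simp, ?_⟩
    · exact contDiff_snd.contMDiff.contMDiffAt.comp x (contMDiffAt_coords m₂ hx)
    · exact (contDiff_fst.prodMk contDiff_const).contMDiff.contMDiffAt.comp x
        (contMDiffAt_coords m₂ hx)
    · filter_upwards [ψ₂.open_source.mem_nhds hx] with y hy
      simp [v₂ y hy, mul_comm]

theorem dense_fst_ne : Dense {z : ℂ × ℂ | z.1 ≠ 0} := by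
  have : {z : ℂ × ℂ | z.1 ≠ 0} = ({0}ᶜ : Set ℂ) ×ˢ univ := by ext; simp
  rw [this]
  exact (dense_compl_singleton 0).prod dense_univ

theorem dense_snd_ne : Dense {z : ℂ × ℂ | z.2 ≠ 0} := by
  have : {z : ℂ × ℂ | z.2 ≠ 0} = univ ×ˢ ({0}ᶜ : Set ℂ) := by ext; simp
  rw [this]
  exact dense_univ.prod (dense_compl_singleton 0)

theorem IsBlowup.dense {E : X → Y} {p : Y} (hE : IsBlowup E p) : Dense (E ⁻¹' {p}ᶜ) := by
  obtain ⟨-, -, -, φ, hφ, hp, h0, ψ₁, m₁, ψ₂, m₂, hs, t₁, t₂, v₁, v₂⟩ := hE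
  intro x
  by_cases hx : E x = p
  · have hx' : x ∈ ψ₁.source ∪ ψ₂.source := hs ▸ (show E x ∈ φ.source from hx ▸ hp)
    rcases hx' with hx' | hx'
    · refine mem_closure_of_coords hx' (dense_fst_ne _) fun y hy hy' h => hy' ?_
      have h1 := v₁ y hy
      rw [h, h0] at h1
      exact (congrArg Prod.fst h1).symm
    · refine mem_closure_of_coords hx' (dense_snd_ne _) fun y hy hy' h => hy' ?_
      have h1 := v₂ y hy
      rw [h, h0] at h1
      exact (congrArg Prod.snd h1).symm
  · exact subset_closure hx

theorem IsBlowup.isPrincipal {E : X → Y} {p : Y} (hE : IsBlowup E p) : IsPrincipal E p := by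
  refine ⟨hE.1, hE.dense, fun x hx => ?_⟩
  obtain ⟨-, -, -, φ, hφ, hp, h0, H⟩ := hE
  exact ⟨φ, hφ, hp, h0, HasBlowupCharts.isPrincipalAt H (hx ▸ hp)⟩

/-- Local existence of liftings to a blowing-up. -/
theorem IsBlowup.exists_lift_at {E : X → Y} {p : Y} (hE : IsBlowup E p) {h : X' → Y}
    (H : IsPrincipal h p) (x : X') :
    ∃ g : X' → X, ContMDiffAt 𝓘(ℂ, ℂ × ℂ) 𝓘(ℂ, ℂ × ℂ) ω g x ∧ ∀ᶠ y in 𝓝 x, E (g y) = h y := by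
  by_cases hx : h x = p
  · obtain ⟨-, -, -, φ, hφ, hp, h0, ψ₁, m₁, ψ₂, m₂, hs, t₁, t₂, v₁, v₂⟩ := hE
    obtain ⟨d, l, hd, hl, hlx, hdl⟩ := H.at_coords hφ hp h0 hx
    have hsrc : ∀ᶠ y in 𝓝 x, h y ∈ φ.source :=
      H.holomorphic.continuous.continuousAt.eventually_mem (φ.open_source.mem_nhds (hx ▸ hp))
    have hl₁ : ContMDiffAt 𝓘(ℂ, ℂ × ℂ) 𝓘(ℂ, ℂ) ω (fun y => (l y).1) x :=
      contDiff_fst.contMDiff.contMDiffAt.comp x hl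
    have hl₂ : ContMDiffAt 𝓘(ℂ, ℂ × ℂ) 𝓘(ℂ, ℂ) ω (fun y => (l y).2) x :=
      contDiff_snd.contMDiff.contMDiffAt.comp x hl
    have key : ∀ (ψ : OpenPartialHomeomorph X (ℂ × ℂ)) (std : ℂ × ℂ → ℂ × ℂ) (k : X' → ℂ × ℂ),
        ψ ∈ X.coords → ψ.source ⊆ E ⁻¹' φ.source → ψ.target = {z | std z ∈ φ.target} →
        (∀ x ∈ ψ.source, φ (E x) = std (ψ x)) →
        ContMDiffAt 𝓘(ℂ, ℂ × ℂ) 𝓘(ℂ, ℂ × ℂ) ω k x → (∀ᶠ y in 𝓝 x, std (k y) = d y • l y) →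
        ∃ g : X' → X, ContMDiffAt 𝓘(ℂ, ℂ × ℂ) 𝓘(ℂ, ℂ × ℂ) ω g x ∧ ∀ᶠ y in 𝓝 x, E (g y) = h y := by
      intro ψ std k m hsub ht hv hk hstd
      have htar : ∀ᶠ y in 𝓝 x, k y ∈ ψ.target := by
        filter_upwards [hdl, hsrc, hstd] with y h1 h2 h3
        rw [ht]
        change std (k y) ∈ φ.target
        rw [h3, ← h1]
        exact φ.map_source h2
      refine ⟨fun y => ψ.symm (k y),
        (contMDiffAt_coords_symm m htar.self_of_nhds).comp x hk, ?_⟩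
      filter_upwards [hdl, hsrc, hstd, htar] with y h1 h2 h3 h4
      refine φ.injOn (hsub (ψ.map_target h4)) h2 ?_
      rw [hv _ (ψ.map_target h4), ψ.right_inv h4, h3, h1]
    -- One component of l does not vanish at `x`. If it is the first, the lift is (d l₁, l₂ / l₁) in
    -- the first chart; otherwise it is (l₁ / l₂, d l₂) in the second.
    rcases not_and_or.1 (mt Prod.ext_iff.2 hlx) with h1 | h1
    · refine key ψ₁ _ (fun y => (d y * (l y).1, (l y).2 / (l y).1)) m₁
        (hs ▸ subset_union_left) t₁ v₁ ?_ ?_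
      · refine ContMDiffAt.prodMk_space (hd.mul hl₁) ?_
        exact (ContDiffAt.contMDiffAt (f := fun z : ℂ × ℂ => z.2 / z.1) (n := ω)
          (contDiffAt_snd.div contDiffAt_fst h1)).comp (g := fun z : ℂ × ℂ => z.2 / z.1) x hl
      · filter_upwards [hl₁.continuousAt.eventually_ne (show (l x).1 ≠ 0 from h1)] with y hy
        refine Prod.ext (by simp) ?_
        simp only [Prod.smul_snd, smul_eq_mul]
        field_simp
    · refine key ψ₂ _ (fun y => ((l y).1 / (l y).2, d y * (l y).2)) m₂
        (hs ▸ subset_union_right) t₂ v₂ ?_ ?_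
      · refine ContMDiffAt.prodMk_space ?_ (hd.mul hl₂)
        exact (ContDiffAt.contMDiffAt (f := fun z : ℂ × ℂ => z.1 / z.2) (n := ω)
          (contDiffAt_fst.div contDiffAt_snd h1)).comp (g := fun z : ℂ × ℂ => z.1 / z.2) x hl
      · filter_upwards [hl₂.continuousAt.eventually_ne (show (l x).2 ≠ 0 from h1)] with y hy
        refine Prod.ext ?_ (by simp)
        simp only [Prod.smul_fst, smul_eq_mul]
        field_simp
  · obtain ⟨x', hx', -⟩ := hE.2.1 (h x) hx
    obtain ⟨e, h1, h2, h3, h4⟩ := exists_openPartialHomeomorph_at (hE.2.2.1 x' (hx' ▸ hx))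
    have h5 : h x ∈ e.target := by rw [← hx', h2 x' h1]; exact e.map_source h1
    refine ⟨fun y => e.symm (h y),
      (h4.contMDiffAt (e.open_target.mem_nhds h5)).comp x (H.holomorphic x), ?_⟩
    filter_upwards [H.holomorphic.continuous.continuousAt.eventually_mem
      (e.open_target.mem_nhds h5)] with y hy
    rw [h2 _ (e.map_target hy), e.right_inv hy]

/-- Two liftings agree where h ≠ p, since E is injective over the complement of `p`. This set is
dense and `X` is Hausdorff, so their values at `x` agree as well. -/
theorem IsBlowup.lift_unique {E : X → Y} {p : Y} (hE : IsBlowup E p) {h : X' → Y}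
    (hd : Dense (h ⁻¹' {p}ᶜ)) {g g' : X' → X} {x : X'} (hg : ContinuousAt g x)
    (hg' : ContinuousAt g' x) (h1 : ∀ᶠ y in 𝓝 x, E (g y) = h y)
    (h2 : ∀ᶠ y in 𝓝 x, E (g' y) = h y) : g x = g' x := by
  have : (𝓝[h ⁻¹' {p}ᶜ] x).NeBot := mem_closure_iff_nhdsWithin_neBot.1 (hd x)
  have h3 : ∀ᶠ y in 𝓝[h ⁻¹' {p}ᶜ] x, g y = g' y := by
    filter_upwards [self_mem_nhdsWithin, nhdsWithin_le_nhds h1, nhdsWithin_le_nhds h2]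
      with y h3 h4 h5
    exact hE.injOn (by rwa [mem_preimage, h4]) (by rwa [mem_preimage, h5]) (h4.trans h5.symm)
  exact tendsto_nhds_unique ((hg.tendsto.mono_left nhdsWithin_le_nhds).congr' h3)
    (hg'.tendsto.mono_left nhdsWithin_le_nhds)

/-- The universal property of blowing-ups. -/
theorem IsBlowup.exists_lift {E : X → Y} {p : Y} (hE : IsBlowup E p) {h : X' → Y}
    (H : IsPrincipal h p) : ∃ g : X' → X, IsHolomorphic g ∧ E ∘ g = h := by
  choose g hg hg' using fun x => hE.exists_lift_at H x
  -- The value at `x` is that of the local lifting chosen at `x`; by uniqueness it coincides, near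
  -- `x`, with one fixed local lifting.
  refine ⟨fun x => g x x, fun x => ?_, funext fun x => (hg' x).self_of_nhds⟩
  refine (hg x).congr_of_eventuallyEq ?_
  filter_upwards [(contMDiffAt_iff_contMDiffAt_nhds (by simp)).1 (hg x), (hg' x).eventually_nhds] with y h1 h2
  exact hE.lift_unique H.dense (hg y).continuousAt h1.continuousAt (hg' y) h2

end ComplexSurface

/-! ### Uniqueness and commutation of blowing-ups; factorization of modifications. -/

namespace ComplexSurface

variable {X Y Z X' Y' : ComplexSurface}

/-- Biholomorphic maps. -/
def IsBiholomorphic (θ : X → Y) : Prop :=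
  IsHolomorphic θ ∧ ∃ τ : Y → X, IsHolomorphic τ ∧ τ ∘ θ = id ∧ θ ∘ τ = id

theorem isBiholomorphic_id : IsBiholomorphic (id : X → X) :=
  ⟨isHolomorphic_id, id, isHolomorphic_id, rfl, rfl⟩

theorem IsBiholomorphic.comp {θ : Y → Z} {η : X → Y} (hθ : IsBiholomorphic θ)
    (hη : IsBiholomorphic η) : IsBiholomorphic (θ ∘ η) := by
  obtain ⟨h1, τ, h2, h3, h4⟩ := hθ
  obtain ⟨k1, σ, k2, k3, k4⟩ := hη
  refine ⟨h1.comp k1, σ ∘ τ, k2.comp h2, ?_, ?_⟩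
  · rw [show (σ ∘ τ) ∘ θ ∘ η = σ ∘ (τ ∘ θ) ∘ η from rfl, h3, Function.id_comp, k3]
  · rw [show (θ ∘ η) ∘ σ ∘ τ = θ ∘ (η ∘ σ) ∘ τ from rfl, k4, Function.id_comp, h4]

theorem IsBiholomorphic.isLocalDiffeomorphAt {θ : X → Y} (hθ : IsBiholomorphic θ) (x : X) :
    IsLocalDiffeomorphAt 𝓘(ℂ, ℂ × ℂ) 𝓘(ℂ, ℂ × ℂ) ω θ x := by
  obtain ⟨h1, τ, h2, h3, h4⟩ := hθ
  let D : Diffeomorph 𝓘(ℂ, ℂ × ℂ) 𝓘(ℂ, ℂ × ℂ) X Y ω :=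
    ⟨⟨θ, τ, congrFun h3, congrFun h4⟩, h1, h2⟩
  exact D.isLocalDiffeomorph x

theorem IsBiholomorphic.bijective {θ : X → Y} (hθ : IsBiholomorphic θ) :
    Function.Bijective θ := by
  obtain ⟨h1, τ, h2, h3, h4⟩ := hθ
  exact ⟨Function.LeftInverse.injective (congrFun h3),
    Function.RightInverse.surjective (congrFun h4)⟩

theorem IsBiholomorphic.exists_openPartialHomeomorph {θ : X → Y} (hθ : IsBiholomorphic θ) :
    ∃ e : OpenPartialHomeomorph X Y, e.source = univ ∧ e.target = univ ∧ (e : X → Y) = θ ∧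
      ContMDiffOn 𝓘(ℂ, ℂ × ℂ) 𝓘(ℂ, ℂ × ℂ) ω e e.source ∧
      ContMDiffOn 𝓘(ℂ, ℂ × ℂ) 𝓘(ℂ, ℂ × ℂ) ω e.symm e.target := by
  obtain ⟨h1, τ, h2, h3, h4⟩ := hθ
  let H : X ≃ₜ Y := ⟨⟨θ, τ, congrFun h3, congrFun h4⟩, h1.continuous, h2.continuous⟩
  exact ⟨H.toOpenPartialHomeomorph, rfl, rfl, rfl, h1.contMDiffOn, h2.contMDiffOn⟩

theorem HasBlowupCharts.comp_right {E : X → Y} {φ : OpenPartialHomeomorph Y (ℂ × ℂ)}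
    (H : HasBlowupCharts E φ) {θ : X' → X} (hθ : IsBiholomorphic θ) :
    HasBlowupCharts (E ∘ θ) φ := by
  obtain ⟨ψ₁, m₁, ψ₂, m₂, hs, t₁, t₂, v₁, v₂⟩ := H
  obtain ⟨e, es, et, rfl, h1, h2⟩ := hθ.exists_openPartialHomeomorph
  refine ⟨e.trans ψ₁, trans_mem_coords h1 h2 m₁, e.trans ψ₂, trans_mem_coords h1 h2 m₂,
    ?_, ?_, ?_, ?_, ?_⟩
  · rw [preimage_comp, hs]
    simp [es]
  · simp [et, t₁]
  · simp [et, t₂]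
  · intro x hx
    exact v₁ (e x) (by simpa [es] using hx)
  · intro x hx
    exact v₂ (e x) (by simpa [es] using hx)

theorem IsBlowup.comp_right {E : X → Y} {p : Y} (hE : IsBlowup E p) {θ : X' → X}
    (hθ : IsBiholomorphic θ) : IsBlowup (E ∘ θ) p := by
  obtain ⟨h1, h2, h3, φ, hφ, hp, h0, H⟩ := hE
  refine ⟨h1.comp hθ.1, fun y hy => ?_, fun x hx => ?_, φ, hφ, hp, h0,
    HasBlowupCharts.comp_right H hθ⟩
  · obtain ⟨x, hx, hx'⟩ := h2 y hy
    obtain ⟨x', rfl⟩ := hθ.bijective.2 x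
    exact ⟨x', hx, fun z hz => hθ.bijective.1 (hx' _ hz)⟩
  · exact IsLocalDiffeomorphAt.comp _ _ (hθ.isLocalDiffeomorphAt x) (h3 (θ x) hx)

theorem IsBlowup.comp_left {E : X → Y} {p : Y} (hE : IsBlowup E p) {θ : Y → Y'}
    (hθ : IsBiholomorphic θ) : IsBlowup (θ ∘ E) (θ p) := by
  obtain ⟨h1, h2, h3, φ, hφ, hp, h0, ψ₁, m₁, ψ₂, m₂, hs, t₁, t₂, v₁, v₂⟩ := hE
  have hinj := hθ.bijective.1
  refine ⟨hθ.1.comp h1, fun y hy => ?_, fun x hx => ?_, ?_⟩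
  · obtain ⟨y, rfl⟩ := hθ.bijective.2 y
    obtain ⟨x, hx, hx'⟩ := h2 y (fun h => hy (by rw [h]))
    exact ⟨x, congrArg θ hx, fun z hz => hx' _ (hinj hz)⟩
  · exact IsLocalDiffeomorphAt.comp _ _ (h3 x (fun h => hx (congrArg θ h)))
      (hθ.isLocalDiffeomorphAt (E x))
  · obtain ⟨e, es, et, rfl, h1, h2⟩ := hθ.exists_openPartialHomeomorph
    have hl : ∀ y, e.symm (e y) = y := fun y => e.left_inv (es ▸ mem_univ y)
    refine ⟨e.symm.trans φ, trans_mem_coords h2 h1 hφ, by simp [et, hl, hp], by simp [hl, h0],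
      ψ₁, m₁, ψ₂, m₂, ?_, ?_, ?_, ?_, ?_⟩
    · rw [← hs]
      ext x
      simp [et, hl]
    · simp [es, t₁]
    · simp [es, t₂]
    · intro x hx
      simpa [hl] using v₁ x hx
    · intro x hx
      simpa [hl] using v₂ x hx

theorem IsBlowup.lift_ext {E : X → Y} {p : Y} (hE : IsBlowup E p) {g g' : X' → X}
    (hg : Continuous g) (hg' : Continuous g') (hd : Dense ((E ∘ g) ⁻¹' {p}ᶜ))
    (h : E ∘ g = E ∘ g') : g = g' :=
  funext fun _ => hE.lift_unique hd hg.continuousAt hg'.continuousAt (Eventually.of_forall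
    fun _ => rfl) (Eventually.of_forall fun y => (congrFun h y).symm)

/-- Two blowing-ups of the same point are isomorphic. -/
theorem IsBlowup.unique {E : X → Y} {E' : X' → Y} {p : Y} (hE : IsBlowup E p)
    (hE' : IsBlowup E' p) : ∃ θ : X' → X, IsBiholomorphic θ ∧ E ∘ θ = E' := by
  obtain ⟨θ, h1, h2⟩ := hE.exists_lift hE'.isPrincipal
  obtain ⟨τ, k1, k2⟩ := hE'.exists_lift hE.isPrincipal
  refine ⟨θ, ⟨h1, τ, k1, ?_, ?_⟩, h2⟩
  · have : E' ∘ (τ ∘ θ) = E' := by rw [← Function.comp_assoc, k2, h2]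
    exact hE'.lift_ext (k1.comp h1).continuous continuous_id (by rw [this]; exact hE'.dense) this
  · have : E ∘ (θ ∘ τ) = E := by rw [← Function.comp_assoc, h2, k2]
    exact hE.lift_ext (h1.comp k1).continuous continuous_id (by rw [this]; exact hE.dense) this

/-- A blowing-up has its standard form in all coordinates centred at the blown-up point. -/
theorem IsBlowup.hasBlowupCharts {E : X → Y} {p : Y} (hE : IsBlowup E p)
    {φ : OpenPartialHomeomorph Y (ℂ × ℂ)} (hφ : φ ∈ Y.coords) (hp : p ∈ φ.source) (h0 : φ p = 0) :
    HasBlowupCharts E φ := by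
  obtain ⟨X', E', hE', H⟩ := exists_isBlowup hφ hp h0
  obtain ⟨θ, hθ, h⟩ := hE'.unique hE
  rw [← h]
  exact H.comp_right hθ

theorem exists_isBlowup_at (p : Y) : ∃ (X : ComplexSurface) (E : X → Y), IsBlowup E p := by
  obtain ⟨φ, h1, h2, h3⟩ := exists_coords_centered p
  obtain ⟨X, E, h, -⟩ := exists_isBlowup h1 h2 h3
  exact ⟨X, E, h⟩

theorem IsBlowup.dense_preimage {E : X → Y} {p : Y} (hE : IsBlowup E p) {U : Set Y}
    (hU : Dense U) : Dense (E ⁻¹' U) := by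
  have h1 : E ⁻¹' {p}ᶜ ⊆ closure (E ⁻¹' U) := by
    intro x hx
    rw [mem_closure_iff_frequently]
    have h2 := mem_closure_iff_frequently.1 (hU (E x))
    rw [← map_nhds_eq_of_isLocalDiffeomorphAt (hE.2.2.1 x hx)] at h2
    exact frequently_map.1 h2
  exact fun x => closure_minimal h1 isClosed_closure (hE.dense x)

/-- F is biholomorphic near `z` and `z` is its whole fibre, so the maximal ideals of F z and of `z`
have the same pull-back. -/
theorem isPrincipal_comp_iff {F : Z → Y} (hF : IsHolomorphic F) {z : Z}
    (hloc : IsLocalDiffeomorphAt 𝓘(ℂ, ℂ × ℂ) 𝓘(ℂ, ℂ × ℂ) ω F z) (hfib : ∀ w, F w = F z → w = z)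
    {k : X → Z} (hk : IsHolomorphic k) : IsPrincipal (F ∘ k) (F z) ↔ IsPrincipal k z := by
  obtain ⟨e, hz, he, he₁, he₂⟩ := exists_openPartialHomeomorph_at hloc
  obtain ⟨φ, hφ, hp, h0⟩ := exists_coords_centered (F z)
  have hm := trans_mem_coords he₁ he₂ hφ
  have hfib' : ∀ w, F w = F z ↔ w = z := fun w => ⟨hfib w, fun h => by rw [h]⟩
  have hset : (F ∘ k) ⁻¹' {F z}ᶜ = k ⁻¹' {z}ᶜ := by
    ext x
    simp [hfib']
  have hs : z ∈ (e.trans φ).source := by simp [hz, ← he z hz, hp]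
  have hs0 : e.trans φ z = 0 := by simp [← he z hz, h0]
  have key : ∀ x, k x = z → (IsPrincipalAt (F ∘ k) φ x ↔ IsPrincipalAt k (e.trans φ) x) := by
    intro x hx
    have hev : ∀ᶠ y in 𝓝 x, φ ((F ∘ k) y) = e.trans φ (k y) := by
      filter_upwards [hk.continuous.continuousAt.eventually_mem
        (e.open_source.mem_nhds (hx ▸ hz : k x ∈ e.source))] with y hy
      simp [he _ hy]
    constructor
    · rintro ⟨d, l, h1, h2, h3, h4⟩
      refine ⟨d, l, h1, h2, h3, ?_⟩
      filter_upwards [h4, hev] with y h5 h6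
      rw [← h6, h5]
    · rintro ⟨d, l, h1, h2, h3, h4⟩
      refine ⟨d, l, h1, h2, h3, ?_⟩
      filter_upwards [h4, hev] with y h5 h6
      rw [h6, h5]
  constructor
  · intro H
    exact ⟨hk, hset ▸ H.dense, fun x hx => ⟨e.trans φ, hm, hs, hs0,
      (key x hx).1 (H.at_coords hφ hp h0 (congrArg F hx))⟩⟩
  · intro H
    exact ⟨hF.comp hk, hset ▸ H.dense, fun x hx => ⟨φ, hφ, hp, h0,
      (key x (hfib _ hx)).2 (H.at_coords hm hs hs0 (hfib _ hx))⟩⟩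

/-- The blowing-ups of two distinct points commute. -/
theorem IsBlowup.comm {Y₁ Z₁ : ComplexSurface} {F : Z → Y} {q : Y} (hF : IsBlowup F q)
    {B : Y₁ → Y} {p : Y} (hB : IsBlowup B p) (hpq : p ≠ q) {z : Z} (hz : F z = p) {B' : Z₁ → Z}
    (hB' : IsBlowup B' z) : ∃ (θ : Z₁ → Y₁) (q' : Y₁), IsBlowup θ q' ∧ B ∘ θ = F ∘ B' := by
  subst hz
  have fibF : ∀ w, F w = F z → w = z := fun w hw => (hF.2.1 (F z) hpq).unique hw rfl
  obtain ⟨q', rfl, hq'⟩ := hB.2.1 q hpq.symm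
  have locF := hF.2.2.1 z hpq
  have locB := hB.2.2.1 q' hpq.symm
  -- Let F' be the blowing-up of the point q' of Y₁ over q. Four liftings are taken: θ of F ∘ B'
  -- through B, β of B ∘ F' through F, σ of β through B', τ of θ through F'. Uniqueness makes σ and
  -- τ mutually inverse, so θ = F' ∘ τ is a blowing-up of q'.
  obtain ⟨θ, hθ, eθ⟩ := hB.exists_lift ((isPrincipal_comp_iff hF.1 locF fibF hB'.1).2 hB'.isPrincipal)
  obtain ⟨W, F', hF'⟩ := exists_isBlowup_at q'
  obtain ⟨β, hβ, eβ⟩ := hF.exists_lift ((isPrincipal_comp_iff hB.1 locB hq' hF'.1).2 hF'.isPrincipal)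
  have dBF : Dense ((B ∘ F') ⁻¹' {F z}ᶜ) := hF'.dense_preimage hB.dense
  have dFB : Dense ((F ∘ B') ⁻¹' {B q'}ᶜ) := hB'.dense_preimage hF.dense
  obtain ⟨σ, hσ, eσ⟩ := hB'.exists_lift ((isPrincipal_comp_iff hF.1 locF fibF hβ).1
    (eβ ▸ hB.isPrincipal.comp hF'.1 dBF))
  obtain ⟨τ, hτ, eτ⟩ := hF'.exists_lift ((isPrincipal_comp_iff hB.1 locB hq' hθ).1
    (eθ ▸ hF.isPrincipal.comp hB'.1 dFB))
  have h1 : F ∘ (β ∘ τ) = F ∘ B' := by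
    rw [← Function.comp_assoc, eβ, Function.comp_assoc, eτ, eθ]
  have h2 : β ∘ τ = B' := hF.lift_ext (hβ.comp hτ).continuous hB'.continuous (h1 ▸ dFB) h1
  have h3 : B' ∘ (σ ∘ τ) = B' := by rw [← Function.comp_assoc, eσ, h2]
  have h4 : σ ∘ τ = id := hB'.lift_ext (hσ.comp hτ).continuous continuous_id
    (h3.symm ▸ hB'.dense) h3
  have k1 : B ∘ (θ ∘ σ) = B ∘ F' := by
    rw [← Function.comp_assoc, eθ, Function.comp_assoc, eσ, eβ]
  have k2 : θ ∘ σ = F' := hB.lift_ext (hθ.comp hσ).continuous hF'.continuous (k1 ▸ dBF) k1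
  have k3 : F' ∘ (τ ∘ σ) = F' := by rw [← Function.comp_assoc, eτ, k2]
  have k4 : τ ∘ σ = id := hF'.lift_ext (hτ.comp hσ).continuous continuous_id
    (k3.symm ▸ hF'.dense) k3
  exact ⟨θ, q', eτ ▸ hF'.comp_right ⟨hτ, σ, hσ, h4, k4⟩, eθ⟩

/-- Finite compositions of blowing-ups of points, up to isomorphism. -/
inductive IsModification : {X Y : ComplexSurface} → (X → Y) → Prop
  | iso {X Y : ComplexSurface} {θ : X → Y} : IsBiholomorphic θ → IsModification θ
  -- Induction strips off the blowing-up closest to the target, to be compared with the blowing-up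
  -- of a point of the target; `IsBlowupComposition` strips off the one closest to the source.
  | step {X Z Y : ComplexSurface} {F : Z → Y} {G : X → Z} {q : Y} :
      IsBlowup F q → IsModification G → IsModification (F ∘ G)

theorem IsModification.isHolomorphic {G : X → Y} (hG : IsModification G) : IsHolomorphic G := by
  induction hG with
  | iso h => exact h.1
  | step hF _ ih => exact hF.1.comp ih

theorem IsModification.biholomorphic_comp {G : X → Y} (hG : IsModification G) {θ : Y → Z}
    (hθ : IsBiholomorphic θ) : IsModification (θ ∘ G) := by
  cases hG with
  | iso h => exact .iso (hθ.comp h)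
  | step hF hG =>
    rw [← Function.comp_assoc]
    exact .step (hF.comp_left hθ) hG

theorem IsModification.comp_blowup {G : X → Y} (hG : IsModification G) {F : X' → X} {q : X}
    (hF : IsBlowup F q) : IsModification (G ∘ F) := by
  induction hG with
  | iso h => exact .step (G := id) (hF.comp_left h) (.iso isBiholomorphic_id)
  | step hF' _ ih =>
    rw [Function.comp_assoc]
    exact .step hF' ih

theorem IsBlowupComposition.isModification {E : X → Y} (hE : IsBlowupComposition Y X E) :
    IsModification E := by
  induction hE with
  | refl => exact .iso isBiholomorphic_id
  | step _ hF ih => exact ih.comp_blowup hF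

theorem IsBlowupComposition.comp {E : X → Y} {E' : X' → X} (hE : IsBlowupComposition Y X E)
    (hE' : IsBlowupComposition X X' E') : IsBlowupComposition Y X' (E ∘ E') := by
  induction hE' with
  | refl => exact hE
  | step _ hF ih =>
    rw [← Function.comp_assoc]
    exact .step ih hF

/-- If the total transform of `C` by `E` has normal crossings but `C` has not at `p`, then `E`
factors through the blowing-up of `p`. -/
theorem IsModification.exists_factor {E : X → Y} (hE : IsModification E) :
    ∀ {C : Set Y} {p : Y} {Y₁ : ComplexSurface} {B : Y₁ → Y}, IsBlowup B p → p ∈ C →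
      ¬ HasNormalCrossingAt C p → (∀ x ∈ E ⁻¹' C, HasNormalCrossingAt (E ⁻¹' C) x) →
      ∃ g : X → Y₁, IsModification g ∧ B ∘ g = E := by
  induction hE with
  | @iso Y θ hθ =>
    intro C p Y₁ B hB hp hnc h
    obtain ⟨x, rfl⟩ := hθ.bijective.2 p
    -- An isomorphism cannot improve the singularity at `p`.
    exact absurd ((h x hp).of_preimage (hθ.isLocalDiffeomorphAt x)) hnc
  | @step Z Y F G q hF hG ih =>
    intro C p Y₁ B hB hp hnc h
    by_cases hpq : p = q
    · subst hpq
      obtain ⟨θ, hθ, e⟩ := hB.unique hF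
      exact ⟨θ ∘ G, hG.biholomorphic_comp hθ, by rw [← Function.comp_assoc, e]⟩
    -- Since F is biholomorphic near the point z over p, z is not a normal crossing of the total
    -- transform either. By induction G factors through the blowing-up of z, which commutes with
    -- that of q.
    · obtain ⟨z, hz, -⟩ := hF.2.1 p hpq
      obtain ⟨Z₁, B', hB'⟩ := exists_isBlowup_at z
      obtain ⟨g, hg, e⟩ := ih (C := F ⁻¹' C) hB' (show F z ∈ C from hz ▸ hp)
        (fun hc => hnc (hz ▸ hc.of_preimage (hF.2.2.1 z (hz ▸ hpq)))) h
      obtain ⟨θ, q', hθ, e'⟩ := hF.comm hB hpq hz hB'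
      refine ⟨θ ∘ g, .step hθ hg, ?_⟩
      rw [← Function.comp_assoc, e', Function.comp_assoc, e]

/-- Every modification which makes the total transform of `C` a normal crossing curve factors
through `E`. -/
def FactorsAll (E : X → Y) (C : Set Y) : Prop :=
  ∀ (X' : ComplexSurface) (E' : X' → Y), IsModification E' →
    (∀ x ∈ E' ⁻¹' C, HasNormalCrossingAt (E' ⁻¹' C) x) → ∃ g : X' → X, IsModification g ∧ E ∘ g = E'

theorem factorsAll_id (C : Set Y) : FactorsAll (id : Y → Y) C :=
  fun _ E' h _ => ⟨E', h, rfl⟩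

/-- The factor through E is again a modification, so the hypothesis on F applies to it. This is why
`FactorsAll` asks for modifications and not merely for holomorphic maps. -/
theorem FactorsAll.comp {E : X → Y} {C : Set Y} (hE : FactorsAll E C) {F : X' → X}
    (hF : FactorsAll F (E ⁻¹' C)) : FactorsAll (E ∘ F) C := by
  intro X' E' h hnc
  obtain ⟨g, hg, rfl⟩ := hE X' E' h hnc
  obtain ⟨g', hg', rfl⟩ := hF X' g hg hnc
  exact ⟨g', hg', rfl⟩

theorem IsBlowup.factorsAll {F : X → Y} {q : Y} (hF : IsBlowup F q) {C : Set Y} (hq : q ∈ C)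
    (hnc : ¬ HasNormalCrossingAt C q) : FactorsAll F C :=
  fun _ _ h h' => h.exists_factor hF hq hnc h'

end ComplexSurface

/-! ### Strict transforms and coordinates outside the centre. -/

namespace ComplexSurface

variable {X Y Z X' : ComplexSurface}

/-- Continuous maps which are local homeomorphisms outside the fibre of `p`. -/
def IsIsoOutside (E : X → Y) (p : Y) : Prop :=
  Continuous E ∧ ∀ x, E x ≠ p → map E (𝓝 x) = 𝓝 (E x)

theorem isIsoOutside_id (p : Y) : IsIsoOutside (id : Y → Y) p :=
  ⟨continuous_id, fun _ _ => map_id⟩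

theorem IsBlowup.isIsoOutside {E : X → Y} {p : Y} (hE : IsBlowup E p) : IsIsoOutside E p :=
  ⟨hE.continuous, fun x hx => map_nhds_eq_of_isLocalDiffeomorphAt (hE.2.2.1 x hx)⟩

theorem IsIsoOutside.comp {E : X → Y} {p : Y} (hE : IsIsoOutside E p) {F : X' → X} {q : X}
    (hF : IsIsoOutside F q) (hq : E q = p) : IsIsoOutside (E ∘ F) p := by
  refine ⟨hE.1.comp hF.1, fun x hx => ?_⟩
  rw [← Filter.map_map, hF.2 x (fun h => hx (by simp [h, hq])), hE.2 _ hx]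
  rfl

theorem IsIsoOutside.mem_closure_iff {E : X → Y} {p : Y} (hE : IsIsoOutside E p) {S : Set Y} {x : X}
    (hx : E x ≠ p) : x ∈ closure (E ⁻¹' S) ↔ E x ∈ closure S := by
  rw [mem_closure_iff_frequently, mem_closure_iff_frequently, ← hE.2 x hx, frequently_map]
  rfl

theorem IsIsoOutside.mem_strictTransform_iff {E : X → Y} {p : Y} (hE : IsIsoOutside E p)
    {S : Set Y} (hS : IsClosed S) {x : X} (hx : E x ≠ p) : x ∈ strictTransform E p S ↔ E x ∈ S := by
  rw [strictTransform, hE.mem_closure_iff hx]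
  constructor
  · intro h
    exact hS.closure_subset_iff.2 sdiff_subset h
  · intro h
    exact subset_closure ⟨h, hx⟩

/-- Outside the fibre of `q` the map F is a local homeomorphism and so commutes with closures. Hence
strict transforms may be taken one blowing-up at a time. -/
theorem strictTransform_comp {E : X → Y} {p : Y} {F : X' → X} {q : X} (hF : IsIsoOutside F q)
    (hq : E q = p) (S : Set Y) :
    strictTransform F q (strictTransform E p S) = strictTransform (E ∘ F) p S := by
  apply Subset.antisymm
  · refine closure_minimal ?_ isClosed_closure
    rintro x ⟨h1, h2⟩
    exact (hF.mem_closure_iff h2).2 h1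
  · refine closure_mono ?_
    intro x hx
    exact ⟨subset_closure hx, fun h => hx.2 (by rw [← hq, ← h]; rfl)⟩

theorem strictTransform_subset {E : X → Y} (hE : Continuous E) (p : Y) {S : Set Y}
    (hS : IsClosed S) : strictTransform E p S ⊆ E ⁻¹' S :=
  closure_minimal (preimage_mono sdiff_subset) (hS.preimage hE)

/-- Coordinates which avoid the blown-up point, as coordinates of the blowing-up. -/
theorem IsBlowup.exists_lift_coords {F : X → Y} {q : Y} (hF : IsBlowup F q)
    {φ : OpenPartialHomeomorph Y (ℂ × ℂ)} (hφ : φ ∈ Y.coords) (hq : q ∉ φ.source) [Nonempty X] :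
    ∃ ψ ∈ X.coords, ψ.source = F ⁻¹' φ.source ∧ ψ.target = φ.target ∧ ∀ x, ψ x = φ (F x) := by
  obtain ⟨e, es, ef, h1, h2⟩ := exists_openPartialHomeomorph
    (isClosed_singleton.isOpen_compl.preimage hF.continuous) hF.injOn (fun x hx => hF.2.2.1 x hx)
  have et : e.target = {q}ᶜ := by
    rw [← e.image_source_eq_target, es, ef, image_preimage_eq_inter_range]
    refine inter_eq_left.2 fun y hy => ?_
    obtain ⟨x, hx, -⟩ := hF.2.1 y hy
    exact ⟨x, hx⟩
  refine ⟨e.trans φ, trans_mem_coords h1 h2 hφ, ?_, ?_, fun x => by simp [ef]⟩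
  · rw [OpenPartialHomeomorph.trans_source, es, ef]
    refine inter_eq_right.2 fun x hx => ?_
    rintro (h : F x = q)
    exact hq (h ▸ hx)
  · rw [OpenPartialHomeomorph.trans_target, et]
    refine inter_eq_left.2 fun z hz => ?_
    rintro (h : φ.symm z = q)
    exact hq (h ▸ φ.map_target hz)

/-! ### Toric configurations and the blowing-up of a corner. -/

/-- The monomial map with exponents `w`, `w'`. -/
def monomialMap (w w' : ℕ × ℕ) (z : ℂ × ℂ) : ℂ × ℂ :=
  (z.1 ^ w.1 * z.2 ^ w'.1, z.1 ^ w.2 * z.2 ^ w'.2)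

/-- In the standard charts of a blowing-up, the exceptional curve receives the sum of the two
exponents, and the remaining axis keeps its own. -/
theorem monomialMap_std₁ (w w' : ℕ × ℕ) (z : ℂ × ℂ) :
    monomialMap w w' (z.1, z.1 * z.2) = monomialMap (w + w') w' z := by
  simp only [monomialMap, Prod.fst_add, Prod.snd_add, mul_pow, pow_add]
  exact Prod.ext (by simp only; ring) (by simp only; ring)

theorem monomialMap_std₂ (w w' : ℕ × ℕ) (z : ℂ × ℂ) :
    monomialMap w w' (z.1 * z.2, z.2) = monomialMap w (w + w') z := by
  simp only [monomialMap, Prod.fst_add, Prod.snd_add, mul_pow, pow_add]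
  exact Prod.ext (by simp only; ring) (by simp only; ring)

variable {Ω : TopologicalSpace.Opens (ℂ × ℂ)}

/-- The coordinates of a point of an open subset of the plane. -/
def val (x : ofOpens Ω) : ℂ × ℂ := Subtype.val (p := fun z => z ∈ Ω) x

/-- The surface `X` over `Ω` is covered by charts `χ 0, …, χ m` in which the projection to `Ω` is
monomial; the curves `A 0, …, A (m + 1)` are the successive coordinate axes of these charts and
`w 0, …, w (m + 1)` are the exponents along these curves. -/
structure IsToric (E : X → ofOpens Ω) (m : ℕ) (w : ℕ → ℕ × ℕ) (A : ℕ → Set X)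
    (χ : ℕ → OpenPartialHomeomorph X (ℂ × ℂ)) : Prop where
  w_zero : w 0 = (1, 0)
  w_last : w (m + 1) = (0, 1)
  pos : ∀ j, 1 ≤ j → j ≤ m → 0 < (w j).1 ∧ 0 < (w j).2
  -- Determinant 1 survives the insertion of w i + w (i + 1). It is what makes the branches cross
  -- the central curve with exponent exactly 1.
  det : ∀ i ≤ m, (w i).1 * (w (i + 1)).2 = (w i).2 * (w (i + 1)).1 + 1
  mem : ∀ i ≤ m, χ i ∈ X.coords
  -- The charts are as large as Ω allows; in particular they contain the whole affine part of the
  -- exceptional axes.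
  target : ∀ i ≤ m, (χ i).target = {z | monomialMap (w i) (w (i + 1)) z ∈ Ω}
  map : ∀ i ≤ m, ∀ x ∈ (χ i).source, val (E x) = monomialMap (w i) (w (i + 1)) (χ i x)
  cover : ∀ x, ∃ i ≤ m, x ∈ (χ i).source
  curve : ∀ i ≤ m, ∀ j ≤ m + 1, ∀ x ∈ (χ i).source,
    (x ∈ A j ↔ (j = i ∧ (χ i x).1 = 0) ∨ (j = i + 1 ∧ (χ i x).2 = 0))

/-- The sequence obtained from `f` by inserting `v` after `f i`. -/
def insertAfter {T : Type*} (i : ℕ) (v : T) (f : ℕ → T) (j : ℕ) : T :=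
  if j ≤ i then f j else if j = i + 1 then v else f (j - 1)

section insertAfter
variable {T : Type*} {i : ℕ} {v : T} {f : ℕ → T} {j : ℕ}

theorem insertAfter_of_le (h : j ≤ i) : insertAfter i v f j = f j := by
  simp [insertAfter, h]

theorem insertAfter_self : insertAfter i v f (i + 1) = v := by
  simp [insertAfter]

theorem insertAfter_succ (h : i + 1 ≤ j) : insertAfter i v f (j + 1) = f j := by
  have h1 : ¬ j + 1 ≤ i := by omega
  have h2 : j ≠ i := by omega
  simp [insertAfter, h1, h2]

end insertAfter

namespace IsToric

variable {E : X → ofOpens Ω} {m : ℕ} {w : ℕ → ℕ × ℕ} {A : ℕ → Set X}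
  {χ : ℕ → OpenPartialHomeomorph X (ℂ × ℂ)} {i j : ℕ}

theorem fst_pos (h : IsToric E m w A χ) (hi : i ≤ m) : 0 < (w i).1 := by
  rcases Nat.eq_zero_or_pos i with rfl | h0
  · simp [h.w_zero]
  · exact (h.pos i h0 hi).1

theorem snd_pos (h : IsToric E m w A χ) (hi : i ≤ m) : 0 < (w (i + 1)).2 := by
  rcases Nat.lt_or_ge i m with h1 | h1
  · exact (h.pos (i + 1) (by omega) h1).2
  · obtain rfl : i = m := by omega
    simp [h.w_last]

theorem isClosed (h : IsToric E m w A χ) (hj : j ≤ m + 1) : IsClosed (A j) := by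
  refine isClosed_of_closure_subset fun x hx => ?_
  obtain ⟨i, hi, hxi⟩ := h.cover x
  rw [h.curve i hi j hj x hxi]
  refine mem_of_mem_closure_coords (Q := {z | (j = i ∧ z.1 = 0) ∨ (j = i + 1 ∧ z.2 = 0)}) hxi ?_
    (fun y hy hy' => (h.curve i hi j hj y hy).1 hy') hx
  have h1 : IsClosed {z : ℂ × ℂ | z.1 = 0} := isClosed_eq continuous_fst continuous_const
  have h2 : IsClosed {z : ℂ × ℂ | z.2 = 0} := isClosed_eq continuous_snd continuous_const
  exact (isClosed_const.inter h1).union (isClosed_const.inter h2)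

theorem zero_mem_target (h : IsToric E m w A χ) (h0 : (0 : ℂ × ℂ) ∈ Ω) (hi : i ≤ m) :
    0 ∈ (χ i).target := by
  rw [h.target i hi]
  have : monomialMap (w i) (w (i + 1)) 0 = 0 := by
    have h1 := h.fst_pos hi
    have h2 := h.snd_pos hi
    exact Prod.ext (by simp [monomialMap, h1.ne']) (by simp [monomialMap, h2.ne'])
  rwa [← this] at h0

/-- Two consecutive curves meet at the origin of a chart. -/
theorem inter_succ (h : IsToric E m w A χ) (h0 : (0 : ℂ × ℂ) ∈ Ω) (hi : i ≤ m) :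
    A i ∩ A (i + 1) = {(χ i).symm 0} := by
  have ht := h.zero_mem_target h0 hi
  ext x
  constructor
  · rintro ⟨h1, h2⟩
    obtain ⟨k, hk, hx⟩ := h.cover x
    rw [h.curve k hk _ (by omega) x hx] at h1 h2
    have h3 : i = k ∧ (χ k x).1 = 0 ∧ (χ k x).2 = 0 := by
      rcases h1 with h1 | h1 <;> rcases h2 with h2 | h2
      · omega
      · exact ⟨h1.1, h1.2, h2.2⟩
      · omega
      · omega
    obtain ⟨rfl, h4, h5⟩ := h3
    rw [mem_singleton_iff, ← (χ i).left_inv hx]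
    exact congrArg _ (Prod.ext h4 h5)
  · rintro rfl
    have hs := (χ i).map_target ht
    have hv := (χ i).right_inv ht
    constructor
    · rw [h.curve i hi _ (by omega) _ hs, hv]
      exact Or.inl ⟨rfl, rfl⟩
    · rw [h.curve i hi _ (by omega) _ hs, hv]
      exact Or.inr ⟨rfl, rfl⟩

/-- Two curves which are not consecutive are disjoint. -/
theorem inter_eq_empty (h : IsToric E m w A χ) (hij : i + 1 < j) (hj : j ≤ m + 1) :
    A i ∩ A j = ∅ := by
  rw [eq_empty_iff_forall_notMem]
  rintro x ⟨h1, h2⟩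
  obtain ⟨k, hk, hx⟩ := h.cover x
  rw [h.curve k hk _ (by omega) x hx] at h1 h2
  omega

theorem closure_axis₁ {z : ℂ × ℂ} (hz : z.1 = 0) : z ∈ closure {z : ℂ × ℂ | z.1 = 0 ∧ z.2 ≠ 0} := by
  have : {z : ℂ × ℂ | z.1 = 0 ∧ z.2 ≠ 0} = ({0} : Set ℂ) ×ˢ ({0}ᶜ : Set ℂ) := by ext; simp
  rw [this, closure_prod_eq]
  exact ⟨by simp [hz], (dense_compl_singleton (0 : ℂ)) z.2⟩

theorem closure_axis₂ {z : ℂ × ℂ} (hz : z.2 = 0) : z ∈ closure {z : ℂ × ℂ | z.1 ≠ 0 ∧ z.2 = 0} := by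
  have : {z : ℂ × ℂ | z.1 ≠ 0 ∧ z.2 = 0} = ({0}ᶜ : Set ℂ) ×ˢ ({0} : Set ℂ) := by ext; simp
  rw [this, closure_prod_eq]
  exact ⟨(dense_compl_singleton (0 : ℂ)) z.1, by simp [hz]⟩

/-- In a chart each curve is an axis, so it has no isolated point, and deleting one point does not
change its closure. -/
theorem strictTransform_id (h : IsToric E m w A χ) (q : X) (hj : j ≤ m + 1) :
    strictTransform id q (A j) = A j := by
  apply Subset.antisymm (strictTransform_subset continuous_id q (h.isClosed hj))
  intro x hx
  by_cases hxq : x = q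
  · subst hxq
    obtain ⟨k, hk, hxk⟩ := h.cover x
    rcases (h.curve k hk j hj x hxk).1 hx with ⟨rfl, h1⟩ | ⟨rfl, h1⟩
    · have h2 : χ j x ∈ closure {z : ℂ × ℂ | z.1 = 0 ∧ z ≠ χ j x} := by
        have : {z : ℂ × ℂ | z.1 = 0 ∧ z ≠ χ j x} = ({0} : Set ℂ) ×ˢ ({(χ j x).2}ᶜ : Set ℂ) := by
          ext z
          simp only [mem_ofPred_eq, mem_prod, mem_singleton_iff, mem_compl_iff, ne_eq, Prod.ext_iff]
          constructor
          · rintro ⟨h3, h4⟩; exact ⟨h3, fun h5 => h4 ⟨h3.trans h1.symm, h5⟩⟩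
          · rintro ⟨h3, h4⟩; exact ⟨h3, fun h5 => h4 h5.2⟩
        rw [this, closure_prod_eq]
        exact ⟨by simp [h1], (dense_compl_singleton _) _⟩
      refine mem_closure_of_coords hxk h2 ?_
      rintro y hy ⟨h3, h4⟩
      exact ⟨(h.curve j hk j hj y hy).2 (Or.inl ⟨rfl, h3⟩), fun h5 => h4 (congrArg _ h5)⟩
    · have h2 : χ k x ∈ closure {z : ℂ × ℂ | z.2 = 0 ∧ z ≠ χ k x} := by
        have : {z : ℂ × ℂ | z.2 = 0 ∧ z ≠ χ k x} = ({(χ k x).1}ᶜ : Set ℂ) ×ˢ ({0} : Set ℂ) := by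
          ext z
          simp only [mem_ofPred_eq, mem_prod, mem_singleton_iff, mem_compl_iff, ne_eq, Prod.ext_iff]
          constructor
          · rintro ⟨h3, h4⟩; exact ⟨fun h5 => h4 ⟨h5, h3.trans h1.symm⟩, h3⟩
          · rintro ⟨h3, h4⟩; exact ⟨h4, fun h5 => h3 h5.1⟩
        rw [this, closure_prod_eq]
        exact ⟨(dense_compl_singleton _) _, by simp [h1]⟩
      refine mem_closure_of_coords hxk h2 ?_
      rintro y hy ⟨h3, h4⟩
      exact ⟨(h.curve k hk (k + 1) hj y hy).2 (Or.inr ⟨rfl, h3⟩), fun h5 => h4 (congrArg _ h5)⟩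
  · exact subset_closure ⟨hx, hxq⟩

/-- Blowing up the intersection point of two consecutive curves. -/
theorem blowup (h : IsToric E m w A χ) (h0 : (0 : ℂ × ℂ) ∈ Ω) (hi : i ≤ m) {F : X' → X} {q : X}
    (hF : IsBlowup F q) (hq : A i ∩ A (i + 1) = {q}) :
    ∃ χ', IsToric (E ∘ F) (m + 1) (insertAfter i (w i + w (i + 1)) w)
      (insertAfter i (F ⁻¹' {q}) fun j => strictTransform F q (A j)) χ' := by
  have hq' : q = (χ i).symm 0 := by
    have := h.inter_succ h0 hi
    rw [hq] at this
    exact singleton_injective this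
  have ht := h.zero_mem_target h0 hi
  have hqs : q ∈ (χ i).source := hq' ▸ (χ i).map_target ht
  have hq0 : χ i q = 0 := by rw [hq', (χ i).right_inv ht]
  -- In the chart k only A k and A (k + 1) are visible, so no chart other than χ i contains a point
  -- of both A i and A (i + 1). The other charts therefore lift unchanged.
  have hqi : ∀ k ≤ m, k ≠ i → q ∉ (χ k).source := by
    intro k hk hki hqk
    have h1 : q ∈ A i ∩ A (i + 1) := hq ▸ rfl
    have h2 := (h.curve k hk i (by omega) q hqk).1 h1.1
    have h3 := (h.curve k hk (i + 1) (by omega) q hqk).1 h1.2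
    omega
  obtain ⟨ψ₁, m₁, ψ₂, m₂, hs, t₁, t₂, v₁, v₂⟩ := hF.hasBlowupCharts (h.mem i hi) hqs hq0
  have hne : Nonempty X' := by
    have h1 : (0 : ℂ × ℂ) ∈ ψ₁.target := by
      rw [t₁]
      simpa [← Prod.zero_eq_mk] using ht
    exact ⟨ψ₁.symm 0⟩
  have hl : ∀ k, ∃ ψ : OpenPartialHomeomorph X' (ℂ × ℂ), k ≤ m → k ≠ i → ψ ∈ X'.coords ∧
      ψ.source = F ⁻¹' (χ k).source ∧ ψ.target = (χ k).target ∧ ∀ x, ψ x = χ k (F x) := by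
    intro k
    by_cases hk : k ≤ m ∧ k ≠ i
    · obtain ⟨ψ, h1, h2⟩ := hF.exists_lift_coords (h.mem k hk.1) (hqi k hk.1 hk.2)
      exact ⟨ψ, fun _ _ => ⟨h1, h2⟩⟩
    · exact ⟨ψ₁, fun h1 h2 => absurd ⟨h1, h2⟩ hk⟩
  choose L hL using hl
  have hs₁ : ∀ x ∈ ψ₁.source, F x ∈ (χ i).source := fun x hx => by
    change x ∈ F ⁻¹' (χ i).source
    rw [hs]
    exact Or.inl hx
  have hs₂ : ∀ x ∈ ψ₂.source, F x ∈ (χ i).source := fun x hx => by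
    change x ∈ F ⁻¹' (χ i).source
    rw [hs]
    exact Or.inr hx
  have hFq : ∀ x, F x ∈ (χ i).source → (F x = q ↔ χ i (F x) = 0) := fun x hx =>
    ⟨fun h => h ▸ hq0, fun h => (χ i).injOn hx hqs (h.trans hq0.symm)⟩
  -- Of the old curves, only A (i + 1) is visible in ψ₁, as t = 0, and only A i in ψ₂, as s = 0; the
  -- other axis of each chart is exceptional.
  have c₁ : ∀ j ≤ m + 1, ∀ x ∈ ψ₁.source,
      (x ∈ strictTransform F q (A j) ↔ j = i + 1 ∧ (ψ₁ x).2 = 0) := by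
    intro j hj x hx
    constructor
    · refine mem_of_mem_closure_coords (Q := {z : ℂ × ℂ | j = i + 1 ∧ z.2 = 0}) hx ?_ ?_
      · exact isClosed_const.inter (isClosed_eq continuous_snd continuous_const)
      · rintro y hy ⟨h1, h2⟩
        have h3 := (h.curve i hi j hj _ (hs₁ y hy)).1 h1
        have h4 := mt (hFq y (hs₁ y hy)).2 h2
        rw [v₁ y hy] at h3 h4
        have h5 : (ψ₁ y).1 ≠ 0 := fun h5 => h4 (by simp [h5])
        rcases h3 with h3 | h3
        · exact absurd h3.2 h5
        · exact ⟨h3.1, (mul_eq_zero.1 h3.2).resolve_left h5⟩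
    · rintro ⟨rfl, h1⟩
      refine mem_closure_of_coords hx (closure_axis₂ h1) ?_
      rintro y hy ⟨h2, h3⟩
      refine ⟨(h.curve i hi _ hj _ (hs₁ y hy)).2 (Or.inr ⟨rfl, ?_⟩), fun h4 => h2 ?_⟩
      · rw [v₁ y hy]; simp [h3]
      · have := (hFq y (hs₁ y hy)).1 h4
        rw [v₁ y hy] at this
        exact congrArg Prod.fst this
  have c₂ : ∀ j ≤ m + 1, ∀ x ∈ ψ₂.source,
      (x ∈ strictTransform F q (A j) ↔ j = i ∧ (ψ₂ x).1 = 0) := by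
    intro j hj x hx
    constructor
    · refine mem_of_mem_closure_coords (Q := {z : ℂ × ℂ | j = i ∧ z.1 = 0}) hx ?_ ?_
      · exact isClosed_const.inter (isClosed_eq continuous_fst continuous_const)
      · rintro y hy ⟨h1, h2⟩
        have h3 := (h.curve i hi j hj _ (hs₂ y hy)).1 h1
        have h4 := mt (hFq y (hs₂ y hy)).2 h2
        rw [v₂ y hy] at h3 h4
        have h5 : (ψ₂ y).2 ≠ 0 := fun h5 => h4 (by simp [h5])
        rcases h3 with h3 | h3
        · exact ⟨h3.1, (mul_eq_zero.1 h3.2).resolve_right h5⟩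
        · exact absurd h3.2 h5
    · rintro ⟨rfl, h1⟩
      refine mem_closure_of_coords hx (closure_axis₁ h1) ?_
      rintro y hy ⟨h2, h3⟩
      refine ⟨(h.curve j hi _ hj _ (hs₂ y hy)).2 (Or.inl ⟨rfl, ?_⟩), fun h4 => h3 ?_⟩
      · rw [v₂ y hy]; simp [h2]
      · have := (hFq y (hs₂ y hy)).1 h4
        rw [v₂ y hy] at this
        exact congrArg Prod.snd this
  have e₁ : ∀ x ∈ ψ₁.source, (F x = q ↔ (ψ₁ x).1 = 0) := by
    intro x hx
    rw [hFq x (hs₁ x hx), v₁ x hx]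
    exact ⟨fun h => congrArg Prod.fst h, fun h => by simp [h]⟩
  have e₂ : ∀ x ∈ ψ₂.source, (F x = q ↔ (ψ₂ x).2 = 0) := by
    intro x hx
    rw [hFq x (hs₂ x hx), v₂ x hx]
    exact ⟨fun h => congrArg Prod.snd h, fun h => by simp [h]⟩
  have cl : ∀ k ≤ m, k ≠ i → ∀ j ≤ m + 1, ∀ x, F x ∈ (χ k).source →
      (x ∈ strictTransform F q (A j) ↔
        (j = k ∧ (χ k (F x)).1 = 0) ∨ (j = k + 1 ∧ (χ k (F x)).2 = 0)) := by
    intro k hk hki j hj x hx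
    rw [hF.isIsoOutside.mem_strictTransform_iff (h.isClosed hj)
      (fun h => hqi k hk hki (h ▸ hx)), h.curve k hk j hj _ hx]
  have charts : ∀ k ≤ m + 1, (k < i ∧ k ≤ m ∧ k ≠ i) ∨ k = i ∨ k = i + 1 ∨
      ∃ l, k = l + 1 ∧ i < l ∧ l ≤ m ∧ l ≠ i := by
    intro k hk
    rcases lt_trichotomy k (i + 1) with h1 | h1 | h1
    · rcases Nat.lt_or_ge k i with h2 | h2
      · exact Or.inl ⟨h2, by omega, by omega⟩
      · exact Or.inr (Or.inl (by omega))
    · exact Or.inr (Or.inr (Or.inl h1))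
    · exact Or.inr (Or.inr (Or.inr ⟨k - 1, by omega, by omega, by omega, by omega⟩))
  -- ψ₂ comes before ψ₁: its axes are A i and the exceptional curve, those of ψ₁ are the exceptional
  -- curve and A (i + 1).
  set χ' : ℕ → OpenPartialHomeomorph X' (ℂ × ℂ) := fun k =>
    if k < i then L k else if k = i then ψ₂ else if k = i + 1 then ψ₁ else L (k - 1) with hχ'
  have x₁ : ∀ k, k < i → χ' k = L k := fun k hk => by simp [hχ', hk]
  have x₂ : χ' i = ψ₂ := by simp [hχ']
  have x₃ : χ' (i + 1) = ψ₁ := by simp [hχ']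
  have x₄ : ∀ k, i < k → χ' (k + 1) = L k := fun k hk => by
    have h1 : ¬ k + 1 < i := by omega
    have h2 : ¬ k + 1 = i := by omega
    have h3 : ¬ k = i := by omega
    simp [hχ', h1, h2, h3]
  refine ⟨χ', ?_, ?_, ?_, ?_, ?_, ?_, ?_, ?_, ?_⟩
  · rw [insertAfter_of_le (Nat.zero_le _), h.w_zero]
  · rw [insertAfter_succ (by omega), h.w_last]
  · intro j hj hjm
    rcases lt_trichotomy j (i + 1) with h1 | rfl | h1
    · rw [insertAfter_of_le (by omega)]
      exact h.pos j hj (by omega)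
    · rw [insertAfter_self]
      have h2 := h.fst_pos hi
      have h3 := h.snd_pos hi
      exact ⟨by simp; omega, by simp; omega⟩
    · obtain ⟨j, rfl⟩ : ∃ l, j = l + 1 := ⟨j - 1, by omega⟩
      rw [insertAfter_succ (by omega)]
      exact h.pos j (by omega) (by omega)
  · intro k hk
    rcases charts k hk with ⟨h1, h2, h3⟩ | rfl | rfl | ⟨l, rfl, h1, h2, h3⟩
    · rw [insertAfter_of_le (by omega), insertAfter_of_le (by omega)]
      exact h.det k h2
    · rw [insertAfter_of_le le_rfl, insertAfter_self]
      have := h.det k hi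
      simp only [Prod.fst_add, Prod.snd_add]
      nlinarith
    · rw [insertAfter_self, insertAfter_succ le_rfl]
      have := h.det i hi
      simp only [Prod.fst_add, Prod.snd_add]
      nlinarith
    · rw [insertAfter_succ (by omega), insertAfter_succ (by omega)]
      exact h.det l h2
  · intro k hk
    rcases charts k hk with ⟨h1, h2, h3⟩ | rfl | rfl | ⟨l, rfl, h1, h2, h3⟩
    · rw [x₁ k h1]; exact (hL k h2 h3).1
    · rw [x₂]; exact m₂
    · rw [x₃]; exact m₁
    · rw [x₄ l h1]; exact (hL l h2 h3).1
  · intro k hk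
    rcases charts k hk with ⟨h1, h2, h3⟩ | rfl | rfl | ⟨l, rfl, h1, h2, h3⟩
    · rw [x₁ k h1, insertAfter_of_le (by omega), insertAfter_of_le (by omega), ← h.target k h2]
      exact (hL k h2 h3).2.2.1
    · rw [x₂, t₂, insertAfter_of_le le_rfl, insertAfter_self, h.target k hi]
      ext z
      simp only [mem_ofPred_eq, monomialMap_std₂]
    · rw [x₃, t₁, insertAfter_self, insertAfter_succ le_rfl, h.target i hi]
      ext z
      simp only [mem_ofPred_eq, monomialMap_std₁]
    · rw [x₄ l h1, insertAfter_succ (by omega), insertAfter_succ (by omega), ← h.target l h2]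
      exact (hL l h2 h3).2.2.1
  · intro k hk x hx
    rcases charts k hk with ⟨h1, h2, h3⟩ | rfl | rfl | ⟨l, rfl, h1, h2, h3⟩
    · rw [x₁ k h1] at hx ⊢
      rw [insertAfter_of_le (by omega), insertAfter_of_le (by omega), (hL k h2 h3).2.2.2]
      rw [(hL k h2 h3).2.1] at hx
      exact h.map k h2 _ hx
    · rw [x₂] at hx ⊢
      rw [insertAfter_of_le le_rfl, insertAfter_self, ← monomialMap_std₂, ← v₂ x hx]
      exact h.map k hi _ (hs₂ x hx)
    · rw [x₃] at hx ⊢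
      rw [insertAfter_self, insertAfter_succ le_rfl, ← monomialMap_std₁, ← v₁ x hx]
      exact h.map i hi _ (hs₁ x hx)
    · rw [x₄ l h1] at hx ⊢
      rw [insertAfter_succ (by omega), insertAfter_succ (by omega), (hL l h2 h3).2.2.2]
      rw [(hL l h2 h3).2.1] at hx
      exact h.map l h2 _ hx
  · intro x
    obtain ⟨k, hk, hx⟩ := h.cover (F x)
    rcases lt_trichotomy k i with h1 | rfl | h1
    · refine ⟨k, by omega, ?_⟩
      rw [x₁ k h1, (hL k hk h1.ne).2.1]
      exact hx
    · rcases (hs ▸ hx : x ∈ ψ₁.source ∪ ψ₂.source) with hx | hx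
      · exact ⟨k + 1, by omega, x₃ ▸ hx⟩
      · exact ⟨k, by omega, x₂ ▸ hx⟩
    · refine ⟨k + 1, by omega, ?_⟩
      rw [x₄ k h1, (hL k hk h1.ne').2.1]
      exact hx
  · intro k hk j hj x hx
    have hj' : j ≤ i ∨ j = i + 1 ∨ ∃ l, j = l + 1 ∧ i + 1 ≤ l ∧ l ≤ m + 1 := by
      rcases lt_trichotomy j (i + 1) with h1 | h1 | h1
      · exact Or.inl (by omega)
      · exact Or.inr (Or.inl h1)
      · exact Or.inr (Or.inr ⟨j - 1, by omega, by omega, by omega⟩)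
    rcases charts k hk with ⟨h1, h2, h3⟩ | rfl | rfl | ⟨l, rfl, h1, h2, h3⟩
    · rw [x₁ k h1] at hx ⊢
      have hx' : x ∈ F ⁻¹' (χ k).source := by rwa [(hL k h2 h3).2.1] at hx
      rw [(hL k h2 h3).2.2.2]
      rcases hj' with hj' | rfl | ⟨l, rfl, h4, h5⟩
      · rw [insertAfter_of_le hj']
        exact cl k h2 h3 j (by omega) x hx'
      · rw [insertAfter_self]
        refine iff_of_false (fun (h4 : F x = q) => hqi k h2 h3 (h4 ▸ hx')) (by omega)
      · rw [insertAfter_succ h4, cl k h2 h3 l h5 x hx']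
        grind
    · rw [x₂] at hx ⊢
      rcases hj' with hj' | rfl | ⟨l, rfl, h4, h5⟩
      · rw [insertAfter_of_le hj', c₂ j (by omega) x hx]
        grind
      · rw [insertAfter_self]
        refine (e₂ x hx).trans ?_
        grind
      · rw [insertAfter_succ h4, c₂ l h5 x hx]
        grind
    · rw [x₃] at hx ⊢
      rcases hj' with hj' | rfl | ⟨l, rfl, h4, h5⟩
      · rw [insertAfter_of_le hj', c₁ j (by omega) x hx]
        grind
      · rw [insertAfter_self]
        refine (e₁ x hx).trans ?_
        grind
      · rw [insertAfter_succ h4, c₁ l h5 x hx]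
        grind
    · rw [x₄ l h1] at hx ⊢
      have hx' : x ∈ F ⁻¹' (χ l).source := by rwa [(hL l h2 h3).2.1] at hx
      rw [(hL l h2 h3).2.2.2]
      rcases hj' with hj' | rfl | ⟨j, rfl, h4, h5⟩
      · rw [insertAfter_of_le hj', cl l h2 h3 j (by omega) x hx']
        grind
      · rw [insertAfter_self]
        refine iff_of_false (fun (h4 : F x = q) => hqi l h2 h3 (h4 ▸ hx')) (by omega)
      · rw [insertAfter_succ h4, cl l h2 h3 j h5 x hx']
        grind

end IsToric

end ComplexSurface

/-! ### Curves that are smooth or have normal crossings. -/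

namespace ComplexSurface

variable {X Y Z X' : ComplexSurface}

/-- Local coordinates whose first coordinate is a given function of old coordinates. -/
theorem exists_coords_fst {χ : OpenPartialHomeomorph X (ℂ × ℂ)} (hχ : χ ∈ X.coords) {x : X}
    (hx : x ∈ χ.source) {g : ℂ × ℂ → ℂ} (hg : ContDiffAt ℂ ω g (χ x)) (hg0 : g (χ x) = 0)
    (hd : fderiv ℂ g (χ x) (1, 0) ≠ 0) {P : X → Prop} (hP : ∀ᶠ y in 𝓝 x, P y) :
    ∃ φ ∈ X.coords, x ∈ φ.source ∧ φ x = 0 ∧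
      ∀ y ∈ φ.source, φ y = (g (χ y), (χ y).2 - (χ x).2) ∧ P y := by
  set G : ℂ × ℂ → ℂ × ℂ := fun z => (g z, z.2 - (χ x).2) with hGdef
  have hG : ContDiffAt ℂ ω G (χ x) := hg.prodMk (contDiffAt_snd.sub contDiffAt_const)
  set a := fderiv ℂ g (χ x) (1, 0) with ha
  set b := fderiv ℂ g (χ x) (0, 1) with hb
  -- The derivative of (g, t - t₀) is triangular with diagonal (a, 1), where a ≠ 0, so its inverse
  -- is explicit and the inverse function theorem applies.
  let G' : (ℂ × ℂ) ≃L[ℂ] (ℂ × ℂ) := ContinuousLinearEquiv.equivOfInverse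
    ((fderiv ℂ g (χ x)).prod (ContinuousLinearMap.snd ℂ ℂ ℂ))
    ((a⁻¹ • (ContinuousLinearMap.fst ℂ ℂ ℂ - b • ContinuousLinearMap.snd ℂ ℂ ℂ)).prod
      (ContinuousLinearMap.snd ℂ ℂ ℂ))
    (by
      intro z
      have h1 : fderiv ℂ g (χ x) z = z.1 * a + z.2 * b := by
        have : z = z.1 • ((1, 0) : ℂ × ℂ) + z.2 • ((0, 1) : ℂ × ℂ) := by ext <;> simp
        conv_lhs => rw [this, map_add, map_smul, map_smul]
        simp [ha, hb]
      refine Prod.ext ?_ ?_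
      · simp [h1]; field_simp; ring
      · simp)
    (by
      intro z
      have h1 : ∀ z : ℂ × ℂ, fderiv ℂ g (χ x) z = z.1 * a + z.2 * b := by
        intro z
        have : z = z.1 • ((1, 0) : ℂ × ℂ) + z.2 • ((0, 1) : ℂ × ℂ) := by ext <;> simp
        conv_lhs => rw [this, map_add, map_smul, map_smul]
        simp [ha, hb]
      refine Prod.ext ?_ ?_
      · simp [h1]; field_simp; ring
      · simp)
  have hG' : HasFDerivAt G (G' : (ℂ × ℂ) →L[ℂ] (ℂ × ℂ)) (χ x) := by
    have h1 := (hg.differentiableAt (by simp)).hasFDerivAt.prodMk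
      ((hasFDerivAt_snd (𝕜 := ℂ) (E := ℂ) (F := ℂ) (p := χ x)).sub_const (χ x).2)
    exact h1
  have hn : (ω : WithTop ℕ∞) ≠ 0 := by simp
  let e₀ := hG.toOpenPartialHomeomorph G hG' hn
  have e₀s : χ x ∈ e₀.source := hG.mem_toOpenPartialHomeomorph_source hG' hn
  have h1 : ∀ᶠ z in 𝓝 (χ x), ContDiffAt ℂ ω G z := hG.eventually (by simp)
  have h2 : ∀ᶠ z in 𝓝 (G (χ x)), ContDiffAt ℂ ω e₀.symm z :=
    (hG.to_localInverse hG' hn).eventually (by simp)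
  have h3 : ∀ᶠ z in 𝓝 (χ x), ContDiffAt ℂ ω e₀.symm (e₀ z) :=
    hG.continuousAt.eventually h2
  obtain ⟨U, hU, hUo, hxU⟩ := eventually_nhds_iff.1 (h1.and h3)
  obtain ⟨V, hV, hVo, hxV⟩ := eventually_nhds_iff.1 hP
  let e := e₀.restrOpen U hUo
  have hes : e.source = e₀.source ∩ U := rfl
  have he : ContDiffOn ℂ ω e e.source := fun z hz => (hU z hz.2).1.contDiffWithinAt
  have he' : ContDiffOn ℂ ω e.symm e.target := by
    intro z hz
    have h4 := e.map_target hz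
    have h5 := (hU _ h4.2).2
    have h6 : e₀ (e.symm z) = z := e.right_inv hz
    rw [h6] at h5
    exact h5.contDiffWithinAt
  refine ⟨(χ.trans e).restr V, restr_mem_coords (coords_trans hχ he he') hVo,
    ⟨⟨hx, ⟨e₀s, hxU⟩⟩, hVo.interior_eq.symm ▸ hxV⟩, ?_, ?_⟩
  · change G (χ x) = 0
    simp [hGdef, hg0]
  · intro y hy
    exact ⟨rfl, hV y (hVo.interior_eq ▸ hy.2)⟩

/-- Near every point, a curve given in suitable coordinates by `s = 0`, `t = 0` and finitely many
equations `s ^ p * t ^ q = c` is smooth or has a normal crossing. -/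
theorem smooth_or_normalCrossing {Z : Set X} {χ : OpenPartialHomeomorph X (ℂ × ℂ)}
    (hχ : χ ∈ X.coords) {x : X} (hx : x ∈ χ.source) (hxZ : x ∈ Z) {e e' : Prop} {p q : ℕ}
    (hpq : (1 ≤ p ∧ 1 ≤ q) ∨ (p = 0 ∧ q = 1) ∨ (p = 1 ∧ q = 0)) {K : Finset ℂ} (hK : 0 ∉ K)
    (hZ : ∀ y ∈ χ.source, y ∈ Z ↔ (e ∧ (χ y).1 = 0) ∨ (e' ∧ (χ y).2 = 0) ∨
      ∃ c ∈ K, (χ y).1 ^ p * (χ y).2 ^ q = c) :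
    IsSmoothCurveAt Z x ∨
      (HasNormalCrossingAt Z x ∧ ((e ∧ e') ∨ (p = 0 ∧ e) ∨ (q = 0 ∧ e'))) := by
  classical
  have cχ : ContinuousAt χ x := χ.continuousAt hx
  have c1 : ContinuousAt (fun y => (χ y).1) x := continuousAt_fst.comp cχ
  have c2 : ContinuousAt (fun y => (χ y).2) x := continuousAt_snd.comp cχ
  have c3 : ContinuousAt (fun y => (χ y).1 ^ p * (χ y).2 ^ q) x := (c1.pow p).mul (c2.pow q)
  have hsrc : ∀ᶠ y in 𝓝 x, y ∈ χ.source := χ.open_source.mem_nhds hx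
  -- `ev1`, `ev2` and `ev3` say that close to `x` only those components matter that pass through
  -- `x`.
  have ev1 : ∀ᶠ y in 𝓝 x, (χ y).1 = 0 → (χ x).1 = 0 := by
    by_cases h : (χ x).1 = 0
    · simp [h]
    · filter_upwards [c1.eventually_ne h] with y hy h'
      exact absurd h' hy
  have ev2 : ∀ᶠ y in 𝓝 x, (χ y).2 = 0 → (χ x).2 = 0 := by
    by_cases h : (χ x).2 = 0
    · simp [h]
    · filter_upwards [c2.eventually_ne h] with y hy h'
      exact absurd h' hy
  have ev3 : ∀ᶠ y in 𝓝 x, ∀ c ∈ K, (χ y).1 ^ p * (χ y).2 ^ q = c →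
      (χ x).1 ^ p * (χ x).2 ^ q = c := by
    rw [Filter.eventually_all_finset]
    intro c _
    by_cases h : (χ x).1 ^ p * (χ x).2 ^ q = c
    · simp [h]
    · filter_upwards [c3.eventually_ne h] with y hy h'
      exact absurd h' hy
  have hs : fderiv ℂ (fun z : ℂ × ℂ => z.1 - (χ x).1) (χ x) (1, 0) ≠ 0 := by
    rw [fderiv_sub_const, fderiv_fst]; simp
  have hsc : ContDiffAt ℂ ω (fun z : ℂ × ℂ => z.1 - (χ x).1) (χ x) :=
    contDiffAt_fst.sub contDiffAt_const
  have hχ' := coords_swap hχ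
  set χ' := χ.trans (Homeomorph.prodComm ℂ ℂ).toOpenPartialHomeomorph with hχ'def
  have hx' : x ∈ χ'.source := by simpa [hχ'def] using hx
  have hχ'v : ∀ y, χ' y = ((χ y).2, (χ y).1) := fun y => rfl
  have ht : fderiv ℂ (fun z : ℂ × ℂ => z.1 - (χ x).2) (χ' x) (1, 0) ≠ 0 := by
    rw [fderiv_sub_const, fderiv_fst]; simp
  have htc : ContDiffAt ℂ ω (fun z : ℂ × ℂ => z.1 - (χ x).2) (χ' x) :=
    contDiffAt_fst.sub contDiffAt_const
  by_cases hc : ∃ c ∈ K, (χ x).1 ^ p * (χ x).2 ^ q = c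
  · obtain ⟨c, hcK, hc⟩ := hc
    have hc0 : c ≠ 0 := fun h => hK (h ▸ hcK)
    -- A branch passes through `x`. If p, q ≥ 1, then `x` is off the axes and s^p t^q - c has
    -- nonzero derivative in s. Otherwise the branch is a line parallel to one axis, and it can meet
    -- only the other axis.
    rcases hpq with ⟨hp, hq⟩ | ⟨rfl, rfl⟩ | ⟨rfl, rfl⟩
    · have hx1 : (χ x).1 ≠ 0 := fun h => hc0 (by rw [← hc, h, zero_pow (by omega), zero_mul])
      have hx2 : (χ x).2 ≠ 0 := fun h => hc0 (by rw [← hc, h, zero_pow (by omega), mul_zero])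
      left
      have hd : fderiv ℂ (fun z : ℂ × ℂ => z.1 ^ p * z.2 ^ q - c) (χ x) (1, 0) ≠ 0 := by
        have h1 := ((hasFDerivAt_fst (𝕜 := ℂ) (E := ℂ) (F := ℂ) (p := χ x)).pow p).mul
          ((hasFDerivAt_snd (𝕜 := ℂ) (E := ℂ) (F := ℂ) (p := χ x)).pow q)
        have h2 := (h1.sub_const c).fderiv
        have h3 : fderiv ℂ (fun z : ℂ × ℂ => z.1 ^ p * z.2 ^ q - c) (χ x) (1, 0) =
            (χ x).2 ^ q * (p * (χ x).1 ^ (p - 1)) := by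
          refine (congrArg (fun L : (ℂ × ℂ) →L[ℂ] ℂ => L (1, 0)) h2).trans ?_
          simp
        rw [h3]
        have : (p : ℂ) ≠ 0 := by exact_mod_cast (by omega : p ≠ 0)
        positivity
      obtain ⟨φ, h1, h2, h3, h4⟩ := exists_coords_fst hχ hx
        (g := fun z => z.1 ^ p * z.2 ^ q - c)
        (((contDiffAt_fst.pow p).mul (contDiffAt_snd.pow q)).sub contDiffAt_const)
        (by simp [hc]) hd (((hsrc.and ev1).and ev2).and ev3)
      refine ⟨φ, h1, h2, h3, fun y hy => ?_⟩
      obtain ⟨h5, ⟨⟨h6, h7⟩, h8⟩, h9⟩ := h4 y hy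
      rw [hZ y h6, h5]
      simp only [sub_eq_zero]
      constructor
      · rintro (⟨-, h⟩ | ⟨-, h⟩ | ⟨c', hc', h⟩)
        · exact absurd (h7 h) hx1
        · exact absurd (h8 h) hx2
        · rw [h, ← h9 c' hc' h, hc]
      · exact fun h => Or.inr (Or.inr ⟨c, hcK, h⟩)
    · simp only [pow_zero, one_mul, pow_one] at hc ev3 hZ
      have hx2 : (χ x).2 ≠ 0 := fun h => hc0 (by rw [← hc, h])
      by_cases hs0 : e ∧ (χ x).1 = 0
      · right
        refine ⟨Or.inr ?_, Or.inr (Or.inl ⟨rfl, hs0.1⟩)⟩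
        obtain ⟨φ, h1, h2, h3, h4⟩ := exists_coords_fst hχ hx hsc (by simp) hs
          (((hsrc.and ev1).and ev2).and ev3)
        refine ⟨φ, h1, h2, h3, fun y hy => ?_⟩
        obtain ⟨h5, ⟨⟨h6, h7⟩, h8⟩, h9⟩ := h4 y hy
        rw [hZ y h6, h5]
        simp only [mul_eq_zero, sub_eq_zero, hs0.2, hc]
        constructor
        · rintro (⟨-, h⟩ | ⟨-, h⟩ | ⟨c', hc', h⟩)
          · exact Or.inl h
          · exact absurd (h8 h) hx2
          · right; rw [h, ← h9 c' hc' h, hc]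
        · rintro (h | h)
          · exact Or.inl ⟨hs0.1, h⟩
          · exact Or.inr (Or.inr ⟨c, hcK, h⟩)
      · left
        obtain ⟨φ, h1, h2, h3, h4⟩ := exists_coords_fst hχ' hx' htc (by simp [hχ'v]) ht
          (((hsrc.and ev1).and ev2).and ev3)
        refine ⟨φ, h1, h2, h3, fun y hy => ?_⟩
        obtain ⟨h5, ⟨⟨h6, h7⟩, h8⟩, h9⟩ := h4 y hy
        rw [hZ y h6, h5]
        simp only [sub_eq_zero, hχ'v, hc]
        constructor
        · rintro (⟨h', h⟩ | ⟨-, h⟩ | ⟨c', hc', h⟩)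
          · exact absurd ⟨h', h7 h⟩ hs0
          · exact absurd (h8 h) hx2
          · rw [h, ← h9 c' hc' h, hc]
        · exact fun h => Or.inr (Or.inr ⟨c, hcK, h⟩)
    · simp only [pow_zero, mul_one, pow_one] at hc ev3 hZ
      have hx1 : (χ x).1 ≠ 0 := fun h => hc0 (by rw [← hc, h])
      by_cases hs0 : e' ∧ (χ x).2 = 0
      · right
        refine ⟨Or.inr ?_, Or.inr (Or.inr ⟨rfl, hs0.1⟩)⟩
        obtain ⟨φ, h1, h2, h3, h4⟩ := exists_coords_fst hχ hx hsc (by simp) hs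
          (((hsrc.and ev1).and ev2).and ev3)
        refine ⟨φ, h1, h2, h3, fun y hy => ?_⟩
        obtain ⟨h5, ⟨⟨h6, h7⟩, h8⟩, h9⟩ := h4 y hy
        rw [hZ y h6, h5]
        simp only [mul_eq_zero, sub_eq_zero, hs0.2, hc]
        constructor
        · rintro (⟨-, h⟩ | ⟨-, h⟩ | ⟨c', hc', h⟩)
          · exact absurd (h7 h) hx1
          · exact Or.inr h
          · left; rw [h, ← h9 c' hc' h, hc]
        · rintro (h | h)
          · exact Or.inr (Or.inr ⟨c, hcK, h⟩)
          · exact Or.inr (Or.inl ⟨hs0.1, h⟩)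
      · left
        obtain ⟨φ, h1, h2, h3, h4⟩ := exists_coords_fst hχ hx hsc (by simp) hs
          (((hsrc.and ev1).and ev2).and ev3)
        refine ⟨φ, h1, h2, h3, fun y hy => ?_⟩
        obtain ⟨h5, ⟨⟨h6, h7⟩, h8⟩, h9⟩ := h4 y hy
        rw [hZ y h6, h5]
        simp only [sub_eq_zero, hc]
        constructor
        · rintro (⟨h', h⟩ | ⟨h', h⟩ | ⟨c', hc', h⟩)
          · exact absurd (h7 h) hx1
          · exact absurd ⟨h', h8 h⟩ hs0
          · rw [h, ← h9 c' hc' h, hc]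
        · exact fun h => Or.inr (Or.inr ⟨c, hcK, h⟩)
  · by_cases h1 : e ∧ (χ x).1 = 0
    · by_cases h2 : e' ∧ (χ x).2 = 0
      · right
        refine ⟨Or.inr ?_, Or.inl ⟨h1.1, h2.1⟩⟩
        obtain ⟨φ, m1, m2, m3, m4⟩ := exists_coords_fst hχ hx hsc (by simp) hs (hsrc.and ev3)
        refine ⟨φ, m1, m2, m3, fun y hy => ?_⟩
        obtain ⟨h5, h6, h9⟩ := m4 y hy
        rw [hZ y h6, h5]
        simp only [h1.2, h2.2, sub_zero, mul_eq_zero]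
        constructor
        · rintro (⟨-, h⟩ | ⟨-, h⟩ | ⟨c', hc', h⟩)
          · exact Or.inl h
          · exact Or.inr h
          · exact absurd ⟨c', hc', h9 c' hc' h⟩ hc
        · rintro (h | h)
          · exact Or.inl ⟨h1.1, h⟩
          · exact Or.inr (Or.inl ⟨h2.1, h⟩)
      · left
        obtain ⟨φ, m1, m2, m3, m4⟩ := exists_coords_fst hχ hx hsc (by simp) hs
          ((hsrc.and ev2).and ev3)
        refine ⟨φ, m1, m2, m3, fun y hy => ?_⟩
        obtain ⟨h5, ⟨h6, h8⟩, h9⟩ := m4 y hy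
        rw [hZ y h6, h5]
        simp only [h1.2, sub_zero]
        constructor
        · rintro (⟨-, h⟩ | ⟨h', h⟩ | ⟨c', hc', h⟩)
          · exact h
          · exact absurd ⟨h', h8 h⟩ h2
          · exact absurd ⟨c', hc', h9 c' hc' h⟩ hc
        · exact fun h => Or.inl ⟨h1.1, h⟩
    · have h2 : e' ∧ (χ x).2 = 0 := by
        rcases (hZ x hx).1 hxZ with h | h | h
        · exact absurd h h1
        · exact h
        · exact absurd h hc
      left
      obtain ⟨φ, m1, m2, m3, m4⟩ := exists_coords_fst hχ' hx' htc (by simp [hχ'v]) ht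
        ((hsrc.and ev1).and ev3)
      refine ⟨φ, m1, m2, m3, fun y hy => ?_⟩
      obtain ⟨h5, ⟨h6, h7⟩, h9⟩ := m4 y hy
      rw [hZ y h6, h5]
      simp only [hχ'v, h2.2, sub_zero]
      constructor
      · rintro (⟨h', h⟩ | ⟨h', h⟩ | ⟨c', hc', h⟩)
        · exact absurd ⟨h', h7 h⟩ h1
        · exact h
        · exact absurd ⟨c', hc', h9 c' hc' h⟩ hc
      · exact fun h => Or.inr (Or.inl ⟨h2.1, h⟩)

end ComplexSurface

/-! ### Singularities that are not normal crossings. -/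

namespace ComplexSurface

variable {X : ComplexSurface}

theorem analyticAt_transition {φ χ : OpenPartialHomeomorph X (ℂ × ℂ)} (hφ : φ ∈ X.coords)
    (hχ : χ ∈ X.coords) {x : X} (hx : x ∈ φ.source) (hx' : x ∈ χ.source) :
    AnalyticAt ℂ (φ ∘ χ.symm) (χ x) := by
  have h1 := contMDiffAt_coords_symm hχ (χ.map_source hx')
  have h2 := contMDiffAt_coords hφ hx
  rw [← χ.left_inv hx'] at h2
  have h3 := ContMDiffAt.comp (χ x) h2 h1
  rw [contMDiffAt_iff_contDiffAt] at h3
  exact h3.analyticAt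

/-- A curve with a normal crossing is contained in the union of two smooth branches with distinct
tangents. -/
theorem HasNormalCrossingAt.exists_branches {Z : Set X} {p : X} (h : HasNormalCrossingAt Z p)
    {χ : OpenPartialHomeomorph X (ℂ × ℂ)} (hχ : χ ∈ X.coords) (hp : p ∈ χ.source) (h0 : χ p = 0) :
    ∃ δ : Bool → ℂ → ℂ × ℂ, (∀ b, ∃ d, HasDerivAt (δ b) d 0 ∧ d ≠ 0) ∧
      (∀ b, AnalyticAt ℂ (δ b) 0 ∧ δ b 0 = 0) ∧
      -- The only consequence of the independence of the two tangents that is needed below: they are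
      -- not both horizontal.
      ¬ ((deriv (δ true) 0).2 = 0 ∧ (deriv (δ false) 0).2 = 0) ∧
      ∀ γ : ℂ → ℂ × ℂ, AnalyticAt ℂ γ 0 → γ 0 = 0 → (∀ τ ≠ 0, γ τ ≠ 0) →
        (∀ τ, ∀ y ∈ χ.source, χ y = γ τ → y ∈ Z) → ∃ b, ∀ᶠ σ in 𝓝 0, ∃ τ, γ τ = δ b σ := by
  obtain ⟨φ, hφ, hpφ, hφ0, hZ⟩ : ∃ φ ∈ X.coords, p ∈ φ.source ∧ φ p = 0 ∧
      ∀ y ∈ φ.source, y ∈ Z → (φ y).1 * (φ y).2 = 0 := by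
    rcases h with ⟨φ, h1, h2, h3, h4⟩ | ⟨φ, h1, h2, h3, h4⟩
    · exact ⟨φ, h1, h2, h3, fun y hy hyZ => by rw [(h4 y hy).1 hyZ, zero_mul]⟩
    · exact ⟨φ, h1, h2, h3, fun y hy hyZ => (h4 y hy).1 hyZ⟩
  set T := φ ∘ χ.symm with hT
  set S := χ ∘ φ.symm with hS
  have aT : AnalyticAt ℂ T 0 := h0 ▸ analyticAt_transition hφ hχ hpφ hp
  have aS : AnalyticAt ℂ S 0 := hφ0 ▸ analyticAt_transition hχ hφ hp hpφ
  have χ0 : χ.symm 0 = p := by rw [← h0, χ.left_inv hp]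
  have φ0 : φ.symm 0 = p := by rw [← hφ0, φ.left_inv hpφ]
  have T0 : T 0 = 0 := by simp [hT, χ0, hφ0]
  have S0 : S 0 = 0 := by simp [hS, φ0, h0]
  have m0 : (0 : ℂ × ℂ) ∈ χ.target := h0 ▸ χ.map_source hp
  have n0 : (0 : ℂ × ℂ) ∈ φ.target := hφ0 ▸ φ.map_source hpφ
  have g1 : ∀ᶠ z in 𝓝 (0 : ℂ × ℂ), z ∈ χ.target ∧ χ.symm z ∈ φ.source := by
    refine Filter.Eventually.and (χ.open_target.mem_nhds m0) ?_
    have h1 := (χ.symm.continuousAt m0).eventually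
      (φ.open_source.mem_nhds (by rw [χ0]; exact hpφ))
    exact h1
  have g2 : ∀ᶠ z in 𝓝 (0 : ℂ × ℂ), z ∈ φ.target ∧ φ.symm z ∈ χ.source := by
    refine Filter.Eventually.and (φ.open_target.mem_nhds n0) ?_
    have h1 := (φ.symm.continuousAt n0).eventually
      (χ.open_source.mem_nhds (by rw [φ0]; exact hp))
    exact h1
  have gST : ∀ᶠ z in 𝓝 (0 : ℂ × ℂ), S (T z) = z := by
    filter_upwards [g1] with z hz
    simp [hS, hT, φ.left_inv hz.2, χ.right_inv hz.1]
  have gTS : ∀ᶠ z in 𝓝 (0 : ℂ × ℂ), T (S z) = z := by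
    filter_upwards [g2] with z hz
    simp [hS, hT, χ.left_inv hz.2, φ.right_inv hz.1]
  have dT : HasFDerivAt T (fderiv ℂ T 0) (S 0) := by
    rw [S0]; exact aT.differentiableAt.hasFDerivAt
  have dS : HasFDerivAt S (fderiv ℂ S 0) (T 0) := by
    rw [T0]; exact aS.differentiableAt.hasFDerivAt
  have dST : ∀ w, fderiv ℂ S 0 (fderiv ℂ T 0 w) = w := by
    have h1 : HasFDerivAt (S ∘ T) _ 0 := dS.comp (0 : ℂ × ℂ) aT.differentiableAt.hasFDerivAt
    have h2 : HasFDerivAt (S ∘ T) _ 0 := (hasFDerivAt_id (𝕜 := ℂ) (0 : ℂ × ℂ)).congr_of_eventuallyEq gST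
    intro w
    exact congrArg (fun L : (ℂ × ℂ) →L[ℂ] (ℂ × ℂ) => L w) (h1.unique h2)
  have dTS : ∀ w, fderiv ℂ T 0 (fderiv ℂ S 0 w) = w := by
    have h1 : HasFDerivAt (T ∘ S) _ 0 := dT.comp (0 : ℂ × ℂ) aS.differentiableAt.hasFDerivAt
    have h2 : HasFDerivAt (T ∘ S) _ 0 := (hasFDerivAt_id (𝕜 := ℂ) (0 : ℂ × ℂ)).congr_of_eventuallyEq gTS
    intro w
    exact congrArg (fun L : (ℂ × ℂ) →L[ℂ] (ℂ × ℂ) => L w) (h1.unique h2)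
  -- The two branches are the axes of the coordinates φ, read in the coordinates χ.
  let ι : Bool → ℂ × ℂ := fun b => bif b then (1, 0) else (0, 1)
  have aι : ∀ b, AnalyticAt ℂ (fun σ : ℂ => σ • ι b) 0 := fun b => analyticAt_id.smul analyticAt_const
  have dι : ∀ b, HasDerivAt (fun σ : ℂ => σ • ι b) (ι b) 0 := fun b => by
    simpa using (hasDerivAt_id (0 : ℂ)).smul_const (ι b)
  have dδ : ∀ b, HasDerivAt (fun σ : ℂ => S (σ • ι b)) (fderiv ℂ S 0 (ι b)) 0 := fun b => by
    refine HasFDerivAt.comp_hasDerivAt (0 : ℂ) (l := S) ?_ (dι b)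
    simp only [zero_smul]
    exact aS.differentiableAt.hasFDerivAt
  refine ⟨fun b σ => S (σ • ι b), fun b => ⟨_, dδ b, fun h1 => ?_⟩, fun b => ⟨?_, ?_⟩, ?_, ?_⟩
  · have h2 := dTS (ι b)
    rw [h1, map_zero] at h2
    cases b <;> simp [ι, Prod.ext_iff] at h2
  · refine AnalyticAt.comp (g := S) ?_ (aι b)
    simpa using aS
  · simp [S0]
  · rintro ⟨h1, h2⟩
    rw [(dδ _).deriv] at h1 h2
    have h3 := dST (0, 1)
    have h4 : fderiv ℂ T 0 (0, 1) = (fderiv ℂ T 0 (0, 1)).1 • ι true +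
        (fderiv ℂ T 0 (0, 1)).2 • ι false := by ext <;> simp [ι]
    rw [h4, map_add, map_smul, map_smul] at h3
    have h5 := congrArg Prod.snd h3
    simp [h1, h2] at h5
  · intro γ aγ γ0 hγ hγZ
    have aT' : AnalyticAt ℂ T (γ 0) := by rw [γ0]; exact aT
    have aTγ : AnalyticAt ℂ (T ∘ γ) 0 := aT'.comp aγ
    have tγ : Tendsto γ (𝓝 0) (𝓝 0) := by
      have := aγ.continuousAt.tendsto
      rwa [γ0] at this
    have e1 := tγ.eventually gST
    have ef : ∀ b : Bool, AnalyticAt ℂ (fun τ => if b then (T (γ τ)).1 else (T (γ τ)).2) 0 := by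
      intro b
      cases b
      · exact (ContinuousLinearMap.snd ℂ ℂ ℂ).analyticAt _ |>.comp aTγ
      · exact (ContinuousLinearMap.fst ℂ ℂ ℂ).analyticAt _ |>.comp aTγ
    have hmul : ∀ᶠ τ in 𝓝 0, (T (γ τ)).1 * (T (γ τ)).2 = 0 := by
      filter_upwards [tγ.eventually g1] with τ h1
      refine hZ _ h1.2 (hγZ τ _ (χ.map_target h1.1) (χ.right_inv h1.1))
    have main : ∀ b : Bool, (∀ᶠ τ in 𝓝 0, (if b then (T (γ τ)).2 else (T (γ τ)).1) = 0) →
        ∀ᶠ σ in 𝓝 (0 : ℂ), ∃ τ, γ τ = S (σ • ι b) := by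
      intro b hb
      have e2 : ∀ᶠ τ in 𝓝 0, T (γ τ) = (if b then (T (γ τ)).1 else (T (γ τ)).2) • ι b := by
        filter_upwards [hb] with τ hτ
        cases b <;> simp at hτ <;> ext <;> simp [ι, hτ]
      have f0 : (if b then (T (γ 0)).1 else (T (γ 0)).2) = 0 := by simp [γ0, T0]
      -- The coordinate of γ along its axis is not constant, because γ leaves the origin. By the
      -- open mapping theorem it takes all small values, so γ sweeps out the whole germ of the
      -- branch.
      rcases (ef b).eventually_constant_or_nhds_le_map_nhds with h1 | h1
      · exfalso
        simp only [f0] at h1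
        have h2 : ∀ᶠ τ in 𝓝[≠] (0 : ℂ), γ τ = 0 ∧ τ ≠ 0 := by
          refine Filter.Eventually.and ?_ self_mem_nhdsWithin
          refine nhdsWithin_le_nhds ?_
          filter_upwards [h1, e1, e2] with τ h2 h3 h4
          rw [← h3, h4, h2, zero_smul, S0]
        obtain ⟨τ, h3, h4⟩ := h2.exists
        exact hγ τ h4 h3
      · rw [f0] at h1
        have h2 := h1 (image_mem_map (e1.and e2))
        filter_upwards [h2] with σ hσ
        obtain ⟨τ, ⟨h3, h4⟩, rfl⟩ := hσ
        refine ⟨τ, ?_⟩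
        dsimp only
        rw [← h4]
        exact h3.symm
    -- A product of two analytic germs in one variable vanishes only if one of them does; so γ stays
    -- on one axis.
    rcases (ef true).eventually_eq_zero_or_eventually_ne_zero with h1 | h1
    · exact ⟨false, main false (by simpa using h1)⟩
    · refine ⟨true, main true ?_⟩
      rcases (ef false).eventually_eq_zero_or_eventually_ne_zero with h2 | h2
      · simpa using h2
      · exfalso
        obtain ⟨τ, ⟨h3, h4⟩, h5⟩ := ((h1.and h2).and (nhdsWithin_le_nhds hmul)).exists
        simp at h3 h4
        exact (mul_ne_zero h3 h4) h5

/-- A cusp is not a normal crossing. -/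
theorem not_hasNormalCrossingAt_cusp {Z : Set X} {p : X} {χ : OpenPartialHomeomorph X (ℂ × ℂ)}
    (hχ : χ ∈ X.coords) (hp : p ∈ χ.source) (h0 : χ p = 0) {a b : ℕ} (ha : 2 ≤ a) (hb : 2 ≤ b)
    (hab : a.Coprime b) {c : ℂ} (hc : c ≠ 0)
    (hZ : ∀ y ∈ χ.source, (χ y).2 ^ a = c * (χ y).1 ^ b → y ∈ Z) : ¬ HasNormalCrossingAt Z p := by
  intro h
  obtain ⟨δ, hd, hδ, -, H⟩ := h.exists_branches hχ hp h0
  -- With k ^ a = c, the cusp is parametrized by (τ ^ a, k τ ^ b).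
  obtain ⟨k, rfl⟩ := IsAlgClosed.exists_pow_nat_eq c (by omega : 0 < a)
  obtain ⟨i, hi⟩ := H (fun τ => (τ ^ a, k * τ ^ b))
    ((analyticAt_id.pow a).prod (analyticAt_const.mul (analyticAt_id.pow b)))
    (by simp [zero_pow (by omega : a ≠ 0), zero_pow (by omega : b ≠ 0)])
    (fun τ hτ h1 => pow_ne_zero a hτ (congrArg Prod.fst h1))
    (fun τ y hy h1 => hZ y hy (by rw [h1]; ring))
  have a1 : AnalyticAt ℂ (fun σ => (δ i σ).1) 0 :=
    (ContinuousLinearMap.fst ℂ ℂ ℂ).analyticAt _ |>.comp (hδ i).1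
  have a2 : AnalyticAt ℂ (fun σ => (δ i σ).2) 0 :=
    (ContinuousLinearMap.snd ℂ ℂ ℂ).analyticAt _ |>.comp (hδ i).1
  have he : (fun σ => (δ i σ).2) ^ a =ᶠ[𝓝 0] (fun _ => k ^ a) * (fun σ => (δ i σ).1) ^ b := by
    filter_upwards [hi] with σ ⟨τ, hτ⟩
    simp only [Pi.pow_apply, Pi.mul_apply, ← hτ]
    ring
  -- The equation of the cusp on the branch gives a · ord y = b · ord x. The branch is regular, so
  -- one of the two orders is 1 and one of a, b divides the other, contrary to coprimality and a, b
  -- ≥ 2.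
  have ho := analyticOrderAt_congr he
  rw [analyticOrderAt_pow a2, analyticOrderAt_mul analyticAt_const (a1.pow b),
    analyticOrderAt_pow a1, analyticAt_const.analyticOrderAt_eq_zero.2 hc, zero_add] at ho
  obtain ⟨d, hd, hd0⟩ := hd i
  have d1 : HasDerivAt (fun σ => (δ i σ).1) d.1 0 :=
    (ContinuousLinearMap.fst ℂ ℂ ℂ).hasFDerivAt.comp_hasDerivAt _ hd
  have d2 : HasDerivAt (fun σ => (δ i σ).2) d.2 0 :=
    (ContinuousLinearMap.snd ℂ ℂ ℂ).hasFDerivAt.comp_hasDerivAt _ hd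
  by_cases h1 : d.1 = 0
  · have h2 : d.2 ≠ 0 := fun h2 => hd0 (Prod.ext h1 h2)
    have h3 := a2.analyticOrderAt_eq_one_of_zero_deriv_ne_zero (by simp [(hδ i).2])
      (by rwa [d2.deriv])
    rw [h3] at ho
    generalize analyticOrderAt (fun σ => (δ i σ).1) 0 = n at ho
    cases n with
    | top => simp [show b ≠ 0 by omega] at ho
    | coe n =>
      simp only [nsmul_eq_mul, mul_one] at ho
      have h4 : a = b * n := by exact_mod_cast ho
      have h5 := hab.symm.eq_one_of_dvd ⟨n, h4⟩
      omega
  · have h3 := a1.analyticOrderAt_eq_one_of_zero_deriv_ne_zero (by simp [(hδ i).2])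
      (by rwa [d1.deriv])
    rw [h3] at ho
    generalize analyticOrderAt (fun σ => (δ i σ).2) 0 = n at ho
    cases n with
    | top => simp [show a ≠ 0 by omega] at ho
    | coe n =>
      simp only [nsmul_eq_mul, mul_one] at ho
      have h4 : a * n = b := by exact_mod_cast ho
      have h5 := hab.eq_one_of_dvd ⟨n, h4.symm⟩
      omega

/-- Two tangent branches, or three branches, do not form a normal crossing. -/
theorem not_hasNormalCrossingAt_of_branches {Z : Set X} {p : X}
    {χ : OpenPartialHomeomorph X (ℂ × ℂ)} (hχ : χ ∈ X.coords) (hp : p ∈ χ.source) (h0 : χ p = 0)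
    {b : ℕ} (hb : 1 ≤ b) {c₁ c₂ : ℂ} (hc : c₁ ≠ c₂)
    (h₁ : ∀ y ∈ χ.source, (χ y).2 = c₁ * (χ y).1 ^ b → y ∈ Z)
    (h₂ : ∀ y ∈ χ.source, (χ y).2 = c₂ * (χ y).1 ^ b → y ∈ Z)
    (h₃ : 2 ≤ b ∨ ∀ y ∈ χ.source, (χ y).1 = 0 → y ∈ Z) : ¬ HasNormalCrossingAt Z p := by
  intro h
  obtain ⟨δ, hd, hδ, hi, H⟩ := h.exists_branches hχ hp h0
  have nz : ∀ i, ¬ ∀ᶠ σ in 𝓝 0, δ i σ = 0 := by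
    intro i h1
    obtain ⟨d, h2, h3⟩ := hd i
    exact h3 (h2.unique ((hasDerivAt_const (0 : ℂ) (0 : ℂ × ℂ)).congr_of_eventuallyEq h1))
  have br : ∀ c : ℂ, (∀ y ∈ χ.source, (χ y).2 = c * (χ y).1 ^ b → y ∈ Z) →
      ∃ i, ∀ᶠ σ in 𝓝 0, (δ i σ).2 = c * (δ i σ).1 ^ b := by
    intro c hcZ
    obtain ⟨i, hi⟩ := H (fun τ => (τ, c * τ ^ b))
      (analyticAt_id.prod (analyticAt_const.mul (analyticAt_id.pow b)))
      (by simp [zero_pow (by omega : b ≠ 0)])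
      (fun τ hτ h1 => hτ (congrArg Prod.fst h1))
      (fun τ y hy h1 => hcZ y hy (by rw [h1]))
    refine ⟨i, ?_⟩
    filter_upwards [hi] with σ ⟨τ, hτ⟩
    rw [← hτ]
  obtain ⟨i₁, e₁⟩ := br c₁ h₁
  obtain ⟨i₂, e₂⟩ := br c₂ h₂
  have hne : i₁ ≠ i₂ := by
    rintro rfl
    refine nz i₁ ?_
    filter_upwards [e₁, e₂] with σ h1 h2
    have h3 : (c₁ - c₂) * (δ i₁ σ).1 ^ b = 0 := by rw [sub_mul, ← h1, ← h2, sub_self]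
    have h4 := (mul_eq_zero.1 h3).resolve_left (sub_ne_zero.2 hc)
    rw [h4, mul_zero] at h1
    exact Prod.ext (pow_eq_zero_iff (by omega) |>.1 h4) h1
  rcases h₃ with h₃ | h₃
  -- If b ≥ 2, the curves y = c x^b are tangent to y = 0, so both branches of the crossing would be
  -- horizontal.
  · have key : ∀ (i : Bool) (c : ℂ), (∀ᶠ σ in 𝓝 0, (δ i σ).2 = c * (δ i σ).1 ^ b) →
        (deriv (δ i) 0).2 = 0 := by
      intro i c hci
      obtain ⟨d, hd, -⟩ := hd i
      have d1 : HasDerivAt (fun σ => (δ i σ).1) d.1 0 :=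
        (ContinuousLinearMap.fst ℂ ℂ ℂ).hasFDerivAt.comp_hasDerivAt _ hd
      have d2 : HasDerivAt (fun σ => (δ i σ).2) d.2 0 :=
        (ContinuousLinearMap.snd ℂ ℂ ℂ).hasFDerivAt.comp_hasDerivAt _ hd
      have d3 := ((d1.fun_pow b).const_mul c).congr_of_eventuallyEq hci
      have d4 := d2.unique d3
      rw [hd.deriv, d4, (hδ i).2]
      simp [zero_pow (by omega : b - 1 ≠ 0)]
    have k₁ := key i₁ c₁ e₁
    have k₂ := key i₂ c₂ e₂
    have key' : ∀ j k : Bool, j ≠ k → (j = true ∧ k = false) ∨ (j = false ∧ k = true) := by decide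
    rcases key' _ _ hne with ⟨rfl, rfl⟩ | ⟨rfl, rfl⟩
    · exact hi ⟨k₁, k₂⟩
    · exact hi ⟨k₂, k₁⟩
  -- The axis x = 0 would be a third branch, but a normal crossing has only two.
  · obtain ⟨i, hi⟩ := H (fun τ => (0, τ)) (analyticAt_const.prod analyticAt_id) rfl
      (fun τ hτ h1 => hτ (congrArg Prod.snd h1)) (fun τ y hy h1 => h₃ y hy (by rw [h1]))
    have key : ∀ c : ℂ, ¬ ∀ᶠ σ in 𝓝 0, (δ i σ).2 = c * (δ i σ).1 ^ b := by
      intro c hci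
      refine nz i ?_
      filter_upwards [hci, hi] with σ h1 ⟨τ, h2⟩
      have h3 : (δ i σ).1 = 0 := by rw [← h2]
      rw [h3, zero_pow (by omega), mul_zero] at h1
      exact Prod.ext h3 h1
    have k₁ : i ≠ i₁ := fun h => key c₁ (h ▸ e₁)
    have k₂ : i ≠ i₂ := fun h => key c₂ (h ▸ e₂)
    have key' : ∀ i j k : Bool, i ≠ j → i ≠ k → j = k := by decide
    exact hne (key' _ _ _ k₁ k₂)

end ComplexSurface

/-! ### The zero set of a quasihomogeneous polynomial. -/

namespace ComplexSurface

variable {X : ComplexSurface} {Ω : TopologicalSpace.Opens (ℂ × ℂ)}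

/-- The curve `C` consists of the axis `u = 0` (if `a`), of the axis `v = 0` (if `b`) and of the
branches `v ^ α = c * u ^ β` with `c ∈ K`. -/
structure IsQuasihomogeneous (C : Set (ofOpens Ω)) (α β : ℕ) (a b : Prop) (K : Finset ℂ) : Prop where
  mem_iff : ∀ x, x ∈ C ↔ (a ∧ (val x).1 = 0) ∨ (b ∧ (val x).2 = 0) ∨
    ∃ c ∈ K, (val x).2 ^ α = c * (val x).1 ^ β
  zero_notMem : 0 ∉ K
  nonempty : a ∨ b ∨ K.Nonempty

theorem eval_weightedHomogeneous {α β γ : ℕ} {f : MvPolynomial (Fin 2) ℂ}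
    (hf : MvPolynomial.IsWeightedHomogeneous ![α, β] f γ) (l u v : ℂ) :
    MvPolynomial.eval ![l ^ α * u, l ^ β * v] f = l ^ γ * MvPolynomial.eval ![u, v] f := by
  rw [MvPolynomial.eval_eq', MvPolynomial.eval_eq', Finset.mul_sum]
  refine Finset.sum_congr rfl fun d hd => ?_
  have h1 := hf (MvPolynomial.mem_support_iff.1 hd)
  rw [Finsupp.weight_apply, Finsupp.sum_fintype _ _ (by simp)] at h1
  simp only [Fin.sum_univ_two, Fin.prod_univ_two, Matrix.cons_val_zero, Matrix.cons_val_one,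
    smul_eq_mul] at h1 ⊢
  rw [← h1]
  ring

/-- With α x + β y = 1 by Bézout, l = u^x v^y works. It follows that ℂ* acts transitively, by (u, v)
↦ (l^α u, l^β v), on each branch minus the origin. -/
theorem exists_common_root {α β : ℕ} (hcop : α.Coprime β) {u v : ℂ} (hu : u ≠ 0) (hv : v ≠ 0)
    (h : v ^ α = u ^ β) : ∃ l : ℂ, l ≠ 0 ∧ l ^ α = u ∧ l ^ β = v := by
  have hb := Nat.gcd_eq_gcd_ab α β
  rw [hcop.gcd_eq_one] at hb
  set x := α.gcdA β
  set y := α.gcdB β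
  refine ⟨u ^ x * v ^ y, by positivity, ?_, ?_⟩
  · rw [mul_pow, ← zpow_natCast, ← zpow_natCast, ← zpow_mul, ← zpow_mul, mul_comm y, zpow_mul v,
      zpow_natCast, h, ← zpow_natCast, ← zpow_mul, ← zpow_add₀ hu]
    convert zpow_one u using 2
    push_cast at hb
    linarith
  · rw [mul_pow, ← zpow_natCast, ← zpow_natCast, ← zpow_mul, ← zpow_mul, mul_comm x, zpow_mul u,
      zpow_natCast, ← h, ← zpow_natCast, ← zpow_mul, ← zpow_add₀ hv]
    convert zpow_one v using 2
    push_cast at hb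
    linarith

/-- The action (u, v) ↦ (l^α u, l^β v) multiplies f by l^γ. Every orbit off the axes meets the line
u = 1, so there f is governed by g(w) = f(1, w). A root w ≠ 0 of g contributes the branch v^α = w^α
u^β, and the axes belong to the zero set when f(0, 1) = 0 or f(1, 0) = 0. -/
theorem exists_isQuasihomogeneous {α β γ : ℕ} (hα : 0 < α) (hβ : 0 < β) (hcop : α.Coprime β)
    (hγ : 0 < γ) {f : MvPolynomial (Fin 2) ℂ} (hf0 : f ≠ 0)
    (hf : MvPolynomial.IsWeightedHomogeneous ![α, β] f γ) (Ω : TopologicalSpace.Opens (ℂ × ℂ)) :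
    ∃ a b K, IsQuasihomogeneous (zeroSet Ω f) α β a b K := by
  classical
  have hl := eval_weightedHomogeneous hf
  set φ : ℂ → ℂ → ℂ := fun u v => MvPolynomial.eval ![u, v] f with hφ
  have hφl : ∀ l u v, φ (l ^ α * u) (l ^ β * v) = l ^ γ * φ u v := hl
  set g : Polynomial ℂ := MvPolynomial.aeval ![1, Polynomial.X] f with hg
  have hge : ∀ w, g.eval w = φ 1 w := by
    intro w
    have h1 : (Polynomial.evalRingHom w).comp
        (MvPolynomial.aeval ![1, Polynomial.X] : MvPolynomial (Fin 2) ℂ →ₐ[ℂ] _).toRingHom =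
        MvPolynomial.eval ![1, w] := by
      apply MvPolynomial.ringHom_ext
      · intro r; simp
      · intro i; fin_cases i <;> simp
    exact congrArg (fun L : MvPolynomial (Fin 2) ℂ →+* ℂ => L f) h1
  have hdown : ∀ l v, l ≠ 0 → φ (l ^ α) v = l ^ γ * φ 1 (v / l ^ β) := by
    intro l v h
    rw [← hφl, mul_one, mul_div_cancel₀ _ (pow_ne_zero _ h)]
  -- If g were zero, f would vanish wherever u ≠ 0, and u f would be the zero polynomial.
  have hg0 : g ≠ 0 := by
    intro h
    have h1 : f * MvPolynomial.X 0 = 0 := by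
      apply MvPolynomial.funext
      intro z
      rw [map_mul, MvPolynomial.eval_X, map_zero]
      by_cases hz : z 0 = 0
      · rw [hz, mul_zero]
      · obtain ⟨l, hl'⟩ := IsAlgClosed.exists_pow_nat_eq (z 0) hα
        have hl0 : l ≠ 0 := by rintro rfl; exact hz (by rw [← hl', zero_pow hα.ne'])
        have h2 := hdown l (z 1) hl0
        rw [← hge, h, Polynomial.eval_zero, mul_zero, hl'] at h2
        have h3 : z = ![z 0, z 1] := by ext i; fin_cases i <;> rfl
        rw [h3]
        change φ (z 0) (z 1) * _ = 0
        rw [h2, zero_mul]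
    rcases mul_eq_zero.1 h1 with h2 | h2
    · exact hf0 h2
    · exact MvPolynomial.X_ne_zero _ h2
  have h00 : φ 0 0 = 0 := by
    have := hφl 0 1 1
    simpa [zero_pow hα.ne', zero_pow hβ.ne', zero_pow hγ.ne'] using this
  have hne : φ 0 1 = 0 ∨ φ 1 0 = 0 ∨
      ((g.roots.toFinset.filter (· ≠ 0)).image (· ^ α)).Nonempty := by
    by_contra hcon
    push Not at hcon
    obtain ⟨h1, h2, h3⟩ := hcon
    rw [Finset.eq_empty_iff_forall_notMem] at h3
    simp only [ne_eq, Finset.mem_image, Finset.mem_filter, Multiset.mem_toFinset] at h3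
    have hroot : ∀ w, g.eval w ≠ 0 := by
      intro w hw
      by_cases hw0 : w = 0
      · rw [hge, hw0] at hw
        exact h2 hw
      · exact h3 (w ^ α) ⟨w, ⟨(Polynomial.mem_roots hg0).2 hw, hw0⟩, rfl⟩
    have h01 : φ 0 1 = 0 := by
      have hdeg : g.degree = 0 := by
        by_contra hd
        obtain ⟨w, hw⟩ := IsAlgClosed.exists_root g hd
        exact hroot w hw
      rw [Polynomial.eq_C_of_degree_eq_zero hdeg] at hge
      simp only [Polynomial.eval_C] at hge
      -- A polynomial g without roots is constant, so f(l^α, 1) = l^γ g for l ≠ 0. Continuity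
      -- extends this to l = 0 and gives f(0, 1) = 0.
      have hcont : Continuous fun l : ℂ => φ (l ^ α) 1 := by
        have : (fun l : ℂ => φ (l ^ α) 1) = fun l =>
            MvPolynomial.eval (fun i => (![l ^ α, 1] : Fin 2 → ℂ) i) f := rfl
        rw [this]
        simp only [MvPolynomial.eval_eq', Fin.prod_univ_two, Matrix.cons_val_zero,
          Matrix.cons_val_one]
        fun_prop
      have heq : (fun l : ℂ => φ (l ^ α) 1) = fun l => l ^ γ * g.coeff 0 := by
        refine hcont.ext_on (dense_compl_singleton (0 : ℂ)) (by fun_prop) fun l hl' => ?_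
        dsimp only
        rw [hdown l 1 hl', ← hge]
      have := congrFun heq 0
      simpa [zero_pow hα.ne', zero_pow hγ.ne'] using this
    exact h1 h01
  refine ⟨φ 0 1 = 0, φ 1 0 = 0, (g.roots.toFinset.filter (· ≠ 0)).image (· ^ α), ⟨?_, ?_, ?_⟩⟩
  · intro x
    change φ (val x).1 (val x).2 = 0 ↔ _
    generalize (val x).1 = u
    generalize (val x).2 = v
    by_cases hu : u = 0
    · subst hu
      by_cases hv : v = 0
      · subst hv
        refine iff_of_true h00 ?_
        rcases hne with h | h | ⟨c, hc⟩
        · exact Or.inl ⟨h, rfl⟩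
        · exact Or.inr (Or.inl ⟨h, rfl⟩)
        · exact Or.inr (Or.inr ⟨c, hc, by simp [zero_pow hα.ne', zero_pow hβ.ne']⟩)
      · obtain ⟨l, rfl⟩ := IsAlgClosed.exists_pow_nat_eq v hβ
        have hl0 : l ≠ 0 := by rintro rfl; exact hv (zero_pow hβ.ne')
        have h1 := hφl l 0 1
        rw [mul_zero, mul_one] at h1
        rw [h1]
        simp only [mul_eq_zero, pow_eq_zero_iff hγ.ne', hl0, false_or, and_true, hv, and_false,
          zero_pow hβ.ne']
        constructor
        · exact Or.inl
        · rintro (h | ⟨c, -, h⟩)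
          · exact h
          · simp [hv] at h
    · obtain ⟨l, rfl⟩ := IsAlgClosed.exists_pow_nat_eq u hα
      have hl0 : l ≠ 0 := by rintro rfl; exact hu (zero_pow hα.ne')
      by_cases hv : v = 0
      · subst hv
        have h1 := hφl l 1 0
        rw [mul_zero, mul_one] at h1
        rw [h1]
        simp only [mul_eq_zero, pow_eq_zero_iff hγ.ne', hl0, false_or, and_true, hu, and_false,
          zero_pow hα.ne']
        constructor
        · exact Or.inl
        · rintro (h | ⟨c, hc, h⟩)
          · exact h
          · exfalso
            simp only [ne_eq, Finset.mem_image, Finset.mem_filter, Multiset.mem_toFinset] at hc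
            obtain ⟨w, ⟨-, hw⟩, rfl⟩ := hc
            exact mul_ne_zero (pow_ne_zero α hw) (pow_ne_zero β hu) h.symm
      · simp only [hu, hv, and_false, false_or]
        constructor
        · intro h
          rw [hdown l v hl0] at h
          have h1 := (mul_eq_zero.1 h).resolve_left (pow_ne_zero _ hl0)
          refine ⟨(v / l ^ β) ^ α, Finset.mem_image_of_mem (· ^ α) (Finset.mem_filter.2
            ⟨Multiset.mem_toFinset.2 ((Polynomial.mem_roots hg0).2 ?_), ?_⟩), ?_⟩
          · rw [Polynomial.IsRoot, hge, h1]
          · exact div_ne_zero hv (pow_ne_zero _ hl0)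
          · rw [pow_right_comm, ← mul_pow, div_mul_cancel₀ _ (pow_ne_zero _ hl0)]
        · rintro ⟨c, hc, h⟩
          simp only [ne_eq, Finset.mem_image, Finset.mem_filter, Multiset.mem_toFinset] at hc
          obtain ⟨w, ⟨hw1, hw⟩, rfl⟩ := hc
          -- The point (u, v) is the image of (1, w) under the action of a common root k of u and v
          -- / w.
          have h1 : (v / w) ^ α = (l ^ α) ^ β := by
            rw [div_pow, h, mul_div_cancel_left₀ _ (pow_ne_zero _ hw)]
          obtain ⟨k, hk, hk1, hk2⟩ := exists_common_root hcop hu (div_ne_zero hv hw) h1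
          have h2 := hφl k 1 w
          rw [mul_one, hk1, hk2, div_mul_cancel₀ _ hw] at h2
          rw [h2, ← hge, (Polynomial.mem_roots hg0).1 hw1, mul_zero]
  · simp only [ne_eq, Finset.mem_image, Finset.mem_filter]
    rintro ⟨w, ⟨-, hw⟩, h⟩
    exact pow_ne_zero _ hw h
  · exact hne

/-- The tautological coordinates on an open subset of the plane. -/
theorem exists_coords_ofOpens (h0 : (0 : ℂ × ℂ) ∈ Ω) : ∃ χ ∈ (ofOpens Ω).coords,
    χ.source = univ ∧ χ.target = {z | z ∈ Ω} ∧ ∀ x, χ x = val x := by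
  have hne : Nonempty Ω := ⟨⟨0, h0⟩⟩
  exact ⟨(Ω.openPartialHomeomorphSubtypeCoe hne).trans (OpenPartialHomeomorph.refl _),
    IsManifold.chart_mem_maximalAtlas (I := 𝓘(ℂ, ℂ × ℂ)) (n := ω) (M := ofOpens Ω) (origin Ω h0),
    by simp; rfl, by ext; simp, fun x => rfl⟩

/-- In the excluded cases either there are only axes, or α = 1 and C is one graph v = c u^β,
possibly together with u = 0. By contraposition, a curve without normal crossing at 0 satisfies the
conditions that make every blowing-up unavoidable. -/
theorem IsQuasihomogeneous.hasNormalCrossingAt {C : Set (ofOpens Ω)} {α β : ℕ} {a b : Prop}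
    {K : Finset ℂ} (hC : IsQuasihomogeneous C α β a b K) (hα : 0 < α) (hβ : 0 < β)
    (h0 : (0 : ℂ × ℂ) ∈ Ω)
    (h : ¬ (K.Nonempty ∧ (2 ≤ α ∨ b ∨ ∃ c₁ ∈ K, ∃ c₂ ∈ K, c₁ ≠ c₂))) :
    HasNormalCrossingAt C (origin Ω h0) := by
  obtain ⟨χ, hχ, hs, ht, hv⟩ := exists_coords_ofOpens h0
  have hx : origin Ω h0 ∈ χ.source := hs ▸ mem_univ _
  have hx0 : χ (origin Ω h0) = 0 := hv _
  have hχ' := coords_swap hχ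
  set χ' := χ.trans (Homeomorph.prodComm ℂ ℂ).toOpenPartialHomeomorph with hχ'def
  have hx' : origin Ω h0 ∈ χ'.source := by simpa [hχ'def] using hx
  have hχ'v : ∀ y, χ' y = ((val y).2, (val y).1) := fun y => by
    change ((χ y).2, (χ y).1) = _
    rw [hv]
  have hx0' : χ' (origin Ω h0) = 0 := hχ'v _
  rcases K.eq_empty_or_nonempty with rfl | ⟨c, hc⟩
  · have hC' := hC.mem_iff
    simp only [Finset.notMem_empty, false_and, exists_false, or_false] at hC'
    by_cases ha : a
    · by_cases hb : b
      · refine Or.inr ⟨χ, hχ, hx, hx0, fun y _ => ?_⟩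
        rw [hC', hv, mul_eq_zero]
        simp [ha, hb]
      · refine Or.inl ⟨χ, hχ, hx, hx0, fun y _ => ?_⟩
        rw [hC', hv]
        simp [ha, hb]
    · have hb : b := by simpa [ha] using hC.nonempty
      refine Or.inl ⟨χ', hχ', hx', hx0', fun y _ => ?_⟩
      rw [hC', hχ'v]
      simp [ha, hb]
  · push Not at h
    obtain ⟨h1, h2, h3⟩ := h ⟨c, hc⟩
    obtain rfl : α = 1 := by omega
    have hK : ∀ d ∈ K, d = c := fun d hd => h3 d hd c hc
    have hC' : ∀ y, y ∈ C ↔ (a ∧ (val y).1 = 0) ∨ (val y).2 - c * (val y).1 ^ β = 0 := by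
      intro y
      rw [hC.mem_iff, sub_eq_zero, pow_one]
      simp only [h2, false_and, false_or]
      refine or_congr Iff.rfl ⟨?_, fun h => ⟨c, hc, h⟩⟩
      rintro ⟨d, hd, h⟩
      rwa [hK d hd] at h
    have hd : fderiv ℂ (fun z : ℂ × ℂ => z.1 - c * z.2 ^ β) (χ' (origin Ω h0)) (1, 0) ≠ 0 := by
      have h4 := (hasFDerivAt_fst (𝕜 := ℂ) (E := ℂ) (F := ℂ) (p := χ' (origin Ω h0))).sub
        (((hasFDerivAt_snd (𝕜 := ℂ) (E := ℂ) (F := ℂ) (p := χ' (origin Ω h0))).pow β).const_mul c)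
      have h5 : fderiv ℂ (fun z : ℂ × ℂ => z.1 - c * z.2 ^ β) (χ' (origin Ω h0)) (1, 0) = 1 := by
        refine (congrArg (fun L : (ℂ × ℂ) →L[ℂ] ℂ => L (1, 0)) h4.fderiv).trans ?_
        simp
      rw [h5]
      exact one_ne_zero
    obtain ⟨φ, m1, m2, m3, m4⟩ := exists_coords_fst hχ' hx' (g := fun z => z.1 - c * z.2 ^ β)
      (contDiffAt_fst.sub (contDiffAt_const.mul (contDiffAt_snd.pow β)))
      (by simp [hx0', zero_pow hβ.ne']) hd (P := fun _ => True) (by simp)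
    by_cases ha : a
    · refine Or.inr ⟨φ, m1, m2, m3, fun y hy => ?_⟩
      rw [hC', (m4 y hy).1, hχ'v, hx0', mul_eq_zero]
      simp only [ha, true_and, Prod.snd_zero, sub_zero]
      exact or_comm
    · refine Or.inl ⟨φ, m1, m2, m3, fun y hy => ?_⟩
      rw [hC', (m4 y hy).1, hχ'v]
      simp only [ha, false_and, false_or]

end ComplexSurface

/-! ### The composition 𝔈ᵏ(p, S) on a toric configuration. -/

namespace ComplexSurface

variable {X Y X' : ComplexSurface} {Ω : TopologicalSpace.Opens (ℂ × ℂ)}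

theorem IsQuasihomogeneous.mem_of_val_eq_zero {C : Set (ofOpens Ω)} {α β : ℕ} {a b : Prop}
    {K : Finset ℂ} (hC : IsQuasihomogeneous C α β a b K) (hα : 0 < α) (hβ : 0 < β) {x : ofOpens Ω}
    (hu : (val x).1 = 0) (hv : (val x).2 = 0) : x ∈ C := by
  rw [hC.mem_iff, hu, hv]
  rcases hC.nonempty with h | h | ⟨c, hc⟩
  · exact Or.inl ⟨h, rfl⟩
  · exact Or.inr (Or.inl ⟨h, rfl⟩)
  · exact Or.inr (Or.inr ⟨c, hc, by simp [zero_pow hα.ne', zero_pow hβ.ne']⟩)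

/-- A branch in the coordinates of a monomial chart. -/
theorem monomialMap_branch {w w' : ℕ × ℕ} {α β ρ ρ' : ℕ} (hdet : w.1 * w'.2 = w.2 * w'.1 + 1)
    (hρ : ρ • w + ρ' • w' = (α, β)) {z : ℂ × ℂ} {c : ℂ} (hz : z.2 ^ ρ = c * z.1 ^ ρ') :
    (monomialMap w w' z).2 ^ α = c * (monomialMap w w' z).1 ^ β := by
  simp only [Prod.ext_iff, Prod.fst_add, Prod.snd_add, Prod.smul_fst, Prod.smul_snd,
    smul_eq_mul] at hρ
  obtain ⟨rfl, rfl⟩ := hρ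
  simp only [monomialMap, mul_pow, ← pow_mul]
  -- As the determinant is 1, pairing (α, β) with w' and w recovers ρ and ρ'.
  have h1 : w'.2 * (ρ * w.1 + ρ' * w'.1) = w'.1 * (ρ * w.2 + ρ' * w'.2) + ρ := by
    linear_combination ρ * hdet
  have h2 : w.1 * (ρ * w.2 + ρ' * w'.2) = w.2 * (ρ * w.1 + ρ' * w'.1) + ρ' := by
    linear_combination ρ' * hdet
  rw [h1, h2, pow_add, pow_add, hz]
  ring

/-- The position `o` is next to the position `s` in a sequence of `m + 2` curves. -/
def Adjacent (m o s : ℕ) : Prop := (s = o + 1 ∧ o ≤ m) ∨ (o = s + 1 ∧ s ≤ m)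

/-- The `j`-th curve of a sequence of `m + 2` curves is contained in the total transform. -/
def InTransform (m : ℕ) (a b : Prop) (j : ℕ) : Prop := (j = 0 → a) ∧ (j = m + 1 → b)

namespace IsToric

variable {E : X → ofOpens Ω} {m : ℕ} {w : ℕ → ℕ × ℕ} {A : ℕ → Set X}
  {χ : ℕ → OpenPartialHomeomorph X (ℂ × ℂ)} {i j o s : ℕ}

theorem fst_eq_zero (h : IsToric E m w A χ) (hj : j ≤ m) {x : X} (hx : x ∈ A j) :
    (val (E x)).1 = 0 := by
  obtain ⟨k, hk, hxk⟩ := h.cover x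
  rw [h.map k hk x hxk, monomialMap]
  rcases (h.curve k hk j (by omega) x hxk).1 hx with ⟨rfl, h1⟩ | ⟨rfl, h1⟩
  · simp [h1, (h.fst_pos hj).ne']
  · simp [h1, (h.fst_pos hj).ne']

theorem snd_eq_zero (h : IsToric E m w A χ) (hj : 1 ≤ j) (hj' : j ≤ m + 1) {x : X} (hx : x ∈ A j) :
    (val (E x)).2 = 0 := by
  obtain ⟨j, rfl⟩ : ∃ l, j = l + 1 := ⟨j - 1, by omega⟩
  have h2 := (h.snd_pos (i := j) (by omega)).ne'
  obtain ⟨k, hk, hxk⟩ := h.cover x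
  rw [h.map k hk x hxk, monomialMap]
  rcases (h.curve k hk _ hj' x hxk).1 hx with ⟨h3, h1⟩ | ⟨h3, h1⟩
  · subst h3; simp [h1, h2]
  · rw [h3] at h2; simp [h1, h2]

theorem subset_preimage (h : IsToric E m w A χ) {C : Set (ofOpens Ω)} {α β : ℕ} {a b : Prop}
    {K : Finset ℂ} (hC : IsQuasihomogeneous C α β a b K) (hα : 0 < α) (hβ : 0 < β)
    (hj : j ≤ m + 1) (he : InTransform m a b j) : A j ⊆ E ⁻¹' C := by
  intro x hx
  by_cases hj0 : j = 0
  · subst hj0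
    exact (hC.mem_iff _).2 (Or.inl ⟨he.1 rfl, h.fst_eq_zero (Nat.zero_le _) hx⟩)
  · have hv := h.snd_eq_zero (by omega) hj hx
    by_cases hjm : j = m + 1
    · exact (hC.mem_iff _).2 (Or.inr (Or.inl ⟨he.2 hjm, hv⟩))
    · exact hC.mem_of_val_eq_zero hα hβ (h.fst_eq_zero (by omega) hx) hv

/-- Coordinates at the intersection point of two consecutive curves. -/
theorem exists_coords_corner (h : IsToric E m w A χ) (h0 : (0 : ℂ × ℂ) ∈ Ω) (ha : Adjacent m o s)
    {q : X} (hq : A o ∩ A s = {q}) {α β ρ ρ' : ℕ} (hρ : ρ • w o + ρ' • w s = (α, β)) :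
    ∃ ψ ∈ X.coords, q ∈ ψ.source ∧ ψ q = 0 ∧ (∀ y ∈ ψ.source, (ψ y).1 = 0 → y ∈ A o) ∧
      (∀ y ∈ ψ.source, (ψ y).2 = 0 → y ∈ A s) ∧
      ∃ κ : ℂ → ℂ, Function.Injective κ ∧ (∀ c ≠ 0, κ c ≠ 0) ∧ ∀ c ≠ 0, ∀ y ∈ ψ.source,
        (ψ y).2 ^ ρ = κ c * (ψ y).1 ^ ρ' → (val (E y)).2 ^ α = c * (val (E y)).1 ^ β := by
  rcases ha with ⟨rfl, hm⟩ | ⟨rfl, hm⟩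
  · have hq' := singleton_injective (hq.symm.trans (h.inter_succ h0 hm))
    have ht := h.zero_mem_target h0 hm
    refine ⟨χ o, h.mem o hm, hq' ▸ (χ o).map_target ht, hq' ▸ (χ o).right_inv ht,
      fun y hy h1 => (h.curve o hm o (by omega) y hy).2 (Or.inl ⟨rfl, h1⟩),
      fun y hy h1 => (h.curve o hm _ (by omega) y hy).2 (Or.inr ⟨rfl, h1⟩),
      id, Function.injective_id, fun _ h => h, fun c _ y hy h1 => ?_⟩
    rw [h.map o hm y hy]
    exact monomialMap_branch (h.det o hm) hρ h1
  · rw [inter_comm] at hq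
    have hq' := singleton_injective (hq.symm.trans (h.inter_succ h0 hm))
    have ht := h.zero_mem_target h0 hm
    have hqs : q ∈ (χ s).source := hq' ▸ (χ s).map_target ht
    have hq0 : χ s q = 0 := hq' ▸ (χ s).right_inv ht
    have hv : ∀ y, (χ s).trans (Homeomorph.prodComm ℂ ℂ).toOpenPartialHomeomorph y =
      ((χ s y).2, (χ s y).1) := fun y => rfl
    have hs : ((χ s).trans (Homeomorph.prodComm ℂ ℂ).toOpenPartialHomeomorph).source =
      (χ s).source := by simp
    refine ⟨_, coords_swap (h.mem s hm), hs ▸ hqs, by rw [hv, hq0]; rfl,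
      fun y hy h1 => (h.curve s hm _ (by omega) y (hs ▸ hy)).2 (Or.inr ⟨rfl, h1⟩),
      fun y hy h1 => (h.curve s hm _ (by omega) y (hs ▸ hy)).2 (Or.inl ⟨rfl, h1⟩),
      -- Exchanging the two axes replaces the constant of a branch by its inverse.
      Inv.inv, inv_injective, fun _ h => inv_ne_zero h, fun c hc y hy h1 => ?_⟩
    rw [h.map s hm y (hs ▸ hy)]
    rw [add_comm] at hρ
    refine monomialMap_branch (h.det s hm) hρ ?_
    simp only [hv] at h1
    rw [h1, mul_inv_cancel_left₀ hc]

theorem not_hasNormalCrossingAt (h : IsToric E m w A χ) (h0 : (0 : ℂ × ℂ) ∈ Ω)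
    (ha : Adjacent m o s) {q : X} (hq : A o ∩ A s = {q}) {C : Set (ofOpens Ω)} {α β : ℕ}
    {a b : Prop} {K : Finset ℂ} (hC : IsQuasihomogeneous C α β a b K) (hα : 0 < α) (hβ : 0 < β)
    (hcop : α.Coprime β) {ρ ρ' : ℕ} (hρ : ρ • w o + ρ' • w s = (α, β)) (hK : K.Nonempty)
    (hcond : (2 ≤ ρ ∧ 2 ≤ ρ') ∨ (ρ = 1 ∧ 1 ≤ ρ' ∧
      (InTransform m a b s ∨ ∃ c₁ ∈ K, ∃ c₂ ∈ K, c₁ ≠ c₂) ∧ (2 ≤ ρ' ∨ InTransform m a b o))) :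
    ¬ HasNormalCrossingAt (E ⁻¹' C) q := by
  obtain ⟨ψ, hψ, hqs, hq0, ho, hs, κ, hκ, hκ0, hbr⟩ := h.exists_coords_corner h0 ha hq hρ
  have hK0 : ∀ c ∈ K, c ≠ 0 := fun c hc h => hC.zero_notMem (h ▸ hc)
  have hbr' : ∀ c ∈ K, ∀ y ∈ ψ.source, (ψ y).2 ^ ρ = κ c * (ψ y).1 ^ ρ' → y ∈ E ⁻¹' C :=
    fun c hc y hy h1 => (hC.mem_iff _).2 (Or.inr (Or.inr ⟨c, hc, hbr c (hK0 c hc) y hy h1⟩))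
  obtain ⟨c, hc⟩ := hK
  rcases hcond with ⟨h1, h2⟩ | ⟨rfl, h1, h2, h3⟩
  · refine not_hasNormalCrossingAt_cusp hψ hqs hq0 h1 h2 ?_ (hκ0 c (hK0 c hc)) (hbr' c hc)
    simp only [Prod.ext_iff, Prod.fst_add, Prod.snd_add, Prod.smul_fst, Prod.smul_snd,
      smul_eq_mul] at hρ
    have d1 : ρ.gcd ρ' ∣ α := hρ.1 ▸ dvd_add (dvd_mul_of_dvd_left (Nat.gcd_dvd_left _ _) _)
      (dvd_mul_of_dvd_left (Nat.gcd_dvd_right _ _) _)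
    have d2 : ρ.gcd ρ' ∣ β := hρ.2 ▸ dvd_add (dvd_mul_of_dvd_left (Nat.gcd_dvd_left _ _) _)
      (dvd_mul_of_dvd_left (Nat.gcd_dvd_right _ _) _)
    exact Nat.eq_one_of_dvd_coprimes hcop d1 d2
  · have hm : o ≤ m + 1 ∧ s ≤ m + 1 := by unfold Adjacent at ha; omega
    simp only [pow_one] at hbr'
    obtain ⟨d, e, hde, h4, h5⟩ : ∃ d e : ℂ, d ≠ e ∧
        (∀ y ∈ ψ.source, (ψ y).2 = d * (ψ y).1 ^ ρ' → y ∈ E ⁻¹' C) ∧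
        (∀ y ∈ ψ.source, (ψ y).2 = e * (ψ y).1 ^ ρ' → y ∈ E ⁻¹' C) := by
      rcases h2 with h2 | ⟨c₁, h4, c₂, h5, h6⟩
      · refine ⟨0, κ c, (hκ0 c (hK0 c hc)).symm, fun y hy h7 => ?_, hbr' c hc⟩
        exact h.subset_preimage hC hα hβ hm.2 h2 (hs y hy (by rw [h7, zero_mul]))
      · exact ⟨κ c₁, κ c₂, hκ.ne h6, hbr' c₁ h4, hbr' c₂ h5⟩
    exact not_hasNormalCrossingAt_of_branches hψ hqs hq0 h1 hde h4 h5
      (h3.imp id fun h3 y hy h6 => h.subset_preimage hC hα hβ hm.1 h3 (ho y hy h6))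

theorem exists_inter_eq (h : IsToric E m w A χ) (h0 : (0 : ℂ × ℂ) ∈ Ω) (ha : Adjacent m o s) :
    ∃ q, A o ∩ A s = {q} := by
  rcases ha with ⟨rfl, hm⟩ | ⟨rfl, hm⟩
  · exact ⟨_, h.inter_succ h0 hm⟩
  · exact ⟨_, inter_comm _ _ ▸ h.inter_succ h0 hm⟩

end IsToric

/-- The exceptional curves of a sequence of `m + 2` curves. -/
def innerCurves (m : ℕ) (A : ℕ → Set X) : List (Set X) := (List.range m).map fun j => A (j + 1)

/-- The curves are numbered along the chain, whereas the list `D` follows the order of creation; a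
permutation relates the two. -/
theorem innerCurves_insertAfter {m i : ℕ} (hi : i ≤ m) (v : Set X) (A : ℕ → Set X) :
    (innerCurves (m + 1) (insertAfter i v A)).Perm (innerCurves m A ++ [v]) := by
  induction m with
  | zero =>
    obtain rfl : i = 0 := by omega
    simp [innerCurves, insertAfter_self]
  | succ m ih =>
    rw [innerCurves, List.range_succ, List.map_append, List.map_singleton]
    rcases Nat.lt_or_ge m i with h | h
    · obtain rfl : i = m + 1 := by omega
      rw [insertAfter_self]
      refine List.Perm.of_eq ?_
      congr 1
      refine List.map_congr_left fun j hj => ?_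
      rw [List.mem_range] at hj
      rw [insertAfter_of_le (by omega)]
    · rw [insertAfter_succ (by omega)]
      refine ((ih h).append_right _).trans ?_
      have h1 : innerCurves (m + 1) A = innerCurves m A ++ [A (m + 1)] := by
        simp [innerCurves, List.range_succ]
      rw [h1, List.append_assoc, List.append_assoc]
      exact List.Perm.append_left _ (List.perm_append_comm)

/-- The curves `A'` on `X` are obtained from the curves `A` on `Y` by the composition of
blowing-ups `E`, which is an isomorphism outside `p` and has the exceptional curves `D`. -/
structure Refines (E : X → Y) (p : Y) (D : List (Set X)) (m : ℕ) (A : ℕ → Set Y) (m' : ℕ)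
    (A' : ℕ → Set X) : Prop where
  first : A' 0 = strictTransform E p (A 0)
  last : A' (m' + 1) = strictTransform E p (A (m + 1))
  perm : (innerCurves m' A').Perm ((innerCurves m A).map (strictTransform E p) ++ D)
  iso : IsIsoOutside E p
  composition : IsBlowupComposition Y X E

theorem Refines.trans {E : X → Y} {p : Y} {D : List (Set X)} {m : ℕ} {A : ℕ → Set Y} {m' : ℕ}
    {A' : ℕ → Set X} (h : Refines E p D m A m' A') {F : X' → X} {q : X} {D' : List (Set X')}
    {m'' : ℕ} {A'' : ℕ → Set X'} (h' : Refines F q D' m' A' m'' A'') (hq : E q = p) :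
    Refines (E ∘ F) p (D.map (strictTransform F q) ++ D') m A m'' A'' := by
  refine ⟨?_, ?_, ?_, h.iso.comp h'.iso hq, h.composition.comp h'.composition⟩
  · rw [h'.first, h.first, strictTransform_comp h'.iso hq]
  · rw [h'.last, h.last, strictTransform_comp h'.iso hq]
  · refine h'.perm.trans ?_
    rw [← List.append_assoc]
    refine List.Perm.append_right _ ?_
    refine (h.perm.map _).trans (List.Perm.of_eq ?_)
    rw [List.map_append, List.map_map]
    congr 2
    funext S
    exact strictTransform_comp h'.iso hq S

theorem IsToric.refines_id {E₀ : Y → ofOpens Ω} {m : ℕ} {w : ℕ → ℕ × ℕ} {A : ℕ → Set Y}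
    {χ : ℕ → OpenPartialHomeomorph Y (ℂ × ℂ)} (h : IsToric E₀ m w A χ) (p : Y) :
    Refines id p [] m A m A := by
  refine ⟨(h.strictTransform_id p (by omega)).symm, (h.strictTransform_id p le_rfl).symm, ?_,
    isIsoOutside_id p, .refl⟩
  rw [List.append_nil, innerCurves, List.map_map]
  refine List.Perm.of_eq (List.map_congr_left fun j hj => ?_)
  rw [List.mem_range] at hj
  exact (h.strictTransform_id p (by omega)).symm

/-- Blowing up the intersection point of two consecutive curves. -/
theorem IsToric.exists_blowup {E₀ : X → ofOpens Ω} {m : ℕ} {w : ℕ → ℕ × ℕ} {A : ℕ → Set X}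
    {χ : ℕ → OpenPartialHomeomorph X (ℂ × ℂ)} (h : IsToric E₀ m w A χ) (h0 : (0 : ℂ × ℂ) ∈ Ω)
    {o s : ℕ} (ha : Adjacent m o s) {q : X} (hq : A o ∩ A s = {q}) {F : X' → X}
    (hF : IsBlowup F q) :
    ∃ w' A' χ' o' s', IsToric (E₀ ∘ F) (m + 1) w' A' χ' ∧
      Refines F q [F ⁻¹' {q}] m A (m + 1) A' ∧ Adjacent (m + 1) o' s' ∧ w' o' = w o + w s ∧
      w' s' = w s ∧ A' o' = F ⁻¹' {q} ∧ A' s' = strictTransform F q (A s) ∧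
      1 ≤ o' ∧ o' ≤ m + 1 ∧ (s' = 0 → s = 0) ∧ (s' = m + 2 → s = m + 1) := by
  have key : ∀ i ≤ m, A i ∩ A (i + 1) = {q} → ∃ χ',
      IsToric (E₀ ∘ F) (m + 1) (insertAfter i (w i + w (i + 1)) w)
        (insertAfter i (F ⁻¹' {q}) fun j => strictTransform F q (A j)) χ' ∧
      Refines F q [F ⁻¹' {q}] m A (m + 1)
        (insertAfter i (F ⁻¹' {q}) fun j => strictTransform F q (A j)) := by
    intro i hi hqi
    obtain ⟨χ', hχ'⟩ := h.blowup h0 hi hF hqi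
    refine ⟨χ', hχ', insertAfter_of_le (Nat.zero_le _), insertAfter_succ (by omega), ?_,
      hF.isIsoOutside, .step (E := id) .refl hF⟩
    refine (innerCurves_insertAfter hi _ _).trans (List.Perm.of_eq ?_)
    simp [innerCurves]
  rcases ha with ⟨rfl, hm⟩ | ⟨rfl, hm⟩
  · obtain ⟨χ', h1, h2⟩ := key o hm hq
    refine ⟨_, _, χ', o + 1, o + 2, h1, h2, Or.inl ⟨rfl, by omega⟩, insertAfter_self,
      insertAfter_succ (by omega), insertAfter_self, insertAfter_succ (by omega), by omega,
      by omega, by omega, by omega⟩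
  · obtain ⟨χ', h1, h2⟩ := key s hm (by rwa [inter_comm])
    refine ⟨_, _, χ', s + 1, s, h1, h2, Or.inr ⟨rfl, by omega⟩, by rw [insertAfter_self, add_comm],
      insertAfter_of_le le_rfl, insertAfter_self, insertAfter_of_le le_rfl, by omega, by omega,
      by omega, by omega⟩

/-- The composition `𝔈ᵏ(p, S)`, where `p` is the intersection point of `S` and a neighbouring curve
of a toric configuration. -/
theorem IsBlowupChain.isToric {E₀ : Y → ofOpens Ω} {m : ℕ} {w : ℕ → ℕ × ℕ} {A : ℕ → Set Y}
    {χ : ℕ → OpenPartialHomeomorph Y (ℂ × ℂ)} (h : IsToric E₀ m w A χ) (h0 : (0 : ℂ × ℂ) ∈ Ω)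
    {o s : ℕ} (ha : Adjacent m o s) {p : Y} (hp : A o ∩ A s = {p}) {k : ℕ} {E : X → Y}
    {D : List (Set X)} (hE : IsBlowupChain p (A s) k X E D) :
    ∃ w' A' χ' o' s', IsToric (E₀ ∘ E) (m + k) w' A' χ' ∧ Refines E p D m A (m + k) A' ∧
      Adjacent (m + k) o' s' ∧ w' o' = w o + k • w s ∧ w' s' = w s ∧
      A' s' = strictTransform E p (A s) ∧ attachingLocus E p (A s) = A' o' ∩ A' s' ∧
      (1 ≤ k → D.getLast? = some (A' o') ∧ 1 ≤ o' ∧ o' ≤ m + k) ∧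
      (s' = 0 → s = 0) ∧ (s' = m + k + 1 → s = m + 1) ∧
      ∀ (C : Set (ofOpens Ω)) (α β : ℕ) (a b : Prop) (K : Finset ℂ),
        IsQuasihomogeneous C α β a b K → 0 < α → 0 < β → α.Coprime β → K.Nonempty →
        ∀ r r' : ℕ, r' • w o + r • w s = (α, β) → k * r' ≤ r →
        (2 ≤ r' ∧ r'.Coprime r) ∨
          (r' = 1 ∧ 2 ≤ r ∧ (InTransform m a b s ∨ ∃ c₁ ∈ K, ∃ c₂ ∈ K, c₁ ≠ c₂)) →
        FactorsAll E (E₀ ⁻¹' C) := by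
  induction hE with
  | nil =>
    refine ⟨w, A, χ, o, s, h, h.refines_id p, ha, by simp, rfl,
      (h.strictTransform_id p (by unfold Adjacent at ha; omega)).symm, ?_, by simp, id, id,
      fun _ _ _ _ _ _ _ _ _ _ _ _ _ _ _ _ => factorsAll_id _⟩
    rw [attachingLocus, h.strictTransform_id p (by unfold Adjacent at ha; omega), hp]
    have h1 : p ∈ A s := (hp.symm ▸ mem_singleton p : p ∈ A o ∩ A s).2
    ext x
    constructor
    · exact fun h => h.2
    · rintro rfl
      exact ⟨h1, rfl⟩
  | @step k X X' E F D q hc hq hF ih =>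
    obtain ⟨w₁, A₁, χ₁, o₁, s₁, t₁, R₁, a₁, ho, hs, hAs, hat, hlast, hs0, hsm, hfac⟩ := ih
    have hq₁ : A₁ o₁ ∩ A₁ s₁ = {q} := hat.symm.trans hq
    have hqp : E q = p := (hq.symm ▸ mem_singleton q : q ∈ attachingLocus E p (A s)).2
    obtain ⟨w₂, A₂, χ₂, o₂, s₂, t₂, R₂, a₂, ho₂, hs₂, hAo₂, hAs₂, h1, h2, h3, h4⟩ :=
      t₁.exists_blowup h0 a₁ hq₁ hF
    have hAs' : A₂ s₂ = strictTransform (E ∘ F) p (A s) := by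
      rw [hAs₂, hAs, strictTransform_comp hF.isIsoOutside hqp]
    refine ⟨w₂, A₂, χ₂, o₂, s₂, t₂, R₁.trans R₂ hqp, a₂, ?_, hs₂.trans hs, hAs', ?_, ?_, ?_, ?_, ?_⟩
    · rw [ho₂, ho, hs, add_assoc, succ_nsmul]
    -- The strict transform of S met the fibre of p only at q, so on the new surface it meets this
    -- fibre only inside the exceptional curve of F.
    · rw [attachingLocus, ← hAs', hAo₂, inter_comm]
      ext x
      refine and_congr_left fun hx => ⟨fun hx' => ?_, fun hx' => ?_⟩
      · have h5 : F x ∈ A₁ s₁ := by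
          have hcl : IsClosed (A₁ s₁) := t₁.isClosed (by unfold Adjacent at a₁; omega)
          rw [hAs₂] at hx
          exact strictTransform_subset hF.continuous q hcl hx
        have h6 : F x ∈ attachingLocus E p (A s) := ⟨hAs ▸ h5, hx'⟩
        rw [hq] at h6
        exact h6
      · change E (F x) = p
        rw [show F x = q from hx', hqp]
    · intro _
      exact ⟨by simp [hAo₂], h1, h2⟩
    · exact fun h => hs0 (h3 h)
    · exact fun h => hsm (h4 h)
    · intro C α β a b K hC hα hβ hcop hK r r' hr hk hcond
      have hk' : k * r' + r' ≤ r := by linarith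
      refine (hfac C α β a b K hC hα hβ hcop hK r r' hr (by omega) hcond).comp ?_
      refine hF.factorsAll ?_ ?_
      · have h5 : q ∈ A₁ o₁ ∩ A₁ s₁ := hq₁ ▸ mem_singleton q
        rcases a₁ with ⟨rfl, hm⟩ | ⟨rfl, hm⟩
        · exact hC.mem_of_val_eq_zero hα hβ (t₁.fst_eq_zero hm h5.1)
            (t₁.snd_eq_zero (by omega) (by omega) h5.2)
        · exact hC.mem_of_val_eq_zero hα hβ (t₁.fst_eq_zero hm h5.2)
            (t₁.snd_eq_zero (by omega) (by omega) h5.1)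
      -- After k blowing-ups the neighbour has exponent w o + k w s, so the coefficient of w s has
      -- dropped to r - k r', which is still at least r'.
      · have hr' : r' • w₁ o₁ + (r - k * r') • w₁ s₁ = (α, β) := by
          obtain ⟨d, rfl⟩ : ∃ d, r = k * r' + d := ⟨r - k * r', by omega⟩
          rw [← hr, ho, hs, Nat.add_sub_cancel_left, smul_add, add_smul, ← mul_smul, mul_comm r' k,
            add_assoc]
        refine t₁.not_hasNormalCrossingAt h0 a₁ hq₁ hC hα hβ hcop hr' hK ?_
        rcases hcond with ⟨h5, h6⟩ | ⟨rfl, h5, h6⟩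
        · exact Or.inl ⟨h5, by omega⟩
        · refine Or.inr ⟨rfl, by omega, h6.imp_left fun h7 =>
            ⟨fun h8 => h7.1 (hs0 h8), fun h8 => h7.2 (hsm h8)⟩, ?_⟩
          -- For r' = 1 the branches are graphs with exponent r - k. At the first centre this is r ≥
          -- 2; at the later ones the neighbour is exceptional and belongs to the total transform.
          rcases Nat.eq_zero_or_pos k with rfl | hk0
          · left; omega
          · right
            obtain ⟨-, h8, h9⟩ := hlast hk0
            exact ⟨fun h => by omega, fun h => by omega⟩

end ComplexSurface

/-! ### The whole composition, governed by the Euclidean algorithm. -/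

theorem euclidQuotients_zero (a : ℕ) : euclidQuotients a 0 = [] := by
  rw [euclidQuotients]; simp

theorem euclidQuotients_of_ne_zero (a : ℕ) {b : ℕ} (hb : b ≠ 0) :
    euclidQuotients a b = (a / b) :: euclidQuotients b (a % b) := by
  rw [euclidQuotients]; simp [hb]

namespace ComplexSurface

variable {X Y : ComplexSurface} {Ω : TopologicalSpace.Opens (ℂ × ℂ)}

theorem Adjacent.symm {m o s : ℕ} (h : Adjacent m o s) : Adjacent m s o := h.elim Or.inr Or.inl

/-- The composition `𝔈^{q₁}(p₁, S₁) ∘ ⋯ ∘ 𝔈^{qₘ}(pₘ, Sₘ)`, where the `qᵢ` are the quotients of a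
Euclidean algorithm and `p₁` is the intersection point of `S₁` and a neighbouring curve of a toric
configuration. -/
theorem IsChainComposition.isToric {l : List ℕ} {p : Y} {S : Set Y} {E : X → Y} {D : List (Set X)}
    (hE : IsChainComposition l Y p S X E D) :
    ∀ {E₀ : Y → ofOpens Ω} {m : ℕ} {w : ℕ → ℕ × ℕ} {A : ℕ → Set Y}
      {χ : ℕ → OpenPartialHomeomorph Y (ℂ × ℂ)}, IsToric E₀ m w A χ → (0 : ℂ × ℂ) ∈ Ω →
    ∀ {o s : ℕ}, Adjacent m o s → A o ∩ A s = {p} → S = A s →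
    ∀ {r r' α β : ℕ}, l = euclidQuotients r r' → r' < r → r.Coprime r' →
      r' • w o + r • w s = (α, β) →
    ∃ m' w' A' χ' c, IsToric (E₀ ∘ E) m' w' A' χ' ∧ Refines E p D m A m' A' ∧ w' c = (α, β) ∧
      ((l ≠ [] ∨ (1 ≤ s ∧ s ≤ m)) → 1 ≤ c ∧ c ≤ m') ∧
      D.getLast?.or (some (strictTransform E p S)) = some (A' c) ∧
      (l ≠ [] → D.getLast? = some (A' c)) ∧
      ∀ (C : Set (ofOpens Ω)) (a b : Prop) (K : Finset ℂ),
        IsQuasihomogeneous C α β a b K → 0 < α → 0 < β → α.Coprime β → K.Nonempty →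
        r' = 0 ∨ 2 ≤ r' ∨
          (r' = 1 ∧ 2 ≤ r ∧ (InTransform m a b s ∨ ∃ c₁ ∈ K, ∃ c₂ ∈ K, c₁ ≠ c₂)) →
        FactorsAll E (E₀ ⁻¹' C) := by
  induction hE with
  | nil Y p S =>
    intro E₀ m w A χ h h0 o s ha hp hS r r' α β hl hr hcop hw
    have hr' : r' = 0 := by
      by_contra h1
      rw [euclidQuotients_of_ne_zero _ h1] at hl
      exact absurd hl (by simp)
    subst hr'
    -- The algorithm stops at remainder 0, where coprimality forces r = 1: the current curve S has
    -- exponent (α, β) and is the central one.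
    have hr1 : r = 1 := by simpa using hcop
    subst hr1
    refine ⟨m, w, A, χ, s, h, h.refines_id p, by simpa using hw, by simp, ?_, by simp,
      fun _ _ _ _ _ _ _ _ _ _ => factorsAll_id _⟩
    rw [hS, h.strictTransform_id p (by unfold Adjacent at ha; omega)]
    rfl
  | @cons n l Y Y' X p S p' S' E₁ E₂ D₁ D₂ hB hatt hlast _ ih =>
    intro E₀ m w A χ h h0 o s ha hp hS r r' α β hl hr hcop hw
    have hr' : r' ≠ 0 := by
      rintro rfl
      rw [euclidQuotients_zero] at hl
      exact absurd hl (by simp)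
    rw [euclidQuotients_of_ne_zero _ hr', List.cons.injEq] at hl
    obtain ⟨rfl, rfl⟩ := hl
    subst hS
    have hpos : 1 ≤ r / r' := Nat.div_pos hr.le (Nat.pos_of_ne_zero hr')
    have hdiv := Nat.div_add_mod r r'
    have hmod := Nat.mod_lt r (Nat.pos_of_ne_zero hr')
    obtain ⟨w₁, A₁, χ₁, o₁, s₁, t₁, R₁, a₁, ho, hs, hAs, hat, hlast₁, hs0, hsm, hfac⟩ :=
      hB.isToric h h0 ha hp
    obtain ⟨hl₁, ho1, hom⟩ := hlast₁ hpos
    have hS' : S' = A₁ o₁ := by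
      rw [hlast] at hl₁
      exact Option.some_injective _ hl₁
    have hp' : A₁ s₁ ∩ A₁ o₁ = {p'} := by rw [inter_comm, ← hat, hatt]
    have hpp : E₁ p' = p := (hatt.symm ▸ mem_singleton p' : p' ∈ attachingLocus E₁ p (A s)).2
    -- The roles are exchanged: the last component becomes the curve S of the next stage and the old
    -- S its neighbour, with coefficients r' and r % r'.
    have hw' : (r % r') • w₁ s₁ + r' • w₁ o₁ = (α, β) := by
      rw [ho, hs, ← hw, smul_add, ← mul_smul, add_comm, add_assoc, ← add_smul, hdiv]
    have hcop' : r'.Coprime (r % r') := by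
      have h1 := hcop.symm
      rw [Nat.Coprime, Nat.gcd_rec] at h1
      exact Nat.Coprime.symm h1
    obtain ⟨m₂, w₂, A₂, χ₂, c, t₂, R₂, hc, hc1, hor, -, hfac₂⟩ :=
      ih t₁ h0 a₁.symm hp' hS' rfl hmod hcop' hw'
    -- If no stage follows, the central curve is the last one of D₁; the `or` in the statement
    -- covers this case.
    have hlast₂ : (D₁.map (strictTransform E₂ p') ++ D₂).getLast? = some (A₂ c) := by
      rw [List.getLast?_append, List.getLast?_map, hlast]
      exact hor
    refine ⟨m₂, w₂, A₂, χ₂, c, t₂, R₁.trans R₂ hpp, hc, fun _ => hc1 (Or.inr ⟨ho1, hom⟩), ?_,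
      fun _ => hlast₂, ?_⟩
    · rw [hlast₂]; rfl
    · intro C a b K hC hα hβ hαβ hK hcond
      refine (hfac C α β a b K hC hα hβ hαβ hK r r' hw ?_ ?_).comp ?_
      · rw [mul_comm]; exact Nat.mul_div_le r r'
      · rcases hcond with h1 | h1 | h1
        · exact absurd h1 hr'
        · exact Or.inl ⟨h1, hcop.symm⟩
        · exact Or.inr h1
      · refine hfac₂ C a b K hC hα hβ hαβ hK ?_
        -- From the second stage on S is exceptional, hence in the total transform. So a coefficient
        -- r % r' = 1 raises no further condition.
        have h2 : InTransform (m + r / r') a b o₁ := ⟨fun h => by omega, fun h => by omega⟩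
        rcases Nat.lt_or_ge (r % r') 2 with h3 | h3
        · rcases Nat.eq_zero_or_pos (r % r') with h4 | h4
          · exact Or.inl h4
          · exact Or.inr (Or.inr ⟨by omega, by omega, Or.inl h2⟩)
        · exact Or.inr (Or.inl h3)

/-- The toric structure identifies the attaching locus with a corner, hence with a single point that
can be blown up. -/
theorem exists_isBlowupChain {E₀ : Y → ofOpens Ω} {m : ℕ} {w : ℕ → ℕ × ℕ} {A : ℕ → Set Y}
    {χ : ℕ → OpenPartialHomeomorph Y (ℂ × ℂ)} (h : IsToric E₀ m w A χ) (h0 : (0 : ℂ × ℂ) ∈ Ω)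
    {o s : ℕ} (ha : Adjacent m o s) {p : Y} (hp : A o ∩ A s = {p}) (k : ℕ) :
    ∃ X E D, IsBlowupChain p (A s) k X E D := by
  induction k with
  | zero => exact ⟨Y, id, [], .nil⟩
  | succ k ih =>
    obtain ⟨X, E, D, hE⟩ := ih
    obtain ⟨w₁, A₁, χ₁, o₁, s₁, t₁, -, a₁, -, -, -, hat, -⟩ := hE.isToric h h0 ha hp
    obtain ⟨q, hq⟩ := t₁.exists_inter_eq h0 a₁
    obtain ⟨X', F, hF⟩ := exists_isBlowup_at q
    exact ⟨X', E ∘ F, _, .step hE (hat.trans hq) hF⟩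

theorem exists_isChainComposition (r' : ℕ) :
    ∀ {r : ℕ} {Y : ComplexSurface} {E₀ : Y → ofOpens Ω} {m : ℕ} {w : ℕ → ℕ × ℕ} {A : ℕ → Set Y}
      {χ : ℕ → OpenPartialHomeomorph Y (ℂ × ℂ)}, IsToric E₀ m w A χ → (0 : ℂ × ℂ) ∈ Ω →
    ∀ {o s : ℕ}, Adjacent m o s → ∀ {p : Y}, A o ∩ A s = {p} → r' < r →
      ∃ X E D, IsChainComposition (euclidQuotients r r') Y p (A s) X E D := by
  induction r' using Nat.strong_induction_on with
  | _ r' ih =>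
    intro r Y E₀ m w A χ h h0 o s ha p hp hr
    by_cases hr' : r' = 0
    · subst hr'
      rw [euclidQuotients_zero]
      exact ⟨Y, id, [], .nil Y p _⟩
    · rw [euclidQuotients_of_ne_zero _ hr']
      have hpos : 1 ≤ r / r' := Nat.div_pos hr.le (Nat.pos_of_ne_zero hr')
      have hmod := Nat.mod_lt r (Nat.pos_of_ne_zero hr')
      obtain ⟨Y', E₁, D₁, hE₁⟩ := exists_isBlowupChain h h0 ha hp (r / r')
      obtain ⟨w₁, A₁, χ₁, o₁, s₁, t₁, -, a₁, -, -, -, hat, hlast, -⟩ := hE₁.isToric h h0 ha hp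
      obtain ⟨q, hq⟩ := t₁.exists_inter_eq h0 a₁
      obtain ⟨X, E₂, D₂, hE₂⟩ := ih _ hmod t₁ h0 a₁.symm (inter_comm _ _ ▸ hq) hmod
      exact ⟨X, E₁ ∘ E₂, _, .cons hE₁ (hat.trans hq) (hlast hpos).1 hE₂⟩

/-- The plane with its coordinate axes is a toric configuration. -/
theorem exists_isToric_id (h0 : (0 : ℂ × ℂ) ∈ Ω) : ∃ χ, IsToric (id : ofOpens Ω → ofOpens Ω) 0
    (fun j => if j = 0 then (1, 0) else (0, 1))
    (fun j => if j = 0 then zeroSet Ω (MvPolynomial.X 0) else zeroSet Ω (MvPolynomial.X 1)) χ := by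
  obtain ⟨χ, hχ, hs, ht, hv⟩ := exists_coords_ofOpens h0
  have h1 : ∀ x, x ∈ zeroSet Ω (MvPolynomial.X 0) ↔ (val x).1 = 0 := fun x => by
    change MvPolynomial.eval _ _ = 0 ↔ _
    rw [MvPolynomial.eval_X]; rfl
  have h2 : ∀ x, x ∈ zeroSet Ω (MvPolynomial.X 1) ↔ (val x).2 = 0 := fun x => by
    change MvPolynomial.eval _ _ = 0 ↔ _
    rw [MvPolynomial.eval_X]; rfl
  refine ⟨fun _ => χ, rfl, rfl, fun j h h' => by omega, fun i hi => ?_, fun _ _ => hχ, fun i hi => ?_,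
    fun i hi x _ => ?_, fun x => ⟨0, le_rfl, hs ▸ mem_univ x⟩, fun i hi j hj x _ => ?_⟩
  · obtain rfl : i = 0 := by omega
    rfl
  · obtain rfl : i = 0 := by omega
    rw [ht]
    ext z
    simp [monomialMap]
  · obtain rfl : i = 0 := by omega
    rw [hv]
    simp [monomialMap]
  · obtain rfl : i = 0 := by omega
    obtain rfl | rfl : j = 0 ∨ j = 1 := by omega
    · simpa [hv] using h1 x
    · simpa [hv] using h2 x

end ComplexSurface

/-! ### Total and strict transforms in the monomial charts. -/

namespace ComplexSurface

variable {X : ComplexSurface} {Ω : TopologicalSpace.Opens (ℂ × ℂ)}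

namespace IsToric

variable {E : X → ofOpens Ω} {m : ℕ} {w : ℕ → ℕ × ℕ} {A : ℕ → Set X}
  {χ : ℕ → OpenPartialHomeomorph X (ℂ × ℂ)} {i j c : ℕ}

/-- The slopes of the exponents are strictly monotone. -/
theorem slope_lt (h : IsToric E m w A χ) (hij : i < j) (hj : j ≤ m + 1) :
    (w i).2 * (w j).1 < (w i).1 * (w j).2 := by
  induction j, hij using Nat.le_induction with
  | base =>
    have := h.det i (by omega)
    simp only [Nat.succ_eq_add_one]
    omega
  | succ j hij ih =>
    have h1 := ih (by omega)
    have h2 := h.det j (by omega)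
    have h3 := h.snd_pos (i := j) (by omega)
    obtain ⟨k, rfl⟩ : ∃ k, j = k + 1 := ⟨j - 1, by omega⟩
    have h4 := h.snd_pos (i := k) (by omega)
    -- Transitivity of the comparison of slopes, after multiplication by the positive second
    -- exponent of the intermediate curve.
    refine Nat.lt_of_mul_lt_mul_left (a := (w (k + 1)).2) ?_
    calc (w (k + 1)).2 * ((w i).2 * (w (k + 1 + 1)).1)
        = (w i).2 * ((w (k + 1)).2 * (w (k + 1 + 1)).1) := by ring
      _ ≤ (w i).2 * ((w (k + 1)).1 * (w (k + 1 + 1)).2) := Nat.mul_le_mul_left _ (by omega)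
      _ = ((w i).2 * (w (k + 1)).1) * (w (k + 1 + 1)).2 := by ring
      _ < ((w i).1 * (w (k + 1)).2) * (w (k + 1 + 1)).2 := Nat.mul_lt_mul_of_pos_right h1 h3
      _ = (w (k + 1)).2 * ((w i).1 * (w (k + 1 + 1)).2) := by ring

/-- The equations of the branches in the monomial charts. -/
theorem exists_branch_exponents (h : IsToric E m w A χ) (hi : i ≤ m) (hcm : c ≤ m)
    {α β : ℕ} (hw : w c = (α, β)) {K : Finset ℂ} (hK : 0 ∉ K) :
    ∃ p q, ∃ K' : Finset ℂ, ((i ≠ c ∧ i + 1 ≠ c ∧ 1 ≤ p ∧ 1 ≤ q) ∨ (i = c ∧ p = 0 ∧ q = 1) ∨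
      (i + 1 = c ∧ p = 1 ∧ q = 0)) ∧ 0 ∉ K' ∧ (K.Nonempty → K'.Nonempty) ∧
      ∀ z : ℂ × ℂ, z.1 ≠ 0 → z.2 ≠ 0 → ((∃ k ∈ K, (monomialMap (w i) (w (i + 1)) z).2 ^ α =
        k * (monomialMap (w i) (w (i + 1)) z).1 ^ β) ↔ ∃ k ∈ K', z.1 ^ p * z.2 ^ q = k) := by
  classical
  have hdet := h.det i hi
  -- Before the central curve the relation is u^β = v^α s^(p+1) t^q, so the constants are inverted;
  -- from it on it is v^α = u^β s^p t^(q+1). The exponents are determinants with (α, β): they vanish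
  -- only for the central curve, and then its neighbour has determinant 1.
  rcases Nat.lt_or_ge i c with hic | hic
  · have h1 := h.slope_lt hic (by omega)
    rw [hw] at h1
    obtain ⟨p, hp⟩ := Nat.exists_eq_add_of_lt h1
    obtain ⟨q, hq, hq'⟩ : ∃ q, (w (i + 1)).1 * β = (w (i + 1)).2 * α + q ∧
        ((i + 1 ≠ c ∧ 1 ≤ q) ∨ (i + 1 = c ∧ p = 0 ∧ q = 0)) := by
      rcases Nat.lt_or_ge (i + 1) c with h2 | h2
      · have h3 := h.slope_lt h2 (by omega)
        rw [hw] at h3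
        exact ⟨(w (i + 1)).1 * β - (w (i + 1)).2 * α, by simp only at h3; omega,
          Or.inl ⟨by omega, by simp only at h3; omega⟩⟩
      · have h3 : i + 1 = c := by omega
        rw [h3, hw] at hdet ⊢
        exact ⟨0, by simp only; ring, Or.inr ⟨rfl, by simp only at hdet hp; omega, rfl⟩⟩
    refine ⟨p + 1, q, K.image (·⁻¹), ?_, ?_, fun h => h.image _, fun z hz1 hz2 => ?_⟩
    · rcases hq' with h2 | h2
      · exact Or.inl ⟨by omega, h2.1, by omega, h2.2⟩
      · exact Or.inr (Or.inr ⟨h2.1, by omega, h2.2.2⟩)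
    · simp only [Finset.mem_image, inv_eq_zero, not_exists, not_and]
      rintro k hk rfl
      exact hK hk
    · have h2 : (monomialMap (w i) (w (i + 1)) z).1 ^ β =
          (monomialMap (w i) (w (i + 1)) z).2 ^ α * (z.1 ^ (p + 1) * z.2 ^ q) := by
        simp only [monomialMap, mul_pow, ← pow_mul, hq]
        simp only at hp
        rw [hp]
        ring
      have h3 : (monomialMap (w i) (w (i + 1)) z).2 ^ α ≠ 0 := by
        simp only [monomialMap]; positivity
      rw [h2]
      simp only [Finset.exists_mem_image]
      refine exists_congr fun k => and_congr_right fun hk => ?_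
      have hk0 : k ≠ 0 := fun h => hK (h ▸ hk)
      constructor
      · intro h4
        refine eq_inv_of_mul_eq_one_left ?_
        refine mul_left_cancel₀ h3 ?_
        linear_combination -h4
      · intro h4
        rw [h4]
        field_simp
  · obtain ⟨p, hp, hp'⟩ : ∃ p, (w i).2 * α = (w i).1 * β + p ∧
        ((i ≠ c ∧ 1 ≤ p) ∨ (i = c ∧ p = 0)) := by
      rcases Nat.lt_or_ge c i with h2 | h2
      · have h3 := h.slope_lt h2 (by omega)
        rw [hw] at h3
        simp only at h3
        exact ⟨(w i).2 * α - (w i).1 * β, by lia, Or.inl ⟨by omega, by lia⟩⟩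
      · have h3 : i = c := by omega
        rw [h3, hw]
        exact ⟨0, by simp only; ring, Or.inr ⟨rfl, rfl⟩⟩
    have h1 := h.slope_lt (i := c) (j := i + 1) (by omega) (by omega)
    rw [hw] at h1
    obtain ⟨q, hq⟩ := Nat.exists_eq_add_of_lt h1
    simp only at hq
    refine ⟨p, q + 1, K, ?_, hK, id, fun z hz1 hz2 => ?_⟩
    · rcases hp' with h2 | h2
      · exact Or.inl ⟨h2.1, by omega, h2.2, by omega⟩
      · refine Or.inr (Or.inl ⟨h2.1, h2.2, ?_⟩)
        rw [h2.1, hw] at hdet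
        simp only at hdet
        rw [h2.1] at hq
        omega
    · have h2 : (monomialMap (w i) (w (i + 1)) z).2 ^ α =
          (z.1 ^ p * z.2 ^ (q + 1)) * (monomialMap (w i) (w (i + 1)) z).1 ^ β := by
        have hq2 : (w (i + 1)).2 * α = (w (i + 1)).1 * β + (q + 1) := by linarith
        simp only [monomialMap, mul_pow, ← pow_mul, hp, hq2]
        ring
      have h3 : (monomialMap (w i) (w (i + 1)) z).1 ^ β ≠ 0 := by
        simp only [monomialMap]; positivity
      rw [h2]
      exact exists_congr fun k => and_congr_right fun hk => mul_left_inj' h3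

theorem fst_ne_zero (h : IsToric E m w A χ) (hi : i ≤ m) {x : X} (hx : x ∈ (χ i).source)
    (h1 : (χ i x).1 ≠ 0) (h2 : (χ i x).2 ≠ 0) : (val (E x)).1 ≠ 0 := by
  rw [h.map i hi x hx]
  exact mul_ne_zero (pow_ne_zero _ h1) (pow_ne_zero _ h2)

theorem snd_ne_zero (h : IsToric E m w A χ) (hi : i ≤ m) {x : X} (hx : x ∈ (χ i).source)
    (h1 : (χ i x).1 ≠ 0) (h2 : (χ i x).2 ≠ 0) : (val (E x)).2 ≠ 0 := by
  rw [h.map i hi x hx]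
  exact mul_ne_zero (pow_ne_zero _ h1) (pow_ne_zero _ h2)

theorem eq_origin_iff (h0 : (0 : ℂ × ℂ) ∈ Ω) (x : ofOpens Ω) :
    x = origin Ω h0 ↔ (val x).1 = 0 ∧ (val x).2 = 0 := by
  rw [← Prod.mk_eq_zero]
  exact Subtype.ext_iff

/-- The exceptional divisor. -/
theorem map_eq_origin_iff (h : IsToric E m w A χ) (h0 : (0 : ℂ × ℂ) ∈ Ω) (hm : 1 ≤ m) (x : X) :
    E x = origin Ω h0 ↔ ∃ j, 1 ≤ j ∧ j ≤ m ∧ x ∈ A j := by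
  rw [eq_origin_iff]
  constructor
  · rintro ⟨h1, h2⟩
    obtain ⟨k, hk, hx⟩ := h.cover x
    rw [h.map k hk x hx] at h1 h2
    simp only [monomialMap, mul_eq_zero, pow_eq_zero_iff', ne_eq] at h1 h2
    have e1 : (χ k x).1 = 0 → x ∈ A k := fun h3 => (h.curve k hk k (by omega) x hx).2 (Or.inl ⟨rfl, h3⟩)
    have e2 : (χ k x).2 = 0 → x ∈ A (k + 1) := fun h3 =>
      (h.curve k hk (k + 1) (by omega) x hx).2 (Or.inr ⟨rfl, h3⟩)
    by_cases hs : (χ k x).1 = 0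
    · by_cases hk0 : k = 0
      · subst hk0
        refine ⟨1, le_rfl, hm, e2 ?_⟩
        have := h.w_zero
        simp only [this, not_true_eq_false, and_false, false_or] at h2
        exact h2.1
      · exact ⟨k, by omega, hk, e1 hs⟩
    · simp only [hs, false_and, false_or] at h1
      refine ⟨k + 1, by omega, ?_, e2 h1.1⟩
      by_contra hkm
      obtain rfl : k = m := by omega
      exact h1.2 (by rw [h.w_last])
  · rintro ⟨j, hj, hjm, hx⟩
    exact ⟨h.fst_eq_zero hjm hx, h.snd_eq_zero hj (by omega) hx⟩

section transforms

variable {C : Set (ofOpens Ω)} {α β : ℕ} {a b : Prop} {K : Finset ℂ} {p q : ℕ} {K' : Finset ℂ}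

/-- The total transform in a monomial chart. -/
theorem mem_preimage_iff (h : IsToric E m w A χ) (hC : IsQuasihomogeneous C α β a b K)
    (hα : 0 < α) (hβ : 0 < β) (hc : 1 ≤ c) (hcm : c ≤ m) (hi : i ≤ m) (hpq : p = 0 → i = c)
    (hpq' : q = 0 → i + 1 = c) (hK' : 0 ∉ K')
    (hbr : ∀ z : ℂ × ℂ, z.1 ≠ 0 → z.2 ≠ 0 → ((∃ k ∈ K, (monomialMap (w i) (w (i + 1)) z).2 ^ α =
        k * (monomialMap (w i) (w (i + 1)) z).1 ^ β) ↔ ∃ k ∈ K', z.1 ^ p * z.2 ^ q = k))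
    {x : X} (hx : x ∈ (χ i).source) :
    x ∈ E ⁻¹' C ↔ (InTransform m a b i ∧ (χ i x).1 = 0) ∨
      (InTransform m a b (i + 1) ∧ (χ i x).2 = 0) ∨ ∃ k ∈ K', (χ i x).1 ^ p * (χ i x).2 ^ q = k := by
  have e1 : (χ i x).1 = 0 → x ∈ A i := fun h3 => (h.curve i hi i (by omega) x hx).2 (Or.inl ⟨rfl, h3⟩)
  have e2 : (χ i x).2 = 0 → x ∈ A (i + 1) := fun h3 =>
    (h.curve i hi (i + 1) (by omega) x hx).2 (Or.inr ⟨rfl, h3⟩)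
  have i1 : 1 ≤ i → InTransform m a b i := fun h => ⟨by omega, by omega⟩
  have i2 : i + 1 ≤ m → InTransform m a b (i + 1) := fun h => ⟨by omega, by omega⟩
  have s1 : InTransform m a b i → (χ i x).1 = 0 → x ∈ E ⁻¹' C := fun h1 h2 =>
    h.subset_preimage hC hα hβ (by omega) h1 (e1 h2)
  have s2 : InTransform m a b (i + 1) → (χ i x).2 = 0 → x ∈ E ⁻¹' C := fun h1 h2 =>
    h.subset_preimage hC hα hβ (by omega) h1 (e2 h2)
  by_cases hs : (χ i x).1 = 0
  · by_cases hi0 : 1 ≤ i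
    · exact iff_of_true (s1 (i1 hi0) hs) (Or.inl ⟨i1 hi0, hs⟩)
    obtain rfl : i = 0 := by omega
    constructor
    · intro hxC
      by_cases ha : a
      · exact Or.inl ⟨⟨fun _ => ha, by omega⟩, hs⟩
      -- If C does not contain the axis u = 0, it meets it only at the origin. So a point of A 0 in
      -- the total transform lies over the origin, on A 1.
      · have hv : (val (E x)).2 = 0 := by
          rcases (hC.mem_iff _).1 hxC with h1 | h1 | ⟨k, -, h1⟩
          · exact absurd h1.1 ha
          · exact h1.2
          · rw [h.fst_eq_zero hi (e1 hs), zero_pow hβ.ne', mul_zero] at h1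
            exact (pow_eq_zero_iff hα.ne').1 h1
        rw [h.map 0 hi x hx, monomialMap, h.w_zero] at hv
        simp only [pow_zero, one_mul, pow_eq_zero_iff', ne_eq] at hv
        exact Or.inr (Or.inl ⟨i2 (by omega), hv.1⟩)
    · rintro (⟨h1, h2⟩ | ⟨h1, h2⟩ | ⟨k, hk, h1⟩)
      · exact s1 h1 h2
      · exact s2 h1 h2
      · rw [hs] at h1
        have hp0 : p ≠ 0 := fun h => by have := hpq h; omega
        rw [zero_pow hp0, zero_mul] at h1
        exact absurd (h1 ▸ hk) hK'
  · by_cases ht : (χ i x).2 = 0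
    · by_cases him : i + 1 ≤ m
      · exact iff_of_true (s2 (i2 him) ht) (Or.inr (Or.inl ⟨i2 him, ht⟩))
      obtain rfl : i = m := by omega
      constructor
      · intro hxC
        by_cases hb : b
        · exact Or.inr (Or.inl ⟨⟨by omega, fun _ => hb⟩, ht⟩)
        · exfalso
          have hu : (val (E x)).1 = 0 := by
            rcases (hC.mem_iff _).1 hxC with h1 | h1 | ⟨k, hk, h1⟩
            · exact h1.2
            · exact absurd h1.1 hb
            · rw [h.snd_eq_zero (by omega) le_rfl (e2 ht), zero_pow hα.ne'] at h1
              rcases mul_eq_zero.1 h1.symm with h2 | h2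
              · exact absurd (h2 ▸ hk) hC.zero_notMem
              · exact (pow_eq_zero_iff hβ.ne').1 h2
          rw [h.map i hi x hx, monomialMap, h.w_last] at hu
          simp only [pow_zero, mul_one, pow_eq_zero_iff', ne_eq] at hu
          exact hs hu.1
      · rintro (⟨h1, h2⟩ | ⟨h1, h2⟩ | ⟨k, hk, h1⟩)
        · exact s1 h1 h2
        · exact s2 h1 h2
        · rw [ht] at h1
          have hq0 : q ≠ 0 := fun h => by have := hpq' h; omega
          rw [zero_pow hq0, mul_zero] at h1
          exact absurd (h1 ▸ hk) hK'
    · have := hbr _ hs ht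
      rw [← h.map i hi x hx] at this
      rw [mem_preimage, hC.mem_iff, this]
      simp [hs, ht, h.fst_ne_zero hi hx hs ht, h.snd_ne_zero hi hx hs ht]

theorem isClosed_branches (P Q : Prop) (p q : ℕ) (K' : Finset ℂ) :
    IsClosed {z : ℂ × ℂ | (P ∧ z.1 = 0) ∨ (Q ∧ z.2 = 0) ∨ ∃ k ∈ K', z.1 ^ p * z.2 ^ q = k} := by
  have h1 : IsClosed {z : ℂ × ℂ | z.1 = 0} := isClosed_eq continuous_fst continuous_const
  have h2 : IsClosed {z : ℂ × ℂ | z.2 = 0} := isClosed_eq continuous_snd continuous_const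
  have h3 : IsClosed {z : ℂ × ℂ | ∃ k ∈ K', z.1 ^ p * z.2 ^ q = k} := by
    have : {z : ℂ × ℂ | ∃ k ∈ K', z.1 ^ p * z.2 ^ q = k} =
        (fun z : ℂ × ℂ => z.1 ^ p * z.2 ^ q) ⁻¹' (K' : Set ℂ) := by
      ext z; simp
    rw [this]
    exact K'.finite_toSet.isClosed.preimage (by fun_prop)
  exact (isClosed_const.inter h1).union ((isClosed_const.inter h2).union h3)

/-- The branches are the closure of their part outside the axes of a monomial chart. -/
theorem mem_closure_branches (hpq : p = 0 → q = 1) (hpq' : q = 0 → p = 1) {k : ℂ}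
    (hk : k ≠ 0) {z : ℂ × ℂ} (hz : z.1 ^ p * z.2 ^ q = k) :
    z ∈ closure {z : ℂ × ℂ | z.1 ≠ 0 ∧ z.2 ≠ 0 ∧ z.1 ^ p * z.2 ^ q = k} := by
  by_cases h1 : z.1 = 0
  · have hp : p = 0 := by
      by_contra hp
      rw [h1, zero_pow hp, zero_mul] at hz
      exact hk hz.symm
    obtain rfl := hp
    rw [hpq rfl, pow_zero, one_mul, pow_one] at hz
    have : {z : ℂ × ℂ | z.1 ≠ 0 ∧ z.2 = k} = ({0}ᶜ : Set ℂ) ×ˢ ({k} : Set ℂ) := by ext; simp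
    have h2 : z ∈ closure {z : ℂ × ℂ | z.1 ≠ 0 ∧ z.2 = k} := by
      rw [this, closure_prod_eq]
      exact ⟨(dense_compl_singleton (0 : ℂ)) z.1, by simp [hz]⟩
    refine closure_mono ?_ h2
    rintro y ⟨h3, h4⟩
    exact ⟨h3, h4 ▸ hk, by rw [hpq rfl, h4]; ring⟩
  · by_cases h2 : z.2 = 0
    · have hq : q = 0 := by
        by_contra hq
        rw [h2, zero_pow hq, mul_zero] at hz
        exact hk hz.symm
      obtain rfl := hq
      rw [hpq' rfl, pow_zero, mul_one, pow_one] at hz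
      have : {z : ℂ × ℂ | z.1 = k ∧ z.2 ≠ 0} = ({k} : Set ℂ) ×ˢ ({0}ᶜ : Set ℂ) := by ext; simp
      have h2 : z ∈ closure {z : ℂ × ℂ | z.1 = k ∧ z.2 ≠ 0} := by
        rw [this, closure_prod_eq]
        exact ⟨by simp [hz], (dense_compl_singleton (0 : ℂ)) z.2⟩
      refine closure_mono ?_ h2
      rintro y ⟨h3, h4⟩
      exact ⟨h3 ▸ hk, h4, by rw [hpq' rfl, h3]; ring⟩
    · exact subset_closure ⟨h1, h2, hz⟩

/-- The strict transform in a monomial chart. -/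
theorem mem_strictTransform_iff (h : IsToric E m w A χ) (h0 : (0 : ℂ × ℂ) ∈ Ω)
    (hC : IsQuasihomogeneous C α β a b K)
    (hα : 0 < α) (hβ : 0 < β) (hm : 1 ≤ m) (hi : i ≤ m) (hpq : p = 0 → q = 1)
    (hpq' : q = 0 → p = 1) (hK' : 0 ∉ K')
    (hbr : ∀ z : ℂ × ℂ, z.1 ≠ 0 → z.2 ≠ 0 → ((∃ k ∈ K, (monomialMap (w i) (w (i + 1)) z).2 ^ α =
        k * (monomialMap (w i) (w (i + 1)) z).1 ^ β) ↔ ∃ k ∈ K', z.1 ^ p * z.2 ^ q = k))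
    {x : X} (hx : x ∈ (χ i).source) :
    x ∈ strictTransform E (origin Ω h0) C ↔ ((a ∧ i = 0) ∧ (χ i x).1 = 0) ∨
      ((b ∧ i = m) ∧ (χ i x).2 = 0) ∨ ∃ k ∈ K', (χ i x).1 ^ p * (χ i x).2 ^ q = k := by
  constructor
  · refine mem_of_mem_closure_coords hx (isClosed_branches (a ∧ i = 0) (b ∧ i = m) p q K') ?_
    rintro y hy ⟨hyC, hy0⟩
    have hnA : ∀ j, 1 ≤ j → j ≤ m → y ∉ A j := fun j h1 h2 h3 =>
      hy0 ((h.map_eq_origin_iff h0 hm y).2 ⟨j, h1, h2, h3⟩)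
    have hy0' : ¬ ((val (E y)).1 = 0 ∧ (val (E y)).2 = 0) := fun h =>
      hy0 ((eq_origin_iff h0 _).2 h)
    have e1 : (χ i y).1 = 0 → y ∈ A i := fun h3 => (h.curve i hi i (by omega) y hy).2 (Or.inl ⟨rfl, h3⟩)
    have e2 : (χ i y).2 = 0 → y ∈ A (i + 1) := fun h3 =>
      (h.curve i hi (i + 1) (by omega) y hy).2 (Or.inr ⟨rfl, h3⟩)
    by_cases hs : (χ i y).1 = 0
    · have hi0 : i = 0 := by
        by_contra hi0
        exact hnA i (by omega) hi (e1 hs)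
      have hu := h.fst_eq_zero hi (e1 hs)
      refine Or.inl ⟨⟨?_, hi0⟩, hs⟩
      rcases (hC.mem_iff _).1 hyC with h1 | h1 | ⟨k, -, h1⟩
      · exact h1.1
      · exact absurd ⟨hu, h1.2⟩ hy0'
      · rw [hu, zero_pow hβ.ne', mul_zero] at h1
        exact absurd ⟨hu, (pow_eq_zero_iff hα.ne').1 h1⟩ hy0'
    · by_cases ht : (χ i y).2 = 0
      · have him : i = m := by
          by_contra him
          exact hnA (i + 1) (by omega) (by omega) (e2 ht)
        have hv := h.snd_eq_zero (by omega) (by omega) (e2 ht)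
        refine Or.inr (Or.inl ⟨⟨?_, him⟩, ht⟩)
        rcases (hC.mem_iff _).1 hyC with h1 | h1 | ⟨k, hk, h1⟩
        · exact absurd ⟨h1.2, hv⟩ hy0'
        · exact h1.1
        · rw [hv, zero_pow hα.ne'] at h1
          rcases mul_eq_zero.1 h1.symm with h2 | h2
          · exact absurd (h2 ▸ hk) hC.zero_notMem
          · exact absurd ⟨(pow_eq_zero_iff hβ.ne').1 h2, hv⟩ hy0'
      · refine Or.inr (Or.inr ((hbr _ hs ht).1 ?_))
        rw [← h.map i hi y hy]
        rcases (hC.mem_iff _).1 hyC with h1 | h1 | h1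
        · exact absurd h1.2 (h.fst_ne_zero hi hy hs ht)
        · exact absurd h1.2 (h.snd_ne_zero hi hy hs ht)
        · exact h1
  · rintro (⟨⟨ha, rfl⟩, h1⟩ | ⟨⟨hb, rfl⟩, h1⟩ | ⟨k, hk, h1⟩)
    · refine mem_closure_of_coords hx (closure_axis₁ h1) ?_
      rintro y hy ⟨h2, h3⟩
      have hA : y ∈ A 0 := (h.curve 0 hi 0 (by omega) y hy).2 (Or.inl ⟨rfl, h2⟩)
      refine ⟨(hC.mem_iff _).2 (Or.inl ⟨ha, h.fst_eq_zero hi hA⟩), fun h4 => ?_⟩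
      have h5 := ((eq_origin_iff h0 _).1 h4).2
      rw [h.map 0 hi y hy, monomialMap, h.w_zero] at h5
      simp [h3] at h5
    · refine mem_closure_of_coords hx (closure_axis₂ h1) ?_
      rintro y hy ⟨h2, h3⟩
      have hA : y ∈ A (i + 1) := (h.curve i hi _ (by omega) y hy).2 (Or.inr ⟨rfl, h3⟩)
      refine ⟨(hC.mem_iff _).2 (Or.inr (Or.inl ⟨hb, h.snd_eq_zero (by omega) le_rfl hA⟩)),
        fun h4 => ?_⟩
      have h5 := ((eq_origin_iff h0 _).1 h4).1
      rw [h.map i hi y hy, monomialMap, h.w_last] at h5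
      simp [h2] at h5
    · have hk0 : k ≠ 0 := fun h => hK' (h ▸ hk)
      refine mem_closure_of_coords hx (mem_closure_branches hpq hpq' hk0 h1) ?_
      rintro y hy ⟨h2, h3, h4⟩
      refine ⟨(hC.mem_iff _).2 (Or.inr (Or.inr ?_)), fun h5 =>
        h.fst_ne_zero hi hy h2 h3 ((eq_origin_iff h0 _).1 h5).1⟩
      rw [h.map i hi y hy]
      exact (hbr _ h2 h3).2 ⟨k, hk, h4⟩

theorem hasNormalCrossingAt_preimage (h : IsToric E m w A χ)
    (hC : IsQuasihomogeneous C α β a b K) (hα : 0 < α) (hβ : 0 < β) (hc : 1 ≤ c) (hcm : c ≤ m)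
    (hw : w c = (α, β)) {x : X} (hx : x ∈ E ⁻¹' C) : HasNormalCrossingAt (E ⁻¹' C) x := by
  obtain ⟨i, hi, hxi⟩ := h.cover x
  obtain ⟨p, q, K', hpq, hK', -, hbr⟩ := h.exists_branch_exponents hi hcm hw hC.zero_notMem
  rcases smooth_or_normalCrossing (h.mem i hi) hxi hx (by omega) hK' (fun y hy =>
    h.mem_preimage_iff hC hα hβ hc hcm hi (by omega) (by omega) hK' hbr hy) with h1 | h1
  · exact Or.inl h1
  · exact h1.1

/-- A crossing would need both axes, or a branch and an axis, in one chart. The axes of C are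
visible only in the charts 0 and m, which differ since m ≥ 1. A branch line p = 0 occurs only in the
chart c ≥ 1 and could cross only s = 0, a component only in the chart 0; likewise a line q = 0
occurs only in the chart c - 1 < m. -/
theorem isSmoothCurveAt_strictTransform (h : IsToric E m w A χ) (h0 : (0 : ℂ × ℂ) ∈ Ω)
    (hC : IsQuasihomogeneous C α β a b K) (hα : 0 < α) (hβ : 0 < β) (hc : 1 ≤ c) (hcm : c ≤ m)
    (hw : w c = (α, β)) {x : X} (hx : x ∈ strictTransform E (origin Ω h0) C) :
    IsSmoothCurveAt (strictTransform E (origin Ω h0) C) x := by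
  obtain ⟨i, hi, hxi⟩ := h.cover x
  obtain ⟨p, q, K', hpq, hK', -, hbr⟩ := h.exists_branch_exponents hi hcm hw hC.zero_notMem
  rcases smooth_or_normalCrossing (h.mem i hi) hxi hx (by omega) hK' (fun y hy =>
    h.mem_strictTransform_iff h0 hC hα hβ (by omega) hi (by omega) (by omega) hK' hbr hy) with
    h1 | ⟨-, h1 | h1 | h1⟩
  · exact h1
  · have := h1.1.2; have := h1.2.2; omega
  · have := h1.1; have := h1.2.2; omega
  · have := h1.1; have := h1.2.2; omega

/-- The branches outside the axes meet the exceptional divisor along one component. -/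
theorem strictTransform_inter_nonempty_iff (h : IsToric E m w A χ) (h0 : (0 : ℂ × ℂ) ∈ Ω)
    (hC : IsQuasihomogeneous C α β a b K) (hc : 1 ≤ c) (hcm : c ≤ m)
    (hw : w c = (α, β)) {C' : Set (ofOpens Ω)}
    (hC' : ∀ x, x ∈ C' ↔ x ∈ C ∧ (val x).1 ≠ 0 ∧ (val x).2 ≠ 0) (hne : C'.Nonempty)
    (hj : j ≤ m + 1) : (strictTransform E (origin Ω h0) C' ∩ A j).Nonempty ↔ j = c := by
  have hKC : ∀ x, x ∈ C' ↔ ((val x).1 ≠ 0 ∧ (val x).2 ≠ 0) ∧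
      ∃ k ∈ K, (val x).2 ^ α = k * (val x).1 ^ β := by
    intro x
    rw [hC', hC.mem_iff]
    tauto
  constructor
  · rintro ⟨x, hx, hxA⟩
    obtain ⟨i, hi, hxi⟩ := h.cover x
    obtain ⟨p, q, K', hpq, hK', -, hbr⟩ := h.exists_branch_exponents hi hcm hw hC.zero_notMem
    have h1 := mem_of_mem_closure_coords hxi (isClosed_branches False False p q K') (by
      rintro y hy ⟨hy1, -⟩
      obtain ⟨⟨h2, h3⟩, h4⟩ := (hKC _).1 hy1
      have hs : (χ i y).1 ≠ 0 := by
        intro hs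
        have hA : y ∈ A i := (h.curve i hi i (by omega) y hy).2 (Or.inl ⟨rfl, hs⟩)
        exact h2 (h.fst_eq_zero hi hA)
      have ht : (χ i y).2 ≠ 0 := by
        intro ht
        have hA : y ∈ A (i + 1) := (h.curve i hi _ (by omega) y hy).2 (Or.inr ⟨rfl, ht⟩)
        exact h3 (h.snd_eq_zero (by omega) (by omega) hA)
      rw [h.map i hi y hy] at h4
      exact Or.inr (Or.inr ((hbr _ hs ht).1 h4))) hx
    obtain ⟨k, hk, h1⟩ := (h1.resolve_left fun h => h.1).resolve_left fun h => h.1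
    have hk0 : k ≠ 0 := fun h => hK' (h ▸ hk)
    rcases (h.curve i hi j hj x hxi).1 hxA with ⟨rfl, h2⟩ | ⟨rfl, h2⟩
    · have hp : p = 0 := by
        by_contra hp
        rw [h2, zero_pow hp, zero_mul] at h1
        exact hk0 h1.symm
      omega
    · have hq : q = 0 := by
        by_contra hq
        rw [h2, zero_pow hq, mul_zero] at h1
        exact hk0 h1.symm
      omega
  · rintro rfl
    obtain ⟨p, q, K', hpq, hK', hne', hbr⟩ :=
      h.exists_branch_exponents hcm hcm hw hC.zero_notMem
    obtain ⟨rfl, rfl⟩ : p = 0 ∧ q = 1 := by omega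
    obtain ⟨x₀, hx₀⟩ := hne
    obtain ⟨k₀, hk₀, -⟩ := ((hKC _).1 hx₀).2
    obtain ⟨k, hk⟩ := hne' ⟨k₀, hk₀⟩
    have hk0 : k ≠ 0 := fun h => hK' (h ▸ hk)
    -- In the chart of the central curve, whose axis is s = 0, the branches are the lines t = k;
    -- they meet it at (0, k), which lies over the origin.
    have ht : ((0, k) : ℂ × ℂ) ∈ (χ j).target := by
      rw [h.target j hcm, mem_ofPred_eq]
      have h1 := h.pos j hc hcm
      have : monomialMap (w j) (w (j + 1)) (0, k) = 0 :=
        Prod.ext (by simp [monomialMap, h1.1.ne']) (by simp [monomialMap, h1.2.ne'])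
      rwa [this]
    have hs := (χ j).map_target ht
    have hv := (χ j).right_inv ht
    refine ⟨(χ j).symm (0, k), ?_, (h.curve j hcm j hj _ hs).2 (Or.inl ⟨rfl, by rw [hv]⟩)⟩
    refine mem_closure_of_coords hs (mem_closure_branches (p := 0) (q := 1) (by simp) (by simp) hk0
      (by rw [hv]; simp)) ?_
    rintro y hy ⟨h2, h3, h4⟩
    have h5 := h.fst_ne_zero hcm hy h2 h3
    refine ⟨(hKC _).2 ⟨⟨h5, h.snd_ne_zero hcm hy h2 h3⟩, ?_⟩, fun h6 =>
        h5 ((eq_origin_iff h0 _).1 h6).1⟩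
    rw [h.map j hcm y hy]
    exact (hbr _ h2 h3).2 ⟨k, hk, h4⟩

end transforms

theorem mem_innerCurves {S : Set X} : S ∈ innerCurves m A ↔ ∃ j, 1 ≤ j ∧ j ≤ m ∧ S = A j := by
  simp only [innerCurves, List.mem_map, List.mem_range]
  constructor
  · rintro ⟨j, hj, rfl⟩
    exact ⟨j + 1, by omega, by omega, rfl⟩
  · rintro ⟨j, hj, hj', rfl⟩
    exact ⟨j - 1, by omega, by congr 1; omega⟩

theorem isChainOfCurves (h : IsToric E m w A χ) (h0 : (0 : ℂ × ℂ) ∈ Ω) :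
    IsChainOfCurves (innerCurves m A) := by
  intro i j hi hj
  have hi' : i < m := by simpa [innerCurves] using hi
  have hj' : j < m := by simpa [innerCurves] using hj
  have ei : (innerCurves m A)[i] = A (i + 1) := by simp [innerCurves]
  have ej : (innerCurves m A)[j] = A (j + 1) := by simp [innerCurves]
  rw [ei, ej]
  constructor
  · rintro rfl
    exact ⟨_, h.inter_succ h0 (by omega)⟩
  · intro hij
    exact h.inter_eq_empty (by omega) (by omega)

end IsToric

end ComplexSurface

/-! ### Conclusion. -/

namespace ComplexSurface

variable {X : ComplexSurface} {Ω : TopologicalSpace.Opens (ℂ × ℂ)}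

/-- The inner curves lie over the origin, so on them attaching locus and strict transform coincide.
-/
theorem IsToric.attachingLocus_inter_nonempty_iff {E : X → ofOpens Ω} {m : ℕ} {w : ℕ → ℕ × ℕ}
    {A : ℕ → Set X} {χ : ℕ → OpenPartialHomeomorph X (ℂ × ℂ)} (h : IsToric E m w A χ)
    (h0 : (0 : ℂ × ℂ) ∈ Ω) {j : ℕ} (hj : 1 ≤ j) (hjm : j ≤ m) (S : Set (ofOpens Ω)) :
    (attachingLocus E (origin Ω h0) S ∩ A j).Nonempty ↔
      (strictTransform E (origin Ω h0) S ∩ A j).Nonempty := by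
  refine ⟨fun ⟨x, hx, hxA⟩ => ⟨x, hx.1, hxA⟩, fun ⟨x, hx, hxA⟩ => ⟨x, ⟨hx, ?_⟩, hxA⟩⟩
  exact (h.map_eq_origin_iff h0 (by omega) x).2 ⟨j, hj, hjm, hxA⟩

/-- A curve of the configuration is determined by the property of being the only one to meet a given
set. -/
theorem inter_nonempty_iff_of_unique {A : ℕ → Set X} {T : Set X} {m c : ℕ} (hc : 1 ≤ c) (hcm : c ≤ m)
    (h : ∀ j, 1 ≤ j → j ≤ m → ((T ∩ A j).Nonempty ↔ j = c)) {S : Set X} (hS : S ∈ innerCurves m A) :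
    (T ∩ S).Nonempty ↔ A c = S := by
  obtain ⟨j, hj, hjm, rfl⟩ := IsToric.mem_innerCurves.1 hS
  constructor
  · intro h1
    rw [(h j hj hjm).1 h1]
  · intro h1
    rw [← h1]
    exact (h c hc hcm).2 rfl

end ComplexSurface

open ComplexSurface MvPolynomial in
theorem mainTheorem4 (α β γ : ℕ) (hα : 0 < α) (hαβ : α < β) (hcop : Nat.Coprime α β) (hγ : 0 < γ)
    (f : MvPolynomial (Fin 2) ℂ) (hf : IsWeightedHomogeneous ![α, β] f γ) (hred : Squarefree f)
    (Ω : TopologicalSpace.Opens (ℂ × ℂ)) (h0 : (0 : ℂ × ℂ) ∈ Ω) :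
    (∃ (M : ComplexSurface) (E : M → ofOpens Ω) (D : List (Set M)),
      IsChainComposition (euclidQuotients β α) (ofOpens Ω) (origin Ω h0) (zeroSet Ω (X 1)) M E D) ∧
    ∀ (M : ComplexSurface) (E : M → ofOpens Ω) (D : List (Set M)),
      IsChainComposition (euclidQuotients β α) (ofOpens Ω) (origin Ω h0) (zeroSet Ω (X 1)) M E D →
      -- `E` is a desingularization, the minimal one as soon as there is something to desingularize
      IsDesingularization E (zeroSet Ω f) ∧
      (∀ x ∈ strictTransform E (origin Ω h0) (zeroSet Ω f),
        IsSmoothCurveAt (strictTransform E (origin Ω h0) (zeroSet Ω f)) x) ∧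
      (¬ HasNormalCrossingAt (zeroSet Ω f) (origin Ω h0) →
        IsMinimalDesingularization E (zeroSet Ω f)) ∧
      -- the exceptional divisor is a chain, whose two ends carry the strict transforms of the axes
      E ⁻¹' {origin Ω h0} = {x | ∃ A ∈ D, x ∈ A} ∧
      (∃ L : List (Set M), L.Perm D ∧ IsChainOfCurves L ∧
        (∀ A ∈ D, (attachingLocus E (origin Ω h0) (zeroSet Ω (X 0)) ∩ A).Nonempty ↔
          L.head? = some A) ∧
        (∀ A ∈ D, (attachingLocus E (origin Ω h0) (zeroSet Ω (X 1)) ∩ A).Nonempty ↔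
          L.getLast? = some A)) ∧
      -- the central component is the last one created: the only one that meets the strict
      -- transform of the branches other than the axes
      ((zeroSet Ω f \ zeroSet Ω (X 0 * X 1)).Nonempty →
        ∀ A ∈ D, (attachingLocus E (origin Ω h0)
          (zeroSet Ω f \ zeroSet Ω (X 0 * X 1)) ∩ A).Nonempty ↔ D.getLast? = some A) := by
  have hβ : 0 < β := hα.trans hαβ
  obtain ⟨a, b, K, hC⟩ := exists_isQuasihomogeneous hα hβ hcop hγ hred.ne_zero hf Ω
  obtain ⟨χ₀, t₀⟩ := exists_isToric_id h0
  have hadj : Adjacent 0 0 1 := Or.inl ⟨rfl, le_rfl⟩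
  obtain ⟨p, hp⟩ := t₀.exists_inter_eq h0 hadj
  obtain rfl : p = origin Ω h0 := by
    have h1 := hp.symm ▸ mem_singleton p
    rw [IsToric.eq_origin_iff]
    exact ⟨t₀.fst_eq_zero le_rfl h1.1, t₀.snd_eq_zero le_rfl le_rfl h1.2⟩
  refine ⟨exists_isChainComposition α t₀ h0 hadj hp hαβ, fun M E D hE => ?_⟩
  obtain ⟨m, w, A, χ, c, t, R, hw, hcm, -, hlast, hfac⟩ :=
    hE.isToric t₀ h0 hadj hp rfl rfl hαβ hcop.symm (α := α) (β := β) (by simp)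
  have hl : euclidQuotients β α ≠ [] := by
    rw [euclidQuotients_of_ne_zero _ hα.ne']
    exact List.cons_ne_nil _ _
  obtain ⟨hc, hcm⟩ := hcm (Or.inl hl)
  have hlast := hlast hl
  have hm : 1 ≤ m := hc.trans hcm
  rw [Function.id_comp] at t
  -- The plane has no inner curve at the start, so `D` accounts for all of them.
  have hperm : (innerCurves m A).Perm D := by simpa [innerCurves] using R.perm
  have hdes : IsDesingularization E (zeroSet Ω f) :=
    ⟨R.composition, fun x hx => t.hasNormalCrossingAt_preimage hC hα hβ hc hcm hw hx⟩
  refine ⟨hdes, fun x hx => t.isSmoothCurveAt_strictTransform h0 hC hα hβ hc hcm hw hx,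
    fun hnc => ⟨hdes, fun X' E' hE' => ?_⟩, ?_, ⟨innerCurves m A, hperm, t.isChainOfCurves h0, ?_, ?_⟩,
    ?_⟩
  · have hK : K.Nonempty ∧ (2 ≤ α ∨ b ∨ ∃ c₁ ∈ K, ∃ c₂ ∈ K, c₁ ≠ c₂) := by
      by_contra h
      exact hnc (hC.hasNormalCrossingAt hα hβ h0 h)
    -- At the start S is the axis v = 0, which is in the total transform only if b holds; when α =
    -- 1, either b or a second branch is therefore needed at the first stage, and β ≥ 2.
    obtain ⟨g, hg, hg'⟩ := hfac _ a b K hC hα hβ hcop hK.1 (by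
      rcases hK.2 with h1 | h1 | h1
      · exact Or.inr (Or.inl h1)
      · rcases Nat.lt_or_ge α 2 with h2 | h2
        · exact Or.inr (Or.inr ⟨by omega, by omega, Or.inl ⟨by omega, fun _ => h1⟩⟩)
        · exact Or.inr (Or.inl h2)
      · rcases Nat.lt_or_ge α 2 with h2 | h2
        · exact Or.inr (Or.inr ⟨by omega, by omega, Or.inr h1⟩)
        · exact Or.inr (Or.inl h2)) X' E' hE'.1.isModification hE'.2
    exact ⟨g, hg.isHolomorphic, hg'⟩
  · ext x
    refine (t.map_eq_origin_iff h0 hm x).trans ?_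
    simp only [mem_ofPred_eq, ← hperm.mem_iff, IsToric.mem_innerCurves]
    constructor
    · rintro ⟨j, h1, h2, h3⟩
      exact ⟨_, ⟨j, h1, h2, rfl⟩, h3⟩
    · rintro ⟨_, ⟨j, h1, h2, rfl⟩, h3⟩
      exact ⟨j, h1, h2, h3⟩
  · intro S hS
    have hhead : (innerCurves m A).head? = some (A 1) := by
      obtain ⟨m, rfl⟩ : ∃ l, m = l + 1 := ⟨m - 1, by omega⟩
      simp [innerCurves, List.range_succ_eq_map]
    rw [hhead, Option.some_inj]
    refine inter_nonempty_iff_of_unique le_rfl hm (fun j hj hjm => ?_) (hperm.mem_iff.2 hS)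
    rw [t.attachingLocus_inter_nonempty_iff h0 hj hjm]
    -- The strict transforms of the axes are the two outer curves A 0 and A (m + 1), whose only
    -- inner neighbours are A 1 and A m.
    have h1 : A 0 = strictTransform E (origin Ω h0) (zeroSet Ω (X 0)) := R.first
    rw [← h1]
    constructor
    · intro h2
      by_contra h3
      rw [t.inter_eq_empty (by omega) (by omega)] at h2
      exact not_nonempty_empty h2
    · rintro rfl
      rw [t.inter_succ h0 (Nat.zero_le _)]
      exact singleton_nonempty _
  · intro S hS
    have hend : (innerCurves m A).getLast? = some (A m) := by
      obtain ⟨m, rfl⟩ : ∃ l, m = l + 1 := ⟨m - 1, by omega⟩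
      simp [innerCurves, List.range_succ]
    rw [hend, Option.some_inj]
    refine inter_nonempty_iff_of_unique hm le_rfl (fun j hj hjm => ?_) (hperm.mem_iff.2 hS)
    rw [t.attachingLocus_inter_nonempty_iff h0 hj hjm]
    have h1 : A (m + 1) = strictTransform E (origin Ω h0) (zeroSet Ω (X 1)) := R.last
    rw [← h1, inter_comm]
    constructor
    · intro h2
      by_contra h3
      rw [t.inter_eq_empty (by omega) le_rfl] at h2
      exact not_nonempty_empty h2
    · rintro rfl
      rw [t.inter_succ h0 le_rfl]
      exact singleton_nonempty _
  · intro hne S hS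
    rw [hlast, Option.some_inj]
    refine inter_nonempty_iff_of_unique hc hcm (fun j hj hjm => ?_) (hperm.mem_iff.2 hS)
    rw [t.attachingLocus_inter_nonempty_iff h0 hj hjm]
    refine t.strictTransform_inter_nonempty_iff h0 hC hc hcm hw (fun x => and_congr_right fun _ => ?_)
      hne (by omega)
    have h1 : x ∈ zeroSet Ω (X 0 * X 1) ↔ (val x).1 * (val x).2 = 0 := by
      change eval _ _ = 0 ↔ _
      rw [map_mul, eval_X, eval_X]
      rfl
    rw [h1, mul_eq_zero, not_or]
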